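/- Let $M$ be a von Neumann algebra with a tracial state $\varphi$, and let $M_k^{sa}(\mathbb C)$ be the space of selfadjoint complex $k\times k$ matrices. For an $n$-tuple $X=(x_1,\dots,x_n)$ of selfadjoint elements of $M$, $m,k\in\mathbb N$ and $\gamma>0$, let $\Gamma(X;m,k,\gamma)$ be the set of $(a_1,\dots,a_n)\in (M_k^{sa}(\mathbb C))^n$ such that $|tr_k(a_{i_1}\cdots a_{i_p})-\varphi(x_{i_1}\cdots x_{i_p})|<\gamma$ for all $1\le p\le m$ and $1\le i_1,\dots,i_p\le n$, where $tr_k$ is the normalized trace. Let $\mathrm{vol}$ be Lebesgue measure on $(M_k^{sa}(\mathbb C))^n$ with respect to the Euclidean norm $|(a_1,\dots,a_n)|_2=(\sum_i tr_k(a_i^2))^{1/2}$. With $\log 0=-\infty$, put $$\chi(X)=\inf_{m\in\mathbb N,\ \gamma>0}\ \limsup_{k\to\infty}\left[k^{-2}\log \mathrm{vol}(\Gamma(X;m,k,\gamma))+n\log k\right].$$ Let $F$ be an $n$-tuple of selfadjoint elements of $M$ and let $a=a^*\in M$. A bounded microstate sequence for $a$ is a sequence $(a_k)_k$ with $a_k\in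 M_k^{sa}(\mathbb C)$ such that $\sup_k\|a_k\|<\infty$ in operator norm and, for all $m\in\mathbb N$ and $\gamma>0$, $a_k\in\Gamma(a;m,k,\gamma)$ for all sufficiently large $k$. For such a sequence let $\Xi(F;m,k,\gamma)=\{\xi\in(M_k^{sa}(\mathbb C))^n:(\xi,a_k)\in\Gamma(F\cup\{a\};m,k,\gamma)\}$ and $$\chi(\Xi(F))=\inf_{m\in\mathbb N,\ \gamma>0}\ \limsup_{k\to\infty}\left[k^{-2}\log \mathrm{vol}(\Xi(F;m,k,\gamma))+n\log k\right].$$ **Lemma 2.3.** Bounded microstate sequences for $a$ exist. The quantity $\chi(\Xi(F))$ does not depend on the choice of the bounded microstate sequence for $a$; denote it by $\chi(F/a)$. Both $\chi(F/a)$ and $\chi(a)$ lie in $[-\infty,\infty)$, and $$\chi(F\cup\{a\})=\chi(F/a)+\chi(a).$$ -/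

import Mathlib

open Filter MeasureTheory Matrix
open scoped ENNReal Topology

noncomputable section

namespace FreeEntropy

/-! ### Selfadjoint matrices as a Euclidean space -/

/-- `SaMat k` is the real vector space of selfadjoint complex `k × k` matrices. -/
def SaMat (k : ℕ) : Type := selfAdjoint (Matrix (Fin k) (Fin k) ℂ)

instance (k : ℕ) : AddCommGroup (SaMat k) :=
  inferInstanceAs (AddCommGroup (selfAdjoint (Matrix (Fin k) (Fin k) ℂ)))

instance (k : ℕ) : Module ℝ (SaMat k) :=
  inferInstanceAs (Module ℝ (selfAdjoint (Matrix (Fin k) (Fin k) ℂ)))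

/-- The inclusion of selfadjoint matrices into all matrices. -/
def SaMat.toMatrix {k : ℕ} : SaMat k →ₗ[ℝ] Matrix (Fin k) (Fin k) ℂ :=
  (selfAdjoint.submodule ℝ (Matrix (Fin k) (Fin k) ℂ)).subtype

theorem SaMat.toMatrix_injective {k : ℕ} :
    Function.Injective (SaMat.toMatrix : SaMat k → Matrix (Fin k) (Fin k) ℂ) :=
  Subtype.val_injective

theorem SaMat.conjTranspose_toMatrix {k : ℕ} (a : SaMat k) :
    (a.toMatrix)ᴴ = a.toMatrix := a.2

/-- The normalized trace `tr_k` on the `k × k` matrices. -/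
def ntr {k : ℕ} (A : Matrix (Fin k) (Fin k) ℂ) : ℂ := A.trace / (k : ℂ)

/-- The operator norm of a matrix acting on the Hilbert space `ℂ^k`. -/
def opNorm {k : ℕ} (A : Matrix (Fin k) (Fin k) ℂ) : ℝ := ‖Matrix.toEuclideanCLM (𝕜 := ℂ) A‖

theorem re_ntr_sq {k : ℕ} (a : SaMat k) :
    (ntr (a.toMatrix * a.toMatrix)).re = (∑ i, ∑ j, ‖a.toMatrix i j‖ ^ 2) / k := by
  have h : (a.toMatrix * a.toMatrix).trace = ((∑ i, ∑ j, ‖a.toMatrix i j‖ ^ 2 : ℝ) : ℂ) := by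
    rw [Matrix.trace]
    push_cast
    refine Finset.sum_congr rfl fun i _ => ?_
    rw [Matrix.diag_apply, Matrix.mul_apply]
    refine Finset.sum_congr rfl fun j _ => ?_
    have h1 : a.toMatrix j i = star (a.toMatrix i j) := by
      conv_lhs => rw [← a.conjTranspose_toMatrix]
      rfl
    rw [h1]
    exact Complex.mul_conj' _
  rw [ntr, h, ← Complex.ofReal_natCast, ← Complex.ofReal_div, Complex.ofReal_re]

/-- The inner product `⟨a, b⟩ = tr_k(ab)` on selfadjoint matrices. -/
@[reducible] def saCore (k : ℕ) : InnerProductSpace.Core ℝ (SaMat k) where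
  inner a b := (ntr (a.toMatrix * b.toMatrix)).re
  conj_inner_symm a b := by
    simp only [ntr, conj_trivial]
    rw [Matrix.trace_mul_comm]
  re_inner_nonneg a := by
    simp only [RCLike.re_to_real]
    rw [re_ntr_sq]
    positivity
  add_left a b c := by
    simp [ntr, add_mul, add_div]
  smul_left a b r := by
    have h : (r : ℂ) * (a.toMatrix * b.toMatrix).trace / (k : ℂ)
        = (r : ℂ) * ((a.toMatrix * b.toMatrix).trace / (k : ℂ)) := mul_div_assoc _ _ _
    simp [ntr, h]
  definite a h := by
    rw [re_ntr_sq] at h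
    apply SaMat.toMatrix_injective
    rw [map_zero]
    ext i j
    have hk : (k : ℝ) ≠ 0 := by
      have := i.pos
      positivity
    rw [div_eq_zero_iff, or_iff_left hk] at h
    have h1 := (Finset.sum_eq_zero_iff_of_nonneg fun i _ => by positivity).1 h i (Finset.mem_univ i)
    have h2 := (Finset.sum_eq_zero_iff_of_nonneg fun j _ => by positivity).1 h1 j
      (Finset.mem_univ j)
    simpa using h2

/-- The norm `|a|₂ = tr_k(a²)^{1/2}` on selfadjoint matrices. -/
instance (k : ℕ) : NormedAddCommGroup (SaMat k) := (saCore k).toNormedAddCommGroup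

instance (k : ℕ) : InnerProductSpace ℝ (SaMat k) := InnerProductSpace.ofCore (saCore k).toCore

instance (k : ℕ) : FiniteDimensional ℝ (SaMat k) :=
  FiniteDimensional.of_injective SaMat.toMatrix SaMat.toMatrix_injective

instance (k : ℕ) : MeasurableSpace (SaMat k) := borel _

instance (k : ℕ) : BorelSpace (SaMat k) := ⟨rfl⟩

/-- Lebesgue measure on `n`-tuples of selfadjoint `k × k` matrices. On one copy of `SaMat k`,
`volume` is the Lebesgue measure of the Euclidean norm `|·|₂` (the cube spanned by an orthonormal
basis has volume one). On tuples it is the product measure, which is the Lebesgue measure of the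
Euclidean norm `|(a₁, …, aₙ)|₂ = (∑ i, tr_k(a_i²))^{1/2}`. -/
def vol (n k : ℕ) : Measure (Fin n → SaMat k) := volume

/-! ### Microstates and free entropy -/

/-- A tracial state on a C⋆-algebra. -/
structure IsTracialState {M : Type*} [CStarAlgebra M] (φ : M →ₗ[ℂ] ℂ) : Prop where
  map_one : φ 1 = 1
  nonneg : ∀ x : M, 0 ≤ (φ (star x * x)).re ∧ (φ (star x * x)).im = 0
  tracial : ∀ x y : M, φ (x * y) = φ (y * x)

/-- The microstate space `Γ(X; m, k, γ)`: tuples of selfadjoint `k × k` matrices whose mixed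
moments of order `1 ≤ p ≤ m` are within `γ` of those of `X`. -/
def microstates {M : Type*} [CStarAlgebra M] (φ : M →ₗ[ℂ] ℂ) {n : ℕ} (X : Fin n → M)
    (m k : ℕ) (γ : ℝ) : Set (Fin n → SaMat k) :=
  {A | ∀ p : ℕ, 1 ≤ p → p ≤ m → ∀ i : Fin p → Fin n,
    ‖ntr (List.ofFn fun j => (A (i j)).toMatrix).prod - φ (List.ofFn fun j => X (i j)).prod‖ < γ}

/-- For a family `S m k γ` of sets of `n`-tuples of `k × k` matrices, the infimum over `m` and
`γ > 0` of `limsup_k [k⁻² log vol(S m k γ) + n log k]`, where `log 0 = -∞`. -/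
def asymptoticEntropy {n : ℕ} (S : ∀ (_ k : ℕ) (_ : ℝ), Set (Fin n → SaMat k)) : EReal :=
  ⨅ (m : ℕ) (γ : ℝ) (_ : 0 < γ),
    limsup (fun k : ℕ =>
      ((((k : ℝ) ^ 2)⁻¹ : ℝ) : EReal) * ENNReal.log (vol n k (S m k γ))
        + ((n * Real.log k : ℝ) : EReal)) atTop

/-- The free entropy `χ(X)`. -/
def freeEntropy {M : Type*} [CStarAlgebra M] (φ : M →ₗ[ℂ] ℂ) {n : ℕ} (X : Fin n → M) : EReal :=
  asymptoticEntropy (microstates φ X)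

/-- The tuple `F ∪ {a} = (f₁, …, fₙ, a)`. -/
def adjoin {α : Type*} {n : ℕ} (F : Fin n → α) (a : α) : Fin (n + 1) → α :=
  Fin.snoc (α := fun _ => α) F a

/-- A microstate sequence for `a` that is uniformly bounded in operator norm. -/
structure IsMicrostateSeq {M : Type*} [CStarAlgebra M] (φ : M →ₗ[ℂ] ℂ) (a : M)
    (s : ∀ k : ℕ, SaMat k) : Prop where
  approx : ∀ (m : ℕ) (γ : ℝ), 0 < γ → ∀ᶠ k in atTop, ![s k] ∈ microstates φ ![a] m k γ
  bounded : ∃ R : ℝ, ∀ k, opNorm (s k).toMatrix ≤ R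

/-- The relative microstate space `Ξ(F; m, k, γ)` with respect to the sequence `s` for `a`. -/
def relMicrostates {M : Type*} [CStarAlgebra M] (φ : M →ₗ[ℂ] ℂ) {n : ℕ} (F : Fin n → M) (a : M)
    (s : ∀ k : ℕ, SaMat k) (m k : ℕ) (γ : ℝ) : Set (Fin n → SaMat k) :=
  {ξ | adjoin ξ (s k) ∈ microstates φ (adjoin F a) m k γ}

/-- The relative free entropy `χ(F/a)`, computed with the microstate sequence `s` for `a`. -/
def relFreeEntropy {M : Type*} [CStarAlgebra M] (φ : M →ₗ[ℂ] ℂ) {n : ℕ} (F : Fin n → M) (a : M)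
    (s : ∀ k : ℕ, SaMat k) : EReal :=
  asymptoticEntropy (relMicrostates φ F a s)

end FreeEntropy

end

open Filter MeasureTheory Matrix
open scoped ENNReal Topology

noncomputable section

namespace FreeEntropy

/-! ### Unitary conjugation and diagonal matrices -/

/-! By Fubini the volume of the microstates of F ∪ {a} is the integral, over b, of the volume of the
slice of tuples ξ for which (ξ, b) is a microstate. A slice is empty unless b is a microstate for a.
If all slices over microstates of a have comparable volume, the total is roughly the volume of Ξ
times the volume of Γ(a). Normalized logarithms then give the formula, except that an upper limit of
a sum is only at most the sum of the upper limits. So two facts carry the proof: slices are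
comparable, and χ(a) is attained along all large k, not only along a subsequence.

Comparability. The moments of a are those of a compactly supported probability measure. Two k × k
matrices whose moments are close enough to these have increasing eigenvalue lists close in
normalized ℓ² (`eventually_monotone_close`), so a unitary carries one near the other in |·|₂. This
unitary moves the whole tuple, and the last entry is then exchanged. Microstates carry no operator
norm bound, so the effect on mixed moments is controlled by Cauchy–Schwarz and a chessboard estimate
(`exists_norm_ntr_wordProd_le`), which bounds traces of words by traces of 2^r-th powers; these are
prescribed moments. Conjugation preserves volume, hence a slice at fine tolerance is no larger than
any other slice at coarse tolerance (`eventually_vol_slice_le`). This gives independence of the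
sequence and the inequality ≤.

Limit. For ≥ the volume of Γ(a) must be bounded below for every large k (`eventually_le_single`).
The Weyl formula (`lintegral_eq_weyl`) turns this volume into an integral of the squared Vandermonde
product over increasing eigenvalue lists, with a constant whose normalized logarithm converges. A
large volume at one large k₀ yields a list of k₀ reals with large logarithmic energy. Repeating its
points in blocks and spreading each block over a length δ gives, for all large k, a box of lists
with nearly the same moments and energy.

The Weyl formula is proved by induction on k. Border a diagonal matrix with entries y by a vector v
and a corner t. The new spectrum x interlaces y and is given by the secular equation, which depends
on t and the |v i|² only. The map from x to (t, |v i|²) has Jacobian vdm x / vdm y, and integrating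
vdm y over the y interlacing x gives vdm x / k!.

Bounded microstate sequences come from sampling the spectral distribution of a by the strong law of
large numbers. Neither entropy is ⊤, because the second moment is bounded and a Gaussian then
dominates the volume. -/

theorem SaMat.norm_sq_eq {k : ℕ} (a : SaMat k) :
    ‖a‖ ^ 2 = (∑ i, ∑ j, ‖a.toMatrix i j‖ ^ 2) / k := by
  rw [← re_ntr_sq, ← real_inner_self_eq_norm_sq]
  rfl

theorem SaMat.norm_sq_eq_re_ntr {k : ℕ} (a : SaMat k) :
    ‖a‖ ^ 2 = (ntr (a.toMatrix * a.toMatrix)).re := by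
  rw [SaMat.norm_sq_eq, re_ntr_sq]

theorem SaMat.continuous_toMatrix {k : ℕ} :
    Continuous (SaMat.toMatrix : SaMat k → Matrix (Fin k) (Fin k) ℂ) :=
  SaMat.toMatrix.continuous_of_finiteDimensional

/-- The selfadjoint matrix with a given Hermitian underlying matrix. -/
def SaMat.mk {k : ℕ} (A : Matrix (Fin k) (Fin k) ℂ) (h : Aᴴ = A) : SaMat k := ⟨A, h⟩

@[simp] theorem SaMat.toMatrix_mk {k : ℕ} (A : Matrix (Fin k) (Fin k) ℂ) (h : Aᴴ = A) :
    (SaMat.mk A h).toMatrix = A := rfl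

theorem ntr_mul_comm {k : ℕ} (A B : Matrix (Fin k) (Fin k) ℂ) : ntr (A * B) = ntr (B * A) := by
  rw [ntr, ntr, Matrix.trace_mul_comm]

theorem ntr_conj {k : ℕ} (U : unitaryGroup (Fin k) ℂ) (A : Matrix (Fin k) (Fin k) ℂ) :
    ntr ((U : Matrix (Fin k) (Fin k) ℂ) * A * (U : Matrix (Fin k) (Fin k) ℂ)ᴴ) = ntr A := by
  rw [ntr_mul_comm, ← mul_assoc]
  have : (U : Matrix (Fin k) (Fin k) ℂ)ᴴ * (U : Matrix (Fin k) (Fin k) ℂ) = 1 :=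
    Unitary.coe_star_mul_self U
  rw [this, one_mul]

/-- Conjugation `A ↦ U A U⋆` by a unitary, as a linear map on selfadjoint matrices. -/
def SaMat.conjLin {k : ℕ} (U : unitaryGroup (Fin k) ℂ) : SaMat k →ₗ[ℝ] SaMat k where
  toFun a := SaMat.mk ((U : Matrix (Fin k) (Fin k) ℂ) * a.toMatrix *
    (U : Matrix (Fin k) (Fin k) ℂ)ᴴ) (by
      simp only [conjTranspose_mul, conjTranspose_conjTranspose, a.conjTranspose_toMatrix,
        mul_assoc])
  map_add' a b := SaMat.toMatrix_injective (by simp [mul_add, add_mul])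
  map_smul' r a := SaMat.toMatrix_injective (by simp)

theorem SaMat.toMatrix_conjLin {k : ℕ} (U : unitaryGroup (Fin k) ℂ) (a : SaMat k) :
    (SaMat.conjLin U a).toMatrix = (U : Matrix (Fin k) (Fin k) ℂ) * a.toMatrix *
    (U : Matrix (Fin k) (Fin k) ℂ)ᴴ := rfl

theorem SaMat.conjLin_mul {k : ℕ} (U V : unitaryGroup (Fin k) ℂ) (a : SaMat k) :
    SaMat.conjLin (U * V) a = SaMat.conjLin U (SaMat.conjLin V a) := by
  apply SaMat.toMatrix_injective
  simp [SaMat.toMatrix_conjLin, mul_assoc]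

theorem SaMat.conjLin_one {k : ℕ} (a : SaMat k) : SaMat.conjLin 1 a = a := by
  apply SaMat.toMatrix_injective
  simp [SaMat.toMatrix_conjLin]

/-- Conjugation `A ↦ U A U⋆` by a unitary is a linear isometry of `SaMat k`. -/
def SaMat.conj {k : ℕ} (U : unitaryGroup (Fin k) ℂ) : SaMat k ≃ₗᵢ[ℝ] SaMat k where
  toLinearEquiv := LinearEquiv.ofLinearMap (SaMat.conjLin U) (SaMat.conjLin U⁻¹)
    (LinearMap.ext fun a => by simp [← SaMat.conjLin_mul, SaMat.conjLin_one])
    (LinearMap.ext fun a => by simp [← SaMat.conjLin_mul, SaMat.conjLin_one])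
  norm_map' a := by
    refine (sq_eq_sq₀ (norm_nonneg _) (norm_nonneg _)).1 ?_
    simp only [SaMat.norm_sq_eq_re_ntr, LinearEquiv.coe_ofLinearMap]
    have hU : (U : Matrix (Fin k) (Fin k) ℂ)ᴴ * (U : Matrix (Fin k) (Fin k) ℂ) = 1 :=
      Unitary.coe_star_mul_self U
    have : (SaMat.conjLin U a).toMatrix * (SaMat.conjLin U a).toMatrix =
        (U : Matrix (Fin k) (Fin k) ℂ) * (a.toMatrix * a.toMatrix) *
          (U : Matrix (Fin k) (Fin k) ℂ)ᴴ := by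
      rw [SaMat.toMatrix_conjLin]
      calc _ = (U : Matrix (Fin k) (Fin k) ℂ) * a.toMatrix *
            ((U : Matrix (Fin k) (Fin k) ℂ)ᴴ * (U : Matrix (Fin k) (Fin k) ℂ)) * a.toMatrix *
            (U : Matrix (Fin k) (Fin k) ℂ)ᴴ := by simp only [mul_assoc]
        _ = _ := by rw [hU]; simp only [mul_assoc, one_mul]
    rw [this, ntr_conj]

theorem SaMat.toMatrix_conj {k : ℕ} (U : unitaryGroup (Fin k) ℂ) (a : SaMat k) :
    (SaMat.conj U a).toMatrix = (U : Matrix (Fin k) (Fin k) ℂ) * a.toMatrix *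
    (U : Matrix (Fin k) (Fin k) ℂ)ᴴ := rfl

theorem SaMat.conj_mul {k : ℕ} (U V : unitaryGroup (Fin k) ℂ) (a : SaMat k) :
    SaMat.conj (U * V) a = SaMat.conj U (SaMat.conj V a) := SaMat.conjLin_mul U V a

theorem SaMat.conj_inv_conj {k : ℕ} (U : unitaryGroup (Fin k) ℂ) (a : SaMat k) :
    SaMat.conj U⁻¹ (SaMat.conj U a) = a := by
  rw [← SaMat.conj_mul, inv_mul_cancel]
  exact SaMat.conjLin_one a

theorem prod_ofFn_conj {k p : ℕ} (U : unitaryGroup (Fin k) ℂ) (a : Fin p → SaMat k) :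
    (List.ofFn fun j => (SaMat.conj U (a j)).toMatrix).prod =
      (U : Matrix (Fin k) (Fin k) ℂ) * (List.ofFn fun j => (a j).toMatrix).prod *
      (U : Matrix (Fin k) (Fin k) ℂ)ᴴ := by
  have hU : (U : Matrix (Fin k) (Fin k) ℂ)ᴴ * (U : Matrix (Fin k) (Fin k) ℂ) = 1 :=
    Unitary.coe_star_mul_self U
  have hU' : (U : Matrix (Fin k) (Fin k) ℂ) * (U : Matrix (Fin k) (Fin k) ℂ)ᴴ = 1 :=
    Unitary.coe_mul_star_self U
  induction p with
  | zero => simp [hU']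
  | succ p ih =>
    rw [List.ofFn_succ, List.ofFn_succ, List.prod_cons, List.prod_cons, ih fun j => a j.succ,
      SaMat.toMatrix_conj]
    calc _ = (U : Matrix (Fin k) (Fin k) ℂ) * (a 0).toMatrix *
          ((U : Matrix (Fin k) (Fin k) ℂ)ᴴ * (U : Matrix (Fin k) (Fin k) ℂ)) *
          (List.ofFn fun j : Fin p => (a j.succ).toMatrix).prod *
          (U : Matrix (Fin k) (Fin k) ℂ)ᴴ := by simp only [mul_assoc]
      _ = _ := by rw [hU]; simp only [mul_assoc, one_mul]

/-- The diagonal selfadjoint matrix with given real entries. -/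
def SaMat.diag {k : ℕ} (x : Fin k → ℝ) : SaMat k :=
  SaMat.mk (diagonal fun i => (x i : ℂ)) (by
    rw [diagonal_conjTranspose]; congr 1; ext i; simp)

@[simp] theorem SaMat.toMatrix_diag {k : ℕ} (x : Fin k → ℝ) :
    (SaMat.diag x).toMatrix = diagonal fun i => (x i : ℂ) := rfl

theorem SaMat.continuous_diag {k : ℕ} : Continuous (SaMat.diag : (Fin k → ℝ) → SaMat k) := by
  let L : (Fin k → ℝ) →ₗ[ℝ] SaMat k :=
    { toFun := SaMat.diag
      map_add' := fun x y => SaMat.toMatrix_injective (by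
        simp only [map_add, SaMat.toMatrix_diag, diagonal_add, Pi.add_apply, Complex.ofReal_add])
      map_smul' := fun r x => SaMat.toMatrix_injective (by
        ext i j
        by_cases h : i = j
        · subst h; simp
        · simp [h]) }
  exact L.continuous_of_finiteDimensional

theorem SaMat.isHermitian {k : ℕ} (a : SaMat k) : a.toMatrix.IsHermitian :=
  a.conjTranspose_toMatrix

theorem SaMat.exists_eq_conj_diag_eigenvalues {k : ℕ} (a : SaMat k) :
    ∃ U : unitaryGroup (Fin k) ℂ, a = SaMat.conj U (SaMat.diag a.isHermitian.eigenvalues) :=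
  ⟨a.isHermitian.eigenvectorUnitary, SaMat.toMatrix_injective (by
    conv_lhs => rw [a.isHermitian.spectral_theorem]
    rfl)⟩

/-- Equal characteristic polynomials give the same ordered eigenvalue list, so both matrices are
unitarily conjugate to one diagonal matrix. -/
theorem SaMat.exists_conj_of_charpoly_eq {k : ℕ} (a b : SaMat k)
    (h : a.toMatrix.charpoly = b.toMatrix.charpoly) :
    ∃ U : unitaryGroup (Fin k) ℂ, a = SaMat.conj U b := by
  obtain ⟨U, hU⟩ := a.exists_eq_conj_diag_eigenvalues
  obtain ⟨V, hV⟩ := b.exists_eq_conj_diag_eigenvalues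
  rw [(a.isHermitian.eigenvalues_eq_eigenvalues_iff b.isHermitian).2 h] at hU
  refine ⟨U * V⁻¹, ?_⟩
  rw [SaMat.conj_mul, hV, SaMat.conj_inv_conj, ← hU]

open Polynomial in
theorem SaMat.charpoly_diag {k : ℕ} (x : Fin k → ℝ) :
    (SaMat.diag x).toMatrix.charpoly = ∏ i, (X - C (x i : ℂ)) := by
  simp [charpoly_diagonal]

theorem SaMat.exists_eq_conj_diag_monotone {k : ℕ} (a : SaMat k) :
    ∃ (U : unitaryGroup (Fin k) ℂ) (x : Fin k → ℝ), Monotone x ∧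
      a = SaMat.conj U (SaMat.diag x) := by
  set x := a.isHermitian.eigenvalues
  have h := SaMat.exists_conj_of_charpoly_eq a (SaMat.diag (x ∘ Tuple.sort x)) (by
    rw [SaMat.charpoly_diag, a.isHermitian.charpoly_eq]
    exact (Equiv.prod_comp (Tuple.sort x) fun i => Polynomial.X - Polynomial.C (x i : ℂ)).symm)
  exact ⟨h.choose, _, Tuple.monotone_sort x, h.choose_spec⟩

theorem SaMat.diag_pow {k : ℕ} (x : Fin k → ℝ) (p : ℕ) :
    ntr ((SaMat.diag x).toMatrix ^ p) = (((∑ i, x i ^ p) / k : ℝ) : ℂ) := by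
  rw [SaMat.toMatrix_diag, Matrix.diagonal_pow, ntr, Matrix.trace_diagonal]
  push_cast
  rfl

theorem SaMat.norm_sq_diag {k : ℕ} (x : Fin k → ℝ) :
    ‖SaMat.diag x‖ ^ 2 = (∑ i, x i ^ 2) / k := by
  rw [SaMat.norm_sq_eq_re_ntr, ← pow_two, SaMat.diag_pow, Complex.ofReal_re]

/-- The unitary `V * U⁻¹` aligns the two eigenbases, which leaves a difference of diagonal matrices.
-/
theorem SaMat.norm_sq_conj_diag_sub {k : ℕ} (U V : unitaryGroup (Fin k) ℂ) (x y : Fin k → ℝ) :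
    ‖SaMat.conj (V * U⁻¹) (SaMat.conj U (SaMat.diag x)) - SaMat.conj V (SaMat.diag y)‖ ^ 2 =
      (∑ i, (x i - y i) ^ 2) / k := by
  rw [← SaMat.conj_mul, inv_mul_cancel_right, ← map_sub, LinearIsometryEquiv.norm_map]
  have : SaMat.diag x - SaMat.diag y = SaMat.diag fun i => x i - y i :=
    SaMat.toMatrix_injective (by simp [diagonal_sub])
  rw [this, SaMat.norm_sq_diag]

/-! ### Single-letter microstates -/

variable {M : Type*} [CStarAlgebra M] {φ : M →ₗ[ℂ] ℂ}

theorem mem_microstates_single_iff {a : M} {m k : ℕ} {γ : ℝ} {b : SaMat k} :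
    ![b] ∈ microstates φ ![a] m k γ ↔
      ∀ p : ℕ, 1 ≤ p → p ≤ m → ‖ntr (b.toMatrix ^ p) - φ (a ^ p)‖ < γ := by
  refine forall_congr' fun p => forall_congr' fun _ => forall_congr' fun _ => ?_
  have : ∀ i : Fin p → Fin 1, i = fun _ => 0 := fun i => Subsingleton.elim _ _
  constructor
  · intro h
    simpa using h fun _ => 0
  · intro h i
    rw [this i]
    simpa using h

theorem microstates_mono {n : ℕ} {X : Fin n → M} {m m' k : ℕ} {γ γ' : ℝ} (hm : m ≤ m')
    (hγ : γ' ≤ γ) : microstates φ X m' k γ' ⊆ microstates φ X m k γ :=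
  fun _ hA p hp hpm i => (hA p hp (hpm.trans hm) i).trans_le hγ

theorem conj_mem_microstates_iff {n : ℕ} {X : Fin n → M} {m k : ℕ} {γ : ℝ}
    (U : unitaryGroup (Fin k) ℂ) {A : Fin n → SaMat k} :
    (fun i => SaMat.conj U (A i)) ∈ microstates φ X m k γ ↔ A ∈ microstates φ X m k γ := by
  refine forall_congr' fun p => forall_congr' fun _ => forall_congr' fun _ =>
    forall_congr' fun i => ?_
  rw [prod_ofFn_conj U fun j => A (i j), ntr_conj]

theorem continuous_ntr {k : ℕ} : Continuous (ntr : Matrix (Fin k) (Fin k) ℂ → ℂ) :=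
  (Continuous.matrix_trace continuous_id).div_const _

theorem isOpen_microstates {n : ℕ} {X : Fin n → M} {m k : ℕ} {γ : ℝ} :
    IsOpen (microstates φ X m k γ) := by
  have : microstates φ X m k γ = ⋂ p ∈ Finset.Icc 1 m, ⋂ i : Fin p → Fin n,
      {A | ‖ntr (List.ofFn fun j => (A (i j)).toMatrix).prod
        - φ (List.ofFn fun j => X (i j)).prod‖ < γ} := by
    ext A
    simp only [microstates, Set.mem_ofPred_eq, Finset.mem_Icc, Set.mem_iInter, and_imp]
  rw [this]
  refine isOpen_biInter_finset fun p _ => isOpen_iInter_of_finite fun i => ?_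
  refine isOpen_lt (Continuous.norm (Continuous.sub ?_ continuous_const)) continuous_const
  refine continuous_ntr.comp ?_
  simp only [List.ofFn_eq_map]
  exact continuous_list_prod _ fun j _ =>
    SaMat.continuous_toMatrix.comp (continuous_apply (i j))

theorem measurePreserving_conj {n k : ℕ} (U : unitaryGroup (Fin k) ℂ) :
    MeasurePreserving (fun (A : Fin n → SaMat k) i => SaMat.conj U (A i)) (vol n k) (vol n k) :=
  volume_preserving_pi fun _ => (SaMat.conj U).measurePreserving

/-! ### Interlacing sequences and the secular equation -/

open Polynomial in
/-- The nodal polynomial `∏ (X - x i)`. -/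
def nodal {k : ℕ} (x : Fin k → ℝ) : ℝ[X] := ∏ i, (X - C (x i))

open Polynomial in
/-- The nodal polynomial of `y` with the node `y i` left out. -/
def nodalErase {k : ℕ} (y : Fin k → ℝ) (i : Fin k) : ℝ[X] :=
  ∏ j ∈ Finset.univ.erase i, (X - C (y j))

/-- The polynomials `∏ (X - y i)` and `∏_{j ≠ i} (X - y j)`, a basis of the polynomials of degree
at most `k` when `y` is injective. -/
def secularBasis {k : ℕ} (y : Fin k → ℝ) : Fin (k + 1) → Polynomial ℝ :=
  Fin.cons (nodal y) (nodalErase y)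

/-- Strict interlacing of `k + 1` reals by `k` reals. -/
def Interlace {k : ℕ} (y : Fin k → ℝ) (x : Fin (k + 1) → ℝ) : Prop :=
  ∀ i : Fin k, x i.castSucc < y i ∧ y i < x i.succ

/-- The weights `|v i|²` of a bordered matrix with spectrum `x` and diagonal block `y`. -/
def secularWeight {k : ℕ} (y : Fin k → ℝ) (x : Fin (k + 1) → ℝ) (i : Fin k) : ℝ :=
  -(∏ j, (y i - x j)) / (nodalErase y i).eval (y i)

/-- The corner entry and the weights of a bordered matrix with spectrum `x` and diagonal block
`y`. -/
def secularMap {k : ℕ} (y : Fin k → ℝ) (x : Fin (k + 1) → ℝ) : Fin (k + 1) → ℝ :=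
  Fin.cons (∑ j, x j - ∑ i, y i) (secularWeight y x)

section

variable {k : ℕ} {y : Fin k → ℝ} {x : Fin (k + 1) → ℝ}

open Polynomial

theorem monic_nodal (x : Fin k → ℝ) : (nodal x).Monic :=
  monic_prod_of_monic _ _ fun _ _ => monic_X_sub_C _

theorem natDegree_nodal (x : Fin k → ℝ) : (nodal x).natDegree = k := by
  rw [nodal, natDegree_prod_of_monic _ _ fun _ _ => monic_X_sub_C _]
  simp

theorem natDegree_nodalErase_lt (y : Fin k → ℝ) (i : Fin k) : (nodalErase y i).natDegree < k := by
  rw [nodalErase, natDegree_prod_of_monic _ _ fun _ _ => monic_X_sub_C _]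
  simp [i.pos]

theorem natDegree_secularBasis_lt (y : Fin k → ℝ) (l : Fin (k + 1)) :
    (secularBasis y l).natDegree < k + 1 := by
  refine Fin.cases ?_ (fun i => ?_) l
  · simp [secularBasis, natDegree_nodal]
  · exact (natDegree_nodalErase_lt y i).trans (Nat.lt_succ_self k)

theorem eval_nodal (x : Fin k → ℝ) (z : ℝ) : (nodal x).eval z = ∏ i, (z - x i) := by
  simp [nodal, eval_prod]

theorem eval_nodal_eq_zero_iff {x : Fin k → ℝ} {z : ℝ} : (nodal x).eval z = 0 ↔ ∃ i, x i = z := by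
  rw [eval_nodal, Finset.prod_eq_zero_iff]
  simp [sub_eq_zero, eq_comm]

theorem eval_nodalErase (y : Fin k → ℝ) (i : Fin k) (z : ℝ) :
    (nodalErase y i).eval z = ∏ j ∈ Finset.univ.erase i, (z - y j) := by
  simp [nodalErase, eval_prod]

theorem eval_nodalErase_self_ne_zero (hy : Function.Injective y) (i : Fin k) :
    (nodalErase y i).eval (y i) ≠ 0 := by
  rw [eval_nodalErase, Finset.prod_ne_zero_iff]
  intro j hj
  exact sub_ne_zero.2 fun h => (Finset.mem_erase.1 hj).1 (hy h).symm

theorem eval_nodalErase_of_ne {i j : Fin k} (h : j ≠ i) : (nodalErase y i).eval (y j) = 0 := by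
  rw [eval_nodalErase]
  exact Finset.prod_eq_zero (Finset.mem_erase.2 ⟨h, Finset.mem_univ _⟩) (sub_self _)

/-- Both polynomials are monic of degree k + 1, and the next coefficient is minus the sum of the
roots. -/
theorem degree_nodal_sub_lt (a b : Fin (k + 1) → ℝ) (h : ∑ j, a j = ∑ j, b j) :
    (nodal a - nodal b).degree < k := by
  rw [degree_lt_iff_coeff_zero]
  intro m hm
  rw [coeff_sub]
  obtain rfl | hm := hm.eq_or_lt
  · have H := fun c : Fin (k + 1) → ℝ => prod_X_sub_C_coeff_card_pred Finset.univ c (by simp)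
    simp only [Finset.card_univ, Fintype.card_fin, Nat.add_sub_cancel] at H
    rw [nodal, nodal, H, H, h, sub_self]
  · obtain rfl | hm := (Nat.succ_le_of_lt hm).eq_or_lt
    · have H : ∀ c : Fin (k + 1) → ℝ, (nodal c).coeff (k + 1) = 1 := fun c => by
        have := (monic_nodal c).coeff_natDegree
        rwa [natDegree_nodal] at this
      simp only [Nat.succ_eq_add_one, H, sub_self]
    · rw [coeff_eq_zero_of_natDegree_lt, coeff_eq_zero_of_natDegree_lt, sub_self] <;>
      rwa [natDegree_nodal]

/-- Lagrange interpolation at the nodes y. The corner entry is chosen to match the two leading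
coefficients, and the remainder, of degree below k, is fixed by its values at the y i; these values
define the weights. The right side is the characteristic polynomial of the bordered matrix. -/
theorem nodal_eq_secular (hy : Function.Injective y) (x : Fin (k + 1) → ℝ) :
    nodal x = X * nodal y - ∑ l, C (secularMap y x l) * secularBasis y l := by
  set t := ∑ j, x j - ∑ i, y i with ht
  -- Adjoining the root t to y gives a polynomial with the same root sum as `nodal x`.
  have h1 : nodal (Fin.cons t y : Fin (k + 1) → ℝ) = X * nodal y - C t * nodal y := by
    simp [nodal, Fin.prod_univ_succ, sub_mul]
  have hd : (nodal (Fin.cons t y : Fin (k + 1) → ℝ) - nodal x -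
      ∑ i, C (secularWeight y x i) * nodalErase y i).degree < k := by
    refine (degree_sub_le _ _).trans_lt (max_lt (degree_nodal_sub_lt _ _ ?_) ?_)
    · simp [Fin.sum_univ_succ, ht]
    · rw [← Polynomial.mem_degreeLT]
      refine Submodule.sum_mem _ fun i _ => ?_
      rw [← smul_eq_C_mul]
      refine Submodule.smul_mem _ _ (mem_degreeLT.2 ?_)
      exact degree_le_natDegree.trans_lt (Nat.cast_lt.2 (natDegree_nodalErase_lt y i))
  have h0 := eq_zero_of_degree_lt_of_eval_index_eq_zero (v := y) Finset.univ hy.injOn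
    (by simpa using hd) (fun i _ => by
      have h2 : (nodal (Fin.cons t y : Fin (k + 1) → ℝ)).eval (y i) = 0 :=
        eval_nodal_eq_zero_iff.2 ⟨i.succ, by simp⟩
      rw [eval_sub, eval_sub, h2, eval_finsetSum, Finset.sum_eq_single i]
      · rw [eval_mul, eval_C, secularWeight, div_mul_cancel₀ _ (eval_nodalErase_self_ne_zero hy i),
          eval_nodal]
        ring
      · intro j _ hj
        rw [eval_mul, eval_nodalErase_of_ne hj.symm, mul_zero]
      · simp)
  have h3 : ∑ l, C (secularMap y x l) * secularBasis y l =
      C t * nodal y + ∑ i, C (secularWeight y x i) * nodalErase y i := by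
    rw [Fin.sum_univ_succ]
    simp [secularMap, secularBasis, ht]
  rw [h3]
  rw [h1] at h0
  linear_combination -h0

theorem Interlace.strictMono (h : Interlace y x) : StrictMono x :=
  Fin.strictMono_iff_lt_succ.2 fun i => (h i).1.trans (h i).2

theorem Interlace.strictMono_left (h : Interlace y x) : StrictMono y := by
  intro i j hij
  have h1 : x i.succ ≤ x j.castSucc := h.strictMono.monotone (by
    rw [Fin.le_def, Fin.val_succ, Fin.val_castSucc]; exact hij)
  exact (h i).2.trans_le (h1.trans (h j).1.le)

theorem Interlace.lt_of_castSucc_lt (h : Interlace y x) {i : Fin k} {j : Fin (k + 1)}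
    (hij : i.castSucc < j) : y i < x j :=
  (h i).2.trans_le (h.strictMono.monotone (Fin.castSucc_lt_iff_succ_le.1 hij))

theorem Interlace.lt_of_le_castSucc (h : Interlace y x) {i : Fin k} {j : Fin (k + 1)}
    (hij : j ≤ i.castSucc) : x j < y i :=
  (h.strictMono.monotone hij).trans_lt (h i).1

theorem Interlace.ne (h : Interlace y x) (i : Fin k) (j : Fin (k + 1)) : y i ≠ x j := by
  rcases lt_or_ge i.castSucc j with hij | hij
  · exact (h.lt_of_castSucc_lt hij).ne
  · exact (h.lt_of_le_castSucc hij).ne'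

/-- The two neighbours of y i among the x contribute factors of opposite signs, which cancels the
minus sign. Every other x is paired with a y l lying on the same side of y i, so each remaining
quotient is positive. -/
theorem Interlace.secularWeight_pos (h : Interlace y x) (i : Fin k) : 0 < secularWeight y x i := by
  rw [secularWeight, eval_nodalErase, Fin.prod_univ_succAbove _ i.castSucc,
    ← Finset.mul_prod_erase Finset.univ _ (Finset.mem_univ i), Fin.succAbove_castSucc_self]
  have : -((y i - x i.castSucc) * ((y i - x i.succ) *
      ∏ l ∈ Finset.univ.erase i, (y i - x (i.castSucc.succAbove l)))) /
      ∏ j ∈ Finset.univ.erase i, (y i - y j) = (y i - x i.castSucc) * (x i.succ - y i) *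
      ∏ l ∈ Finset.univ.erase i, ((y i - x (i.castSucc.succAbove l)) / (y i - y l)) := by
    rw [Finset.prod_div_distrib]
    ring
  rw [this]
  refine mul_pos (mul_pos (sub_pos.2 (h i).1) (sub_pos.2 (h i).2)) (Finset.prod_pos fun l hl => ?_)
  rcases lt_or_gt_of_ne (Finset.mem_erase.1 hl).1 with hli | hli
  · rw [Fin.succAbove_of_castSucc_lt _ _ (Fin.castSucc_lt_castSucc_iff.2 hli)]
    exact div_pos (sub_pos.2 ((h l).1.trans (h.strictMono_left hli)))
      (sub_pos.2 (h.strictMono_left hli))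
  · rw [Fin.succAbove_of_le_castSucc _ _ (Fin.castSucc_le_castSucc_iff.2 hli.le)]
    exact div_pos_of_neg_of_neg (sub_neg.2 ((h.strictMono_left hli).trans (h l).2))
      (sub_neg.2 (h.strictMono_left hli))

theorem strictMono_ext_of_nodal_eq {m : ℕ} {x z : Fin m → ℝ} (hx : StrictMono x)
    (hz : StrictMono z) (h : nodal x = nodal z) : x = z := by
  refine (hx.range_inj hz).1 (Set.ext fun r => ?_)
  simp only [Set.mem_range, ← eval_nodal_eq_zero_iff, h]

theorem secularMap_injOn (hy : Function.Injective y) :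
    Set.InjOn (secularMap y) {x | Interlace y x} := by
  intro x hx z hz h
  refine strictMono_ext_of_nodal_eq (Interlace.strictMono hx) (Interlace.strictMono hz) ?_
  rw [nodal_eq_secular hy, nodal_eq_secular hy z, h]

/-- The secular equation: the zeros `x j` solve `x j = t + ∑ w i / (x j - y i)`. -/
theorem Interlace.secular_eq (h : Interlace y x) (j : Fin (k + 1)) :
    x j = secularMap y x 0 + ∑ i, secularWeight y x i / (x j - y i) := by
  have hy := h.strictMono_left.injective
  have h0 : (nodal y).eval (x j) ≠ 0 := fun h0 => by
    obtain ⟨i, hi⟩ := eval_nodal_eq_zero_iff.1 h0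
    exact h.ne i j hi
  have h1 : (nodal x).eval (x j) = 0 := eval_nodal_eq_zero_iff.2 ⟨j, rfl⟩
  rw [nodal_eq_secular hy, Fin.sum_univ_succ] at h1
  have h2 : ∀ i, (nodalErase y i).eval (x j) = (nodal y).eval (x j) / (x j - y i) := fun i => by
    rw [eq_div_iff (sub_ne_zero.2 (h.ne i j).symm), eval_nodal, eval_nodalErase,
      Finset.prod_erase_mul _ _ (Finset.mem_univ i)]
  simp only [eval_sub, eval_mul, eval_X, eval_add, eval_C, eval_finsetSum, secularBasis,
    Fin.cons_zero, Fin.cons_succ, h2] at h1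
  have h3 : ∑ i, secularMap y x i.succ * ((nodal y).eval (x j) / (x j - y i)) =
      (nodal y).eval (x j) * ∑ i, secularWeight y x i / (x j - y i) := by
    rw [Finset.mul_sum]
    refine Finset.sum_congr rfl fun i _ => ?_
    simp only [secularMap, Fin.cons_succ]
    ring
  rw [h3] at h1
  apply mul_left_cancel₀ h0
  linear_combination h1

end

/-! #### Surjectivity of the secular map -/

section

variable {k : ℕ} {y : Fin k → ℝ}

/-- The secular function `z - t - ∑ w i / (z - y i)`. -/
def secularFun (y : Fin k → ℝ) (t : ℝ) (w : Fin k → ℝ) (z : ℝ) : ℝ :=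
  z - t - ∑ i, w i / (z - y i)

/-- The `j`-th gap of an increasing sequence. -/
def gap (y : Fin k → ℝ) (j : Fin (k + 1)) : Set ℝ :=
  {z | ∀ i : Fin k, (i.castSucc < j → y i < z) ∧ (j ≤ i.castSucc → z < y i)}

theorem ordConnected_gap (y : Fin k → ℝ) (j : Fin (k + 1)) : (gap y j).OrdConnected :=
  ⟨fun _ ha _ hb _ hc i => ⟨fun h => ((ha i).1 h).trans_le hc.1,
    fun h => hc.2.trans_lt ((hb i).2 h)⟩⟩

theorem ne_of_mem_gap {j : Fin (k + 1)} {z : ℝ} (hz : z ∈ gap y j) (i : Fin k) : z ≠ y i := by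
  rcases lt_or_ge i.castSucc j with hij | hij
  · exact ((hz i).1 hij).ne'
  · exact ((hz i).2 hij).ne

theorem continuousOn_secularFun (t : ℝ) (w : Fin k → ℝ) (j : Fin (k + 1)) :
    ContinuousOn (secularFun y t w) (gap y j) := by
  refine (continuousOn_id.sub continuousOn_const).sub (continuousOn_finsetSum _ fun i _ => ?_)
  exact continuousOn_const.div (continuousOn_id.sub continuousOn_const)
    fun z hz => sub_ne_zero.2 (ne_of_mem_gap hz i)

theorem secularFun_tendsto_right (hy : Function.Injective y) (t : ℝ) {w : Fin k → ℝ}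
    (hw : ∀ i, 0 < w i) (i : Fin k) : Tendsto (secularFun y t w) (𝓝[>] (y i)) atBot := by
  have h1 : secularFun y t w = fun z =>
      (z - t - ∑ l ∈ Finset.univ.erase i, w l / (z - y l)) + w i * -(z - y i)⁻¹ := by
    funext z
    rw [secularFun, ← Finset.add_sum_erase Finset.univ _ (Finset.mem_univ i)]
    ring
  rw [h1]
  refine Tendsto.add_atBot (C := y i - t - ∑ l ∈ Finset.univ.erase i, w l / (y i - y l)) ?_ ?_
  · refine tendsto_nhdsWithin_of_tendsto_nhds (ContinuousAt.tendsto ?_)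
    refine (continuousAt_id.sub continuousAt_const).sub (tendsto_finsetSum _ fun l hl => ?_)
    refine ContinuousAt.div continuousAt_const (continuousAt_id.sub continuousAt_const)
      (sub_ne_zero.2 fun h => (Finset.mem_erase.1 hl).1 (hy h).symm)
  · refine (tendsto_neg_atTop_atBot.comp ?_).const_mul_atBot (hw i)
    refine tendsto_inv_nhdsGT_zero.comp (tendsto_nhdsWithin_iff.2 ⟨?_, ?_⟩)
    · refine tendsto_nhdsWithin_of_tendsto_nhds ?_
      have : Tendsto (fun z => z - y i) (𝓝 (y i)) (𝓝 (y i - y i)) :=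
        (continuous_id.sub continuous_const).tendsto _
      rwa [sub_self] at this
    · filter_upwards [self_mem_nhdsWithin] with z hz using Set.mem_Ioi.2 (sub_pos.2 (Set.mem_Ioi.1 hz))

/-- Reflection at the origin keeps the weights, so limits at poles from the left and at -∞ follow
from those from the right and at +∞. -/
theorem secularFun_neg (t : ℝ) (w : Fin k → ℝ) (z : ℝ) :
    secularFun y t w z = -secularFun (fun i => -y i) (-t) w (-z) := by
  simp only [secularFun]
  have : ∑ i, w i / (-z - -y i) = -∑ i, w i / (z - y i) := by
    rw [← Finset.sum_neg_distrib]
    refine Finset.sum_congr rfl fun i _ => ?_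
    rw [← div_neg]
    congr 1
    ring
  rw [this]
  ring

theorem secularFun_tendsto_left (hy : Function.Injective y) (t : ℝ) {w : Fin k → ℝ}
    (hw : ∀ i, 0 < w i) (i : Fin k) : Tendsto (secularFun y t w) (𝓝[<] (y i)) atTop := by
  rw [funext (secularFun_neg (y := y) t w)]
  refine tendsto_neg_atBot_atTop.comp ((secularFun_tendsto_right
    (neg_injective.comp hy) (-t) hw i).comp ?_)
  exact tendsto_neg_nhdsLT

theorem secularFun_tendsto_atTop (t : ℝ) (w : Fin k → ℝ) :
    Tendsto (secularFun y t w) atTop atTop := by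
  have h : Tendsto (fun z => ∑ i, w i / (z - y i)) atTop (𝓝 (∑ _i : Fin k, 0)) :=
    tendsto_finsetSum _ fun i _ =>
      (tendsto_atTop_add_const_right _ (-y i) tendsto_id).const_div_atTop (w i)
  refine Tendsto.congr (fun z => ?_) ((tendsto_atTop_add_const_right _ (-t) tendsto_id).atTop_add
    h.neg)
  simp [secularFun, sub_eq_add_neg]

theorem secularFun_tendsto_atBot (t : ℝ) (w : Fin k → ℝ) :
    Tendsto (secularFun y t w) atBot atBot := by
  rw [funext (secularFun_neg (y := y) t w)]
  exact tendsto_neg_atTop_atBot.comp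
    ((secularFun_tendsto_atTop (-t) w).comp tendsto_neg_atBot_atTop)

/-- At the left end of each gap the secular function tends to -∞: at -∞ itself for the first gap, at
a pole with positive weight for the others. -/
theorem exists_mem_gap_neg (hy : StrictMono y) (t : ℝ) {w : Fin k → ℝ} (hw : ∀ i, 0 < w i)
    (j : Fin (k + 1)) : ∃ z ∈ gap y j, secularFun y t w z < 0 := by
  induction j using Fin.cases with
  | zero =>
    have h1 : ∀ᶠ z in atBot, z ∈ gap y 0 := by
      simp only [gap, Set.mem_ofPred_eq]
      refine eventually_all.2 fun i => ?_
      filter_upwards [eventually_lt_atBot (y i)] with z hz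
      exact ⟨fun h => absurd h (Fin.not_lt_zero _), fun _ => hz⟩
    obtain ⟨z, hz⟩ := (h1.and ((secularFun_tendsto_atBot t w).eventually_lt_atBot 0)).exists
    exact ⟨z, hz⟩
  | succ i =>
    have h1 : ∀ᶠ z in 𝓝[>] (y i), z ∈ gap y i.succ := by
      simp only [gap, Set.mem_ofPred_eq]
      refine eventually_all.2 fun l => ?_
      rcases le_or_gt l i with hl | hl
      · filter_upwards [self_mem_nhdsWithin] with z hz
        refine ⟨fun _ => (hy.monotone hl).trans_lt hz, fun h => ?_⟩
        rw [Fin.le_def, Fin.val_succ, Fin.val_castSucc] at h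
        exact absurd hl (by rw [Fin.le_def]; omega)
      · filter_upwards [nhdsWithin_le_nhds (eventually_lt_nhds (hy hl))] with z hz
        refine ⟨fun h => ?_, fun _ => hz⟩
        rw [Fin.lt_def, Fin.val_succ, Fin.val_castSucc] at h
        exact absurd hl (by rw [Fin.lt_def]; omega)
    obtain ⟨z, hz⟩ := (h1.and ((secularFun_tendsto_right hy.injective t hw
      i).eventually_lt_atBot 0)).exists
    exact ⟨z, hz⟩

theorem exists_mem_gap_pos (hy : StrictMono y) (t : ℝ) {w : Fin k → ℝ} (hw : ∀ i, 0 < w i)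
    (j : Fin (k + 1)) : ∃ z ∈ gap y j, 0 < secularFun y t w z := by
  induction j using Fin.lastCases with
  | last =>
    have h1 : ∀ᶠ z in atTop, z ∈ gap y (Fin.last k) := by
      simp only [gap, Set.mem_ofPred_eq]
      refine eventually_all.2 fun i => ?_
      filter_upwards [eventually_gt_atTop (y i)] with z hz
      exact ⟨fun _ => hz, fun h => absurd h (Fin.castSucc_lt_last i).not_ge⟩
    obtain ⟨z, hz⟩ := (h1.and ((secularFun_tendsto_atTop t w).eventually_gt_atTop 0)).exists
    exact ⟨z, hz⟩
  | cast i =>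
    have h1 : ∀ᶠ z in 𝓝[<] (y i), z ∈ gap y i.castSucc := by
      simp only [gap, Set.mem_ofPred_eq]
      refine eventually_all.2 fun l => ?_
      rcases lt_or_ge l i with hl | hl
      · filter_upwards [nhdsWithin_le_nhds (eventually_gt_nhds (hy hl))] with z hz
        exact ⟨fun _ => hz, fun h => absurd hl (Fin.castSucc_le_castSucc_iff.1 h).not_gt⟩
      · filter_upwards [self_mem_nhdsWithin] with z hz
        exact ⟨fun h => absurd hl (Fin.castSucc_lt_castSucc_iff.1 h).not_ge,
          fun _ => lt_of_lt_of_le hz (hy.monotone hl)⟩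
    obtain ⟨z, hz⟩ := (h1.and ((secularFun_tendsto_left hy.injective t hw
      i).eventually_gt_atTop 0)).exists
    exact ⟨z, hz⟩

theorem exists_secularFun_eq_zero (hy : StrictMono y) (t : ℝ) {w : Fin k → ℝ} (hw : ∀ i, 0 < w i)
    (j : Fin (k + 1)) : ∃ z ∈ gap y j, secularFun y t w z = 0 := by
  obtain ⟨z₁, h₁, h₁'⟩ := exists_mem_gap_neg hy t hw j
  obtain ⟨z₂, h₂, h₂'⟩ := exists_mem_gap_pos hy t hw j
  exact (ordConnected_gap y j).isPreconnected.intermediate_value h₁ h₂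
    (continuousOn_secularFun t w j) ⟨h₁'.le, h₂'.le⟩

open Polynomial in
-- The intermediate value theorem gives a zero of the secular function in each gap, and these zeros
-- interlace y. They satisfy the secular equation both with the given data and with their own, and a
-- polynomial of degree at most k with k + 1 zeros vanishes, so the two sets of data agree.
theorem exists_secularMap_eq (hy : StrictMono y) (t : ℝ) {w : Fin k → ℝ} (hw : ∀ i, 0 < w i) :
    ∃ x, Interlace y x ∧ secularMap y x = Fin.cons t w := by
  choose x hx hx0 using exists_secularFun_eq_zero hy t hw
  have hI : Interlace y x := fun i =>
    ⟨(hx i.castSucc i).2 le_rfl, (hx i.succ i).1 (Fin.castSucc_lt_succ)⟩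
  have hq : ∀ j, (nodal y).eval (x j) ≠ 0 := fun j h0 => by
    obtain ⟨i, hi⟩ := eval_nodal_eq_zero_iff.1 h0
    exact hI.ne i j hi
  set u : Fin (k + 1) → ℝ := Fin.cons t w with hu
  have h1 : ∀ j, (∑ l, C (secularMap y x l - u l) * secularBasis y l).eval (x j) = 0 := by
    intro j
    have h2 : ∀ i, (nodalErase y i).eval (x j) = (nodal y).eval (x j) / (x j - y i) := fun i => by
      rw [eq_div_iff (sub_ne_zero.2 (hI.ne i j).symm), eval_nodal, eval_nodalErase,
        Finset.prod_erase_mul _ _ (Finset.mem_univ i)]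
    have h3 := hI.secular_eq j
    have h4 := hx0 j
    rw [secularFun] at h4
    have h5 : secularMap y x 0 - t + (∑ i, secularWeight y x i / (x j - y i)
        - ∑ i, w i / (x j - y i)) = 0 := by linarith
    rw [eval_finsetSum, Fin.sum_univ_succ]
    simp only [hu, secularBasis, Fin.cons_zero, Fin.cons_succ, eval_mul, eval_C, h2]
    rw [← Finset.sum_sub_distrib] at h5
    have h6 := congrArg ((nodal y).eval (x j) * ·) h5
    simp only [mul_add, Finset.mul_sum, mul_zero] at h6
    rw [← h6]
    congr 1
    · ring
    · refine Finset.sum_congr rfl fun i _ => ?_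
      simp only [secularMap, Fin.cons_succ]
      ring
  have h2 : ∑ l, C (secularMap y x l - u l) * secularBasis y l = 0 := by
    refine eq_zero_of_natDegree_lt_card_of_eval_eq_zero _ hI.strictMono.injective h1 ?_
    rw [Fintype.card_fin]
    refine Nat.lt_succ_of_le (natDegree_sum_le_of_forall_le _ _ fun l _ => ?_)
    exact (natDegree_C_mul_le _ _).trans (Nat.le_of_lt_succ (natDegree_secularBasis_lt y l))
  refine ⟨x, hI, ?_⟩
  have h3 : ∀ i : Fin k, secularMap y x i.succ - u i.succ = 0 := fun i => by
    have := congrArg (Polynomial.eval (y i)) h2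
    rw [eval_finsetSum, Fin.sum_univ_succ, Finset.sum_eq_single i] at this
    · simp only [secularBasis, Fin.cons_zero, Fin.cons_succ, eval_mul, eval_C, eval_zero,
        eval_nodal_eq_zero_iff.2 ⟨i, rfl⟩, mul_zero, zero_add] at this
      exact (mul_eq_zero.1 this).resolve_right
        (eval_nodalErase_self_ne_zero hy.injective i)
    · intro j _ hj
      simp [secularBasis, eval_nodalErase_of_ne hj.symm]
    · simp
  -- The coefficient of `nodal y` is invisible at the y i; it is read off at x 0 once the other
  -- coefficients are known to vanish.
  have h4 : secularMap y x 0 - u 0 = 0 := by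
    have := h1 0
    rw [eval_finsetSum, Fin.sum_univ_succ, Finset.sum_eq_zero fun i _ => by rw [h3 i]; simp] at this
    simp only [secularBasis, Fin.cons_zero, eval_mul, eval_C, add_zero] at this
    exact (mul_eq_zero.1 this).resolve_right (hq 0)
  funext l
  refine Fin.cases (sub_eq_zero.1 h4) (fun i => sub_eq_zero.1 (h3 i)) l

theorem secularMap_image (hy : StrictMono y) :
    secularMap y '' {x | Interlace y x} = {u | ∀ i : Fin k, 0 < u i.succ} := by
  ext u
  constructor
  · rintro ⟨x, hx, rfl⟩ i
    exact Interlace.secularWeight_pos hx i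
  · intro hu
    obtain ⟨x, hx, h⟩ := exists_secularMap_eq hy (u 0) hu
    refine ⟨x, hx, h.trans ?_⟩
    exact Fin.cons_self_tail u

end

/-! ### The Jacobian of the secular map -/

/-- The Vandermonde product of a finite sequence. -/
def vdm {k : ℕ} (x : Fin k → ℝ) : ℝ := (vandermonde x).det

theorem vdm_eq_prod {k : ℕ} (x : Fin k → ℝ) :
    vdm x = ∏ i : Fin k, ∏ j ∈ Finset.Ioi i, (x j - x i) := det_vandermonde x

theorem vdm_pos {k : ℕ} {x : Fin k → ℝ} (hx : StrictMono x) : 0 < vdm x := by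
  rw [vdm_eq_prod]
  exact Finset.prod_pos fun i _ => Finset.prod_pos fun j hj =>
    sub_pos.2 (hx (Finset.mem_Ioi.1 hj))

theorem continuous_vdm {k : ℕ} : Continuous (vdm : (Fin k → ℝ) → ℝ) := by
  have : (vdm : (Fin k → ℝ) → ℝ) = fun x => ∏ i : Fin k, ∏ j ∈ Finset.Ioi i, (x j - x i) :=
    funext vdm_eq_prod
  rw [this]
  fun_prop

section

variable {k : ℕ} {y : Fin k → ℝ} {x : Fin (k + 1) → ℝ}

open Polynomial

/-- The coefficient matrix of `secularBasis y`. -/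
def secularCoeff (y : Fin k → ℝ) : Matrix (Fin (k + 1)) (Fin (k + 1)) ℝ :=
  Matrix.of fun m l => (secularBasis y l).coeff m

theorem eval_secularBasis_eq (y : Fin k → ℝ) (x : Fin (k + 1) → ℝ) :
    Matrix.of (fun j l => (secularBasis y l).eval (x j)) = vandermonde x * secularCoeff y := by
  ext j l
  rw [of_apply, mul_apply, eval_eq_sum_range' (natDegree_secularBasis_lt y l),
    Finset.sum_range fun i => (secularBasis y l).coeff i * x j ^ i]
  exact Finset.sum_congr rfl fun m _ => mul_comm _ _

theorem vdm_cons (s : ℝ) (y : Fin k → ℝ) :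
    vdm (Fin.cons s y : Fin (k + 1) → ℝ) = (∏ i, (y i - s)) * vdm y := by
  rw [vdm_eq_prod, vdm_eq_prod, Fin.prod_univ_succ]
  simp

/-- Evaluating the basis at an auxiliary point s followed by the y i gives a triangular matrix. Its
determinant is also a Vandermonde product times the coefficient determinant, and the factor
involving s cancels. -/
theorem abs_vdm_mul_det_secularCoeff (y : Fin k → ℝ) :
    |vdm y| * |(secularCoeff y).det| = ∏ i, |(nodalErase y i).eval (y i)| := by
  obtain ⟨s, hs⟩ := (Set.finite_range y).exists_notMem
  have hs' : (nodal y).eval s ≠ 0 := fun h => hs (eval_nodal_eq_zero_iff.1 h)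
  have h1 := congrArg Matrix.det (eval_secularBasis_eq y (Fin.cons s y))
  rw [det_mul, det_of_isUpperTriangular] at h1
  · have h2 := congrArg abs h1
    rw [abs_mul, Finset.abs_prod, Fin.prod_univ_succ] at h2
    change _ = |vdm (Fin.cons s y : Fin (k + 1) → ℝ)| * _ at h2
    rw [vdm_cons, abs_mul] at h2
    simp only [of_apply, Fin.cons_zero, Fin.cons_succ, secularBasis] at h2
    have h3 : |∏ i, (y i - s)| = |(nodal y).eval s| := by
      rw [eval_nodal, Finset.abs_prod, Finset.abs_prod]
      exact Finset.prod_congr rfl fun i _ => abs_sub_comm _ _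
    rw [h3, mul_assoc] at h2
    exact (mul_left_cancel₀ (abs_ne_zero.2 hs') h2).symm
  · intro i j hij
    simp only [id] at hij
    induction i using Fin.cases with
    | zero => exact absurd hij (Fin.not_lt_zero _)
    | succ i =>
      induction j using Fin.cases with
      | zero => simpa [secularBasis] using eval_nodal_eq_zero_iff.2 ⟨i, rfl⟩
      | succ j =>
        simpa [secularBasis] using eval_nodalErase_of_ne (Fin.succ_lt_succ_iff.1 hij).ne'

/-- The Jacobian matrix of `secularMap y`. -/
def secularJacobian (y : Fin k → ℝ) (x : Fin (k + 1) → ℝ) :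
    Matrix (Fin (k + 1)) (Fin (k + 1)) ℝ :=
  Matrix.of (Fin.cons (fun _ => 1) fun i j => secularWeight y x i / (x j - y i))

theorem Interlace.eval_nodal_ne_zero (h : Interlace y x) (j : Fin (k + 1)) :
    (nodal y).eval (x j) ≠ 0 := fun h0 => by
  obtain ⟨i, hi⟩ := eval_nodal_eq_zero_iff.1 h0
  exact h.ne i j hi

theorem Interlace.eval_nodalErase (h : Interlace y x) (i : Fin k) (j : Fin (k + 1)) :
    (nodalErase y i).eval (x j) = (nodal y).eval (x j) / (x j - y i) := by
  rw [eq_div_iff (sub_ne_zero.2 (h.ne i j).symm), eval_nodal, FreeEntropy.eval_nodalErase,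
    Finset.prod_erase_mul _ _ (Finset.mem_univ i)]

/-- Multiplying row j of the transposed Jacobian by `nodal y` at x j produces the evaluation matrix
of the secular basis with columns scaled by the weights. The evaluation matrix is a Vandermonde
matrix times the coefficient matrix, and both the product of the `nodal y` values and the product of
the weights are expressed by the double product of the |x j - y i|. -/
theorem Interlace.abs_det_secularJacobian (h : Interlace y x) :
    |(secularJacobian y x).det| = vdm x / vdm y := by
  have hy := h.strictMono_left.injective
  have h1 : diagonal (fun j => (nodal y).eval (x j)) * (secularJacobian y x)ᵀ =
      Matrix.of (fun j l => (secularBasis y l).eval (x j)) *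
        diagonal (Fin.cons 1 (secularWeight y x) : Fin (k + 1) → ℝ) := by
    ext j l
    rw [diagonal_mul, mul_diagonal, transpose_apply, of_apply]
    induction l using Fin.cases with
    | zero => simp [secularJacobian, secularBasis]
    | succ i =>
      simp only [secularJacobian, secularBasis, of_apply, Fin.cons_succ, h.eval_nodalErase]
      ring
  have h2 := congrArg (fun A => |Matrix.det A|) h1
  simp only [det_mul, det_diagonal, det_transpose, eval_secularBasis_eq, abs_mul,
    Fin.prod_univ_succ (n := k), Fin.cons_zero, Fin.cons_succ, one_mul] at h2
  change _ = |vdm x| * _ * _ at h2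
  have h3 : |∏ i, secularWeight y x i| * ∏ i, |(nodalErase y i).eval (y i)| =
      |∏ j, (nodal y).eval (x j)| := by
    rw [Finset.abs_prod, Finset.abs_prod, ← Finset.prod_mul_distrib]
    have : ∀ i, |secularWeight y x i| * |(nodalErase y i).eval (y i)| = ∏ j, |x j - y i| := by
      intro i
      rw [← abs_mul, secularWeight, div_mul_cancel₀ _ (eval_nodalErase_self_ne_zero hy i), abs_neg,
        Finset.abs_prod]
      exact Finset.prod_congr rfl fun j _ => abs_sub_comm _ _
    simp only [this, eval_nodal, Finset.abs_prod]
    exact Finset.prod_comm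
  rw [← abs_mul, ← Fin.prod_univ_succ fun j => (nodal y).eval (x j), ← h3,
    ← abs_vdm_mul_det_secularCoeff y, abs_of_pos (vdm_pos h.strictMono),
    abs_of_pos (vdm_pos h.strictMono_left)] at h2
  have h4 : |∏ j, (nodal y).eval (x j)| ≠ 0 :=
    abs_ne_zero.2 (Finset.prod_ne_zero_iff.2 fun j _ => h.eval_nodal_ne_zero j)
  rw [← h3, ← abs_vdm_mul_det_secularCoeff y] at h4
  have h5 : |∏ i, secularWeight y x i| ≠ 0 := left_ne_zero_of_mul h4
  have h6 : |(secularCoeff y).det| ≠ 0 := right_ne_zero_of_mul (right_ne_zero_of_mul h4)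
  rw [eq_div_iff (vdm_pos h.strictMono_left).ne']
  apply mul_left_cancel₀ (mul_ne_zero h5 h6)
  linear_combination h2

/-- The derivative of `secularMap y`. -/
def secularDeriv (y : Fin k → ℝ) (x : Fin (k + 1) → ℝ) :
    (Fin (k + 1) → ℝ) →L[ℝ] (Fin (k + 1) → ℝ) :=
  LinearMap.toContinuousLinearMap (Matrix.toLin' (secularJacobian y x))

theorem det_secularDeriv (y : Fin k → ℝ) (x : Fin (k + 1) → ℝ) :
    (secularDeriv y x).det = (secularJacobian y x).det := by
  rw [ContinuousLinearMap.det, secularDeriv]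
  exact LinearMap.det_toLin' _

theorem Interlace.hasFDerivAt_secularMap (h : Interlace y x) :
    HasFDerivAt (secularMap y) (secularDeriv y x) x := by
  rw [hasFDerivAt_pi']
  intro l
  induction l using Fin.cases with
  | zero =>
    have h1 : HasFDerivAt (fun x : Fin (k + 1) → ℝ => ∑ j, x j - ∑ i, y i)
        (∑ j, ContinuousLinearMap.proj (R := ℝ) (φ := fun _ : Fin (k + 1) => ℝ) j) x :=
      (HasFDerivAt.fun_sum fun j _ => hasFDerivAt_apply j x).sub_const _
    refine h1.congr_fderiv (ContinuousLinearMap.ext fun v => ?_)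
    simp [secularDeriv, secularJacobian, Matrix.mulVec, dotProduct]
  | succ i =>
    have h1 : HasFDerivAt (fun x : Fin (k + 1) → ℝ => ∏ j, (y i - x j))
        (∑ j, (∏ l ∈ Finset.univ.erase j, (y i - x l)) •
          -ContinuousLinearMap.proj (R := ℝ) (φ := fun _ : Fin (k + 1) => ℝ) j) x :=
      HasFDerivAt.finsetProd fun j _ => (hasFDerivAt_apply j x).const_sub _
    have h2 := (h1.neg).mul_const ((nodalErase y i).eval (y i))⁻¹
    refine h2.congr_fderiv (ContinuousLinearMap.ext fun v => ?_)
    simp only [secularDeriv, secularJacobian, Matrix.mulVec, dotProduct,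
      _root_.smul_apply, _root_.neg_apply, ContinuousLinearMap.comp_apply,
      ContinuousLinearMap.proj_apply, _root_.sum_apply, smul_eq_mul,
      LinearMap.coe_toContinuousLinearMap', toLin'_apply, of_apply, Fin.cons_succ]
    rw [← Finset.sum_neg_distrib, Finset.mul_sum]
    refine Finset.sum_congr rfl fun j _ => ?_
    -- Logarithmic differentiation: removing the factor y i - x j from the weight amounts to
    -- division by it.
    rw [secularWeight, ← Finset.mul_prod_erase Finset.univ _ (Finset.mem_univ j)]
    have h3 : x j - y i ≠ 0 := sub_ne_zero.2 (h.ne i j).symm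
    have h4 := eval_nodalErase_self_ne_zero h.strictMono_left.injective i
    field_simp
    ring

theorem measurableSet_interlace (y : Fin k → ℝ) : MeasurableSet {x | Interlace y x} := by
  have : {x | Interlace y x} = ⋂ i : Fin k, {x | x i.castSucc < y i ∧ y i < x i.succ} := by
    ext x; simp [Interlace]
  rw [this]
  refine MeasurableSet.iInter fun i => ?_
  exact (measurableSet_lt (measurable_pi_apply _) measurable_const).inter
    (measurableSet_lt measurable_const (measurable_pi_apply _))

theorem lintegral_secularMap (hy : StrictMono y) (g : (Fin (k + 1) → ℝ) → ℝ≥0∞) :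
    ∫⁻ u in {u | ∀ i : Fin k, 0 < u i.succ}, g u =
      ∫⁻ x in {x | Interlace y x}, ENNReal.ofReal (vdm x / vdm y) * g (secularMap y x) := by
  rw [← secularMap_image hy, lintegral_image_eq_lintegral_abs_det_fderiv_mul volume
    (measurableSet_interlace y) (f' := secularDeriv y)
    (fun x hx => (Interlace.hasFDerivAt_secularMap hx).hasFDerivWithinAt)
    (secularMap_injOn hy.injective)]
  refine setLIntegral_congr_fun (measurableSet_interlace y) fun x hx => ?_
  simp only [det_secularDeriv, Interlace.abs_det_secularJacobian hx]

end

/-! ### The integral of the Vandermonde product over an interlacing box -/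

section

variable {k : ℕ} {x : Fin (k + 1) → ℝ}

/-- The Vandermonde determinant after subtracting consecutive rows. -/
theorem det_sub_pow_eq_vdm (x : Fin (k + 1) → ℝ) :
    (Matrix.of fun i j : Fin k => x i.succ ^ (j + 1 : ℕ) - x i.castSucc ^ (j + 1 : ℕ)).det =
      vdm x := by
  let B : Matrix (Fin (k + 1)) (Fin (k + 1)) ℝ := Matrix.of (Fin.cons (fun j => x 0 ^ (j : ℕ))
    fun i j => x i.succ ^ (j : ℕ) - x i.castSucc ^ (j : ℕ))
  have h1 : (vandermonde x).det = B.det := by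
    refine det_eq_of_forall_row_eq_smul_add_pred (fun _ => 1) (fun j => ?_) fun i j => ?_
    · simp [B, vandermonde]
    · simp [B, vandermonde]
  rw [vdm, h1, det_succ_column_zero, Fin.sum_univ_succ, Finset.sum_eq_zero]
  · simp only [Fin.val_zero, pow_zero, one_mul, add_zero, B, of_apply, Fin.cons_zero]
    congr 1
  · intro i _
    simp [B]

/-- In the Leibniz expansion each variable occurs in one factor only, so the integral is again a
determinant. Its entries are differences of consecutive powers of x divided by j + 1, and these
divisors multiply to k!. -/
theorem integral_vdm_box (hx : StrictMono x) :
    ∫ y in Set.univ.pi fun i : Fin k => Set.Ioc (x i.castSucc) (x i.succ), vdm y =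
      vdm x / k.factorial := by
  have hle : ∀ i : Fin k, x i.castSucc ≤ x i.succ := fun i => (hx Fin.castSucc_lt_succ).le
  have hi : ∀ (i : Fin k) (n : ℕ), Integrable (fun z : ℝ => z ^ n)
      (volume.restrict (Set.Ioc (x i.castSucc) (x i.succ))) := fun i n =>
    ((continuous_pow n).intervalIntegrable _ _).1
  rw [volume_pi, Measure.restrict_pi_pi]
  have h1 : ∀ y : Fin k → ℝ, vdm y = ∑ σ : Equiv.Perm (Fin k), ((Equiv.Perm.sign σ : ℤ) : ℝ) *
      ∏ i, y (σ i) ^ (i : ℕ) := fun y => by simp only [vdm, det_apply', vandermonde_apply]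
  have h2 : ∀ (i : Fin k) (n : ℕ), ∫ z in Set.Ioc (x i.castSucc) (x i.succ), z ^ n =
      (x i.succ ^ (n + 1) - x i.castSucc ^ (n + 1)) / (n + 1) := fun i n => by
    rw [← intervalIntegral.integral_of_le (hle i), integral_pow]
  have h3 : ∀ σ : Equiv.Perm (Fin k), ∀ y : Fin k → ℝ,
      ∏ i, y (σ i) ^ (i : ℕ) = ∏ i, y i ^ (σ⁻¹ i : ℕ) := fun σ y => by
    rw [← Equiv.prod_comp σ fun i => y i ^ (σ⁻¹ i : ℕ)]
    simp
  simp only [h1, h3]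
  rw [integral_finsetSum]
  · have h4 : (k.factorial : ℝ) = ∏ j : Fin k, ((j : ℕ) + 1 : ℝ) := by
      rw [← Finset.prod_range_add_one_eq_factorial,
        Finset.prod_range fun i => (i + 1)]
      push_cast
      rfl
    have h5 : vdm x / k.factorial = ((Matrix.of fun i j : Fin k =>
        (x i.succ ^ (j + 1 : ℕ) - x i.castSucc ^ (j + 1 : ℕ))) *
          diagonal fun j : Fin k => ((j : ℕ) + 1 : ℝ)⁻¹).det := by
      rw [det_mul, det_sub_pow_eq_vdm, det_diagonal, h4, Finset.prod_inv_distrib, div_eq_mul_inv]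
    rw [h5, det_apply']
    refine Finset.sum_congr rfl fun σ _ => ?_
    rw [integral_const_mul, integral_fintype_prod_eq_prod (fun i (z : ℝ) => z ^ (σ⁻¹ i : ℕ))]
    congr 1
    rw [← Equiv.prod_comp σ]
    refine Finset.prod_congr rfl fun i _ => ?_
    rw [h2]
    simp [mul_diagonal, div_eq_mul_inv]
  · intro σ _
    exact (Integrable.fintype_prod (f := fun i (z : ℝ) => z ^ (σ⁻¹ i : ℕ))
      fun i => hi i _).const_mul _

theorem lintegral_vdm_box (hx : StrictMono x) :
    ∫⁻ y in {y : Fin k → ℝ | Interlace y x}, ENNReal.ofReal (vdm y) =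
      ENNReal.ofReal (vdm x / k.factorial) := by
  have h1 : {y : Fin k → ℝ | Interlace y x} =
      Set.univ.pi fun i : Fin k => Set.Ioo (x i.castSucc) (x i.succ) := by
    ext y; simp [Interlace, Set.mem_pi]
  have hae : (Set.univ.pi fun i : Fin k => Set.Ioo (x i.castSucc) (x i.succ)) =ᵐ[volume]
      Set.univ.pi fun i : Fin k => Set.Ioc (x i.castSucc) (x i.succ) :=
    Measure.univ_pi_Ioo_ae_eq_Icc.trans Measure.univ_pi_Ioc_ae_eq_Icc.symm
  rw [← ofReal_integral_eq_lintegral_ofReal, h1, setIntegral_congr_set hae, integral_vdm_box hx]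
  · have h2 : IntegrableOn (vdm : (Fin k → ℝ) → ℝ)
        (Set.Icc (fun i => x i.castSucc) fun i => x i.succ) :=
      continuous_vdm.continuousOn.integrableOn_Icc
    refine h2.mono_set ?_
    rw [h1, ← Set.pi_univ_Icc]
    exact Set.pi_mono fun i _ => Set.Ioo_subset_Icc_self
  · refine (ae_restrict_iff' ?_).2 (Eventually.of_forall fun y hy =>
      (vdm_pos (Interlace.strictMono_left hy)).le)
    rw [h1]
    exact MeasurableSet.univ_pi fun i => measurableSet_Ioo

end

/-! ### Bordered matrices -/

section

variable {k : ℕ}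

/-- The matrix with corner entry `t`, first column `v` and remaining block `b`. -/
def border (b : SaMat k) (v : Fin k → ℂ) (t : ℝ) : SaMat (k + 1) :=
  SaMat.mk (Matrix.of (Fin.cons (Fin.cons (t : ℂ) (star v)) fun i => Fin.cons (v i)
    (b.toMatrix i))) (by
      ext i j
      have hb := congrFun₂ b.conjTranspose_toMatrix
      induction i using Fin.cases <;> induction j using Fin.cases <;> simp
      exact hb _ _)

@[simp] theorem border_zero_zero (b : SaMat k) (v : Fin k → ℂ) (t : ℝ) :
    (border b v t).toMatrix 0 0 = t := rfl
@[simp] theorem border_zero_succ (b : SaMat k) (v : Fin k → ℂ) (t : ℝ) (j : Fin k) :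
    (border b v t).toMatrix 0 j.succ = star (v j) := rfl
@[simp] theorem border_succ_zero (b : SaMat k) (v : Fin k → ℂ) (t : ℝ) (i : Fin k) :
    (border b v t).toMatrix i.succ 0 = v i := rfl
@[simp] theorem border_succ_succ (b : SaMat k) (v : Fin k → ℂ) (t : ℝ) (i j : Fin k) :
    (border b v t).toMatrix i.succ j.succ = b.toMatrix i j := rfl

theorem ext_border {A B : Matrix (Fin (k + 1)) (Fin (k + 1)) ℂ} (h1 : A 0 0 = B 0 0)
    (h2 : ∀ j : Fin k, A 0 j.succ = B 0 j.succ) (h3 : ∀ i : Fin k, A i.succ 0 = B i.succ 0)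
    (h4 : ∀ i j : Fin k, A i.succ j.succ = B i.succ j.succ) : A = B := by
  ext i j
  induction i using Fin.cases <;> induction j using Fin.cases
  · exact h1
  · exact h2 _
  · exact h3 _
  · exact h4 _ _

theorem SaMat.star_apply (a : SaMat k) (i j : Fin k) : star (a.toMatrix i j) = a.toMatrix j i :=
  congrFun₂ a.conjTranspose_toMatrix j i

/-- Bordering as a linear equivalence. -/
def borderEquiv (k : ℕ) : (SaMat k × (Fin k → ℂ) × ℝ) ≃ₗ[ℝ] SaMat (k + 1) where
  toFun p := border p.1 p.2.1 p.2.2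
  map_add' p q := SaMat.toMatrix_injective (ext_border (by simp) (by simp) (by simp) (by simp))
  map_smul' r p := SaMat.toMatrix_injective (ext_border (by simp) (by simp) (by simp) (by simp))
  invFun c := (SaMat.mk (c.toMatrix.submatrix Fin.succ Fin.succ) (by
    rw [conjTranspose_submatrix, c.conjTranspose_toMatrix]), fun i => c.toMatrix i.succ 0,
    (c.toMatrix 0 0).re)
  left_inv p := by
    refine Prod.ext (SaMat.toMatrix_injective ?_) (Prod.ext ?_ ?_)
    · ext i j; simp
    · funext i; simp
    · simp
  right_inv c := by
    refine SaMat.toMatrix_injective (ext_border ?_ ?_ ?_ ?_)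
    · simpa using Complex.conj_eq_iff_re.1 (c.star_apply 0 0)
    · intro j; simpa using c.star_apply j.succ 0
    · intro i; simp
    · intro i j; simp

theorem finrank_saMat (k : ℕ) : Module.finrank ℝ (SaMat k) = k ^ 2 := by
  induction k with
  | zero =>
    have : Subsingleton (SaMat 0) := SaMat.toMatrix_injective.subsingleton
    simpa using Module.finrank_zero_of_subsingleton
  | succ k ih =>
    rw [← (borderEquiv k).finrank_eq, Module.finrank_prod, Module.finrank_prod, ih]
    simp [Module.finrank_pi_fintype]
    ring

/-- The unnormalized trace of the square splits over the blocks, with v counted once as a column and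
once as a row. A Gaussian in the bordered matrix therefore factors. -/
theorem border_norm_sq (b : SaMat k) (v : Fin k → ℂ) (t : ℝ) :
    ((k + 1 : ℕ) : ℝ) * ‖border b v t‖ ^ 2 = k * ‖b‖ ^ 2 + 2 * ∑ i, ‖v i‖ ^ 2 + t ^ 2 := by
  have hk : (k : ℝ) * ‖b‖ ^ 2 = ∑ i, ∑ j, ‖b.toMatrix i j‖ ^ 2 := by
    rw [SaMat.norm_sq_eq]
    rcases Nat.eq_zero_or_pos k with rfl | hk
    · simp
    · field_simp
  rw [hk, SaMat.norm_sq_eq, mul_div_cancel₀ _ (Nat.cast_ne_zero.2 k.succ_ne_zero)]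
  simp only [Fin.sum_univ_succ, border_zero_zero, border_zero_succ, border_succ_zero,
    border_succ_succ, norm_star, Complex.norm_real, Real.norm_eq_abs, sq_abs,
    Finset.sum_add_distrib]
  ring

/-- The unitary `1 ⊕ U`. -/
def borderUnitary (U : unitaryGroup (Fin k) ℂ) : unitaryGroup (Fin (k + 1)) ℂ :=
  ⟨Matrix.of (Fin.cons (Fin.cons 1 0) fun i => Fin.cons 0 ((U : Matrix (Fin k) (Fin k) ℂ) i)), by
    have hU := congrFun₂ (Unitary.coe_mul_star_self U)
    rw [mem_unitaryGroup_iff]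
    refine ext_border ?_ ?_ ?_ ?_
    · simp [mul_apply, Fin.sum_univ_succ]
    · simp [mul_apply, Fin.sum_univ_succ, Fin.succ_ne_zero, eq_comm]
    · simp [mul_apply, Fin.sum_univ_succ, Fin.succ_ne_zero]
    · intro i j
      have := hU i j
      rw [mul_apply] at this ⊢
      rw [Fin.sum_univ_succ]
      simpa [one_apply] using this⟩

theorem border_conj (U : unitaryGroup (Fin k) ℂ) (b : SaMat k) (v : Fin k → ℂ) (t : ℝ) :
    border (SaMat.conj U b) ((U : Matrix (Fin k) (Fin k) ℂ) *ᵥ v) t =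
      SaMat.conj (borderUnitary U) (border b v t) := by
  apply SaMat.toMatrix_injective
  refine ext_border ?_ ?_ ?_ ?_
  · simp [SaMat.toMatrix_conj, mul_apply, Fin.sum_univ_succ, borderUnitary]
  · intro j
    simp [SaMat.toMatrix_conj, mul_apply, Fin.sum_univ_succ, borderUnitary, mulVec, dotProduct,
      mul_comm]
  · intro i
    simp [SaMat.toMatrix_conj, mul_apply, Fin.sum_univ_succ, borderUnitary, mulVec, dotProduct]
  · intro i j
    simp [SaMat.toMatrix_conj, mul_apply, Fin.sum_univ_succ, borderUnitary]

theorem continuous_border :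
    Continuous fun p : SaMat k × (Fin k → ℂ) × ℝ => border p.1 p.2.1 p.2.2 :=
  (borderEquiv k).toLinearMap.continuous_of_finiteDimensional

open Polynomial in
/-- A bordered diagonal matrix has the spectrum prescribed by the secular equation. -/
theorem charpoly_border_diag {y : Fin k → ℝ} {x : Fin (k + 1) → ℝ} (h : Interlace y x)
    {v : Fin k → ℂ} (hv : ∀ i, Complex.normSq (v i) = secularWeight y x i) :
    (border (SaMat.diag y) v (secularMap y x 0)).toMatrix.charpoly =
      ∏ j, (X - C (x j : ℂ)) := by
  set A := (border (SaMat.diag y) v (secularMap y x 0)).toMatrix with hA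
  have hroot : ∀ j, A.charpoly.eval (x j : ℂ) = 0 := by
    intro j
    rw [Matrix.eval_charpoly, ← Matrix.exists_mulVec_eq_zero_iff]
    -- The eigenvector for x j: the lower rows force the entries v i / (x j - y i), and the top row
    -- is then the secular equation.
    refine ⟨Fin.cons 1 fun i => v i / ((x j : ℂ) - y i), fun h0 => ?_, ?_⟩
    · simpa using congrFun h0 0
    · have hne : ∀ i, (x j : ℂ) - y i ≠ 0 := fun i => by
        rw [← Complex.ofReal_sub]
        exact Complex.ofReal_ne_zero.2 (sub_ne_zero.2 (h.ne i j).symm)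
      rw [sub_mulVec, sub_eq_zero]
      funext l
      rw [scalar_apply, mulVec_diagonal]
      induction l using Fin.cases with
      | zero =>
        simp only [mulVec, dotProduct, Fin.sum_univ_succ, hA, border_zero_zero, border_zero_succ,
          Fin.cons_zero, Fin.cons_succ, mul_one]
        have h1 := congrArg (fun r : ℝ => (r : ℂ)) (h.secular_eq j)
        push_cast at h1
        rw [h1]
        congr 1
        refine Finset.sum_congr rfl fun i _ => ?_
        rw [← hv i, Complex.normSq_eq_conj_mul_self, ← mul_div_assoc, ← h1]
        rfl
      | succ i =>
        simp only [mulVec, dotProduct, Fin.sum_univ_succ, hA, border_succ_zero, border_succ_succ,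
          Fin.cons_zero, Fin.cons_succ, mul_one, SaMat.toMatrix_diag]
        rw [Finset.sum_eq_single i (fun l _ hl => by rw [diagonal_apply_ne' _ hl, zero_mul])
          (by simp), diagonal_apply_eq]
        have := hne i
        field_simp
        ring
  have hx : Function.Injective fun j => (x j : ℂ) :=
    Complex.ofReal_injective.comp h.strictMono.injective
  have h0 : A.charpoly - ∏ j, (X - C (x j : ℂ)) = 0 := by
    refine eq_zero_of_degree_lt_of_eval_index_eq_zero (v := fun j => (x j : ℂ)) Finset.univ
      hx.injOn ?_ fun j _ => ?_
    · have hm : (∏ j, (X - C (x j : ℂ))).Monic := monic_prod_of_monic _ _ fun _ _ => monic_X_sub_C _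
      have hd : (∏ j, (X - C (x j : ℂ))).degree = ((k + 1 : ℕ) : WithBot ℕ) := by
        rw [degree_prod]; simp
      have h2 := degree_sub_lt_left (p := A.charpoly) (q := ∏ j, (X - C (x j : ℂ))) (by
        rw [hd, charpoly_degree_eq_dim, Fintype.card_fin]) (charpoly_monic A).ne_zero (by
        rw [charpoly_monic A, hm])
      rw [charpoly_degree_eq_dim, Fintype.card_fin] at h2
      rwa [Finset.card_univ, Fintype.card_fin]
    · rw [eval_sub, hroot, zero_sub, neg_eq_zero, eval_prod]
      exact Finset.prod_eq_zero (Finset.mem_univ j) (by simp)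
  exact sub_eq_zero.1 h0

theorem exists_border_diag_eq_conj {y : Fin k → ℝ} {x : Fin (k + 1) → ℝ} (h : Interlace y x)
    {v : Fin k → ℂ} (hv : ∀ i, Complex.normSq (v i) = secularWeight y x i) :
    ∃ U, border (SaMat.diag y) v (secularMap y x 0) = SaMat.conj U (SaMat.diag x) :=
  SaMat.exists_conj_of_charpoly_eq _ _ (by rw [charpoly_border_diag h hv, SaMat.charpoly_diag])

end

/-! ### Gaussian integrals -/

theorem lintegral_gaussian {V : Type*} [NormedAddCommGroup V] [InnerProductSpace ℝ V]
    [FiniteDimensional ℝ V] [MeasurableSpace V] [BorelSpace V] {c : ℝ} (hc : 0 < c) :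
    ∫⁻ x : V, ENNReal.ofReal (Real.exp (-c * ‖x‖ ^ 2)) =
      ENNReal.ofReal ((Real.pi / c) ^ (Module.finrank ℝ V / 2 : ℝ)) := by
  rw [← GaussianFourier.integral_rexp_neg_mul_sq_norm (V := V) hc,
    ofReal_integral_eq_lintegral_ofReal]
  · refine Integrable.of_integral_ne_zero ?_
    rw [GaussianFourier.integral_rexp_neg_mul_sq_norm hc]
    positivity
  · exact Eventually.of_forall fun x => (Real.exp_pos _).le

/-! ### Integration in bordered coordinates -/

/-- The Gaussian integral `∫ exp (-k |b|²)` over `SaMat k`. -/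
def gaussConst (k : ℕ) : ℝ := (Real.pi / k) ^ ((k : ℝ) ^ 2 / 2)

theorem gaussConst_pos (k : ℕ) : 0 < gaussConst k := by
  rcases Nat.eq_zero_or_pos k with rfl | hk
  · simp [gaussConst]
  · have : (0 : ℝ) < k := Nat.cast_pos.2 hk
    rw [gaussConst]
    positivity

theorem lintegral_gaussian_saMat (k : ℕ) :
    ∫⁻ b : SaMat k, ENNReal.ofReal (Real.exp (-k * ‖b‖ ^ 2)) = ENNReal.ofReal (gaussConst k) := by
  rcases Nat.eq_zero_or_pos k with rfl | hk
  · have : Subsingleton (SaMat 0) := SaMat.toMatrix_injective.subsingleton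
    have h := lintegral_gaussian (V := SaMat 0) one_pos
    rw [finrank_saMat] at h
    refine Eq.trans (lintegral_congr fun b => ?_) (h.trans ?_)
    · rw [Subsingleton.elim b 0]; simp
    · simp [gaussConst]
  · rw [lintegral_gaussian (Nat.cast_pos.2 hk), finrank_saMat, gaussConst]
    push_cast
    rfl

theorem lintegral_gaussian_pi_complex (k : ℕ) :
    ∫⁻ v : Fin k → ℂ, ENNReal.ofReal (Real.exp (-(2 * ∑ i, ‖v i‖ ^ 2))) =
      ENNReal.ofReal ((Real.pi / 2) ^ k) := by
  have h1 : ∫ z : ℂ, Real.exp (-2 * ‖z‖ ^ 2) = Real.pi / 2 := by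
    rw [GaussianFourier.integral_rexp_neg_mul_sq_norm two_pos]
    simp
  have h2 : ∀ v : Fin k → ℂ, Real.exp (-(2 * ∑ i, ‖v i‖ ^ 2)) =
      ∏ i, Real.exp (-2 * ‖v i‖ ^ 2) := fun v => by
    rw [← Real.exp_sum, ← Finset.mul_sum, neg_mul]
  have h3 : ∫ v : Fin k → ℂ, Real.exp (-(2 * ∑ i, ‖v i‖ ^ 2)) = (Real.pi / 2) ^ k := by
    simp only [h2]
    rw [integral_fintype_prod_volume_eq_prod (fun (_ : Fin k) (z : ℂ) => Real.exp (-2 * ‖z‖ ^ 2))]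
    simp only [h1, Finset.prod_const, Finset.card_univ, Fintype.card_fin]
  rw [← h3, ofReal_integral_eq_lintegral_ofReal]
  · refine Integrable.of_integral_ne_zero ?_
    rw [h3]
    positivity
  · exact Eventually.of_forall fun x => (Real.exp_pos _).le

/-- The density of Lebesgue measure on `SaMat (k + 1)` in bordered coordinates. -/
def borderConst (k : ℕ) : ℝ :=
  gaussConst (k + 1) / (gaussConst k * (Real.pi / 2) ^ k * Real.sqrt Real.pi)

/-- Bordering is a linear isomorphism, so by uniqueness of Haar measure the two Lebesgue measures
differ by a constant factor. Integrating one Gaussian on both sides identifies the constant. -/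
theorem lintegral_saMat_succ {k : ℕ} {f : SaMat (k + 1) → ℝ≥0∞} (hf : Measurable f) :
    ∫⁻ c, f c = ENNReal.ofReal (borderConst k) *
      ∫⁻ b : SaMat k, ∫⁻ v : Fin k → ℂ, ∫⁻ t : ℝ, f (border b v t) := by
  let L : (SaMat k × (Fin k → ℂ) × ℝ) ≃L[ℝ] SaMat (k + 1) :=
    (borderEquiv k).toContinuousLinearEquiv
  let ν : Measure (SaMat k × (Fin k → ℂ) × ℝ) :=
    (volume : Measure (SaMat k)).prod ((volume : Measure (Fin k → ℂ)).prod volume)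
  have hν₀ : ((volume : Measure (Fin k → ℂ)).prod (volume : Measure ℝ)).IsAddHaarMeasure :=
    Measure.prod.instIsAddHaarMeasure (volume : Measure (Fin k → ℂ)) (volume : Measure ℝ)
  have hν : ν.IsAddHaarMeasure := Measure.prod.instIsAddHaarMeasure (volume : Measure (SaMat k))
    ((volume : Measure (Fin k → ℂ)).prod (volume : Measure ℝ))
  let μ : Measure (SaMat (k + 1)) := ν.map L
  have hμ : μ.IsAddHaarMeasure := L.isAddHaarMeasure_map ν
  have hc : (volume : Measure (SaMat (k + 1))) =
      (volume : Measure (SaMat (k + 1))).addHaarScalarFactor μ • μ :=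
    Measure.isAddLeftInvariant_eq_smul _ _
  set c := (volume : Measure (SaMat (k + 1))).addHaarScalarFactor μ
  have key : ∀ {g : SaMat (k + 1) → ℝ≥0∞}, Measurable g → ∫⁻ c, g c = c *
      ∫⁻ b : SaMat k, ∫⁻ v : Fin k → ℂ, ∫⁻ t : ℝ, g (border b v t) := by
    intro g hg
    have hgL : Measurable fun p : SaMat k × (Fin k → ℂ) × ℝ => g (border p.1 p.2.1 p.2.2) :=
      hg.comp continuous_border.measurable
    rw [hc, lintegral_smul_measure, lintegral_map hg L.continuous.measurable]
    change (c : ℝ≥0∞) * ∫⁻ p, g (border p.1 p.2.1 p.2.2) ∂ν = _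
    rw [lintegral_prod _ hgL.aemeasurable]
    congr 1
    refine lintegral_congr fun b => ?_
    exact lintegral_prod (fun q : (Fin k → ℂ) × ℝ => g (border b q.1 q.2))
      (hgL.comp measurable_prodMk_left).aemeasurable
  have hG := key (g := fun c => ENNReal.ofReal (Real.exp (-(k + 1 : ℕ) * ‖c‖ ^ 2))) (by fun_prop)
  rw [lintegral_gaussian_saMat] at hG
  have h1 : ∀ (b : SaMat k) (v : Fin k → ℂ) (t : ℝ),
      ENNReal.ofReal (Real.exp (-(k + 1 : ℕ) * ‖border b v t‖ ^ 2)) =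
      ENNReal.ofReal (Real.exp (-k * ‖b‖ ^ 2)) *
        (ENNReal.ofReal (Real.exp (-(2 * ∑ i, ‖v i‖ ^ 2))) *
          ENNReal.ofReal (Real.exp (-1 * ‖t‖ ^ 2))) := by
    intro b v t
    rw [← ENNReal.ofReal_mul (Real.exp_pos _).le, ← ENNReal.ofReal_mul (Real.exp_pos _).le,
      ← Real.exp_add, ← Real.exp_add, neg_mul, border_norm_sq, Real.norm_eq_abs, sq_abs]
    congr 2
    ring
  simp only [h1] at hG
  have h2 : ∫⁻ t : ℝ, ENNReal.ofReal (Real.exp (-1 * ‖t‖ ^ 2)) =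
      ENNReal.ofReal (Real.sqrt Real.pi) := by
    rw [lintegral_gaussian one_pos, Real.sqrt_eq_rpow]
    simp
  simp only [lintegral_const_mul' _ _ ENNReal.ofReal_ne_top, h2] at hG
  simp only [lintegral_mul_const' _ _ ENNReal.ofReal_ne_top, lintegral_gaussian_pi_complex] at hG
  rw [lintegral_mul_const' _ _ (ENNReal.mul_ne_top ENNReal.ofReal_ne_top ENNReal.ofReal_ne_top),
    lintegral_gaussian_saMat, ← ENNReal.ofReal_mul (by positivity),
    ← ENNReal.ofReal_mul (gaussConst_pos k).le] at hG
  rw [key hf]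
  congr 1
  have hpos : 0 < gaussConst k * ((Real.pi / 2) ^ k * Real.sqrt Real.pi) :=
    mul_pos (gaussConst_pos k) (by positivity)
  rw [borderConst, mul_assoc, ENNReal.ofReal_div_of_pos hpos, hG,
    ENNReal.mul_div_cancel_right (ENNReal.ofReal_pos.2 hpos).ne' ENNReal.ofReal_ne_top]

/-- A linear bijection scales Lebesgue measure by a constant. The Gaussian is invariant under U and
has a finite nonzero integral, so the constant is 1. -/
theorem measurePreserving_unitary_mulVec {k : ℕ} (U : unitaryGroup (Fin k) ℂ) :
    MeasurePreserving (fun v : Fin k → ℂ => (U : Matrix (Fin k) (Fin k) ℂ) *ᵥ v) := by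
  let L : (Fin k → ℂ) →ₗ[ℝ] (Fin k → ℂ) :=
    (Matrix.mulVecLin (U : Matrix (Fin k) (Fin k) ℂ)).restrictScalars ℝ
  have hL : ∀ v, L v = (U : Matrix (Fin k) (Fin k) ℂ) *ᵥ v := fun v => rfl
  have hU : (U : Matrix (Fin k) (Fin k) ℂ)ᴴ * (U : Matrix (Fin k) (Fin k) ℂ) = 1 :=
    Unitary.coe_star_mul_self U
  have hinj : Function.Injective L := fun v w h => by
    have := congrArg ((U : Matrix (Fin k) (Fin k) ℂ)ᴴ *ᵥ ·) h
    simpa [hL, mulVec_mulVec, hU] using this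
  have hdet : LinearMap.det L ≠ 0 :=
    (LinearEquiv.isUnit_det' (LinearEquiv.ofInjectiveEndo L hinj)).ne_zero
  have hmap := Measure.map_linearMap_addHaar_eq_smul_addHaar
    (volume : Measure (Fin k → ℂ)) hdet
  have hLm : Measurable L := L.continuous_of_finiteDimensional.measurable
  have hnorm : ∀ v : Fin k → ℂ, ∑ i, ‖L v i‖ ^ 2 = ∑ i, ‖v i‖ ^ 2 := fun v => by
    have h1 : ∀ w : Fin k → ℂ, ((∑ i, ‖w i‖ ^ 2 : ℝ) : ℂ) = star w ⬝ᵥ w := fun w => by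
      simp [dotProduct, Complex.conj_mul']
    apply Complex.ofReal_injective
    rw [h1, h1, hL, star_mulVec, ← dotProduct_mulVec, mulVec_mulVec, hU, one_mulVec]
  refine ⟨hLm, ?_⟩
  change Measure.map L volume = volume
  have hI := lintegral_gaussian_pi_complex k
  have hI' : ∫⁻ v, ENNReal.ofReal (Real.exp (-(2 * ∑ i, ‖v i‖ ^ 2))) ∂Measure.map L volume =
      ENNReal.ofReal ((Real.pi / 2) ^ k) := by
    rw [lintegral_map (by fun_prop) hLm, ← hI]
    simp only [hnorm]
  rw [hmap, lintegral_smul_measure, hI] at hI'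
  have hpos : ENNReal.ofReal ((Real.pi / 2) ^ k) ≠ 0 := (ENNReal.ofReal_pos.2 (by positivity)).ne'
  have h1 : ENNReal.ofReal |(LinearMap.det L)⁻¹| = 1 := by
    have := congrArg (· / ENNReal.ofReal ((Real.pi / 2) ^ k)) hI'
    simpa only [smul_eq_mul, ENNReal.mul_div_cancel_right hpos ENNReal.ofReal_ne_top,
      ENNReal.div_self hpos ENNReal.ofReal_ne_top] using this
  rw [hmap, h1, one_smul]

/-- The disc |z|² ≤ b has area πb, and values on half-lines determine the measure. -/
theorem map_normSq_volume : (volume : Measure ℂ).map Complex.normSq =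
    ENNReal.ofReal Real.pi • (volume : Measure ℝ).restrict (Set.Ioi 0) := by
  have hm : Measurable Complex.normSq := Complex.continuous_normSq.measurable
  have hIic : ∀ b : ℝ, (volume : Measure ℂ).map Complex.normSq (Set.Iic b) =
      ENNReal.ofReal (Real.pi * b) := by
    intro b
    rw [Measure.map_apply hm measurableSet_Iic]
    rcases le_or_gt 0 b with hb | hb
    · have : Complex.normSq ⁻¹' Set.Iic b = Metric.closedBall 0 (Real.sqrt b) := by
        ext z
        simp [Complex.normSq_eq_norm_sq, Real.le_sqrt (norm_nonneg z) hb]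
      rw [this, Complex.volume_closedBall, ← ENNReal.ofReal_pow (Real.sqrt_nonneg _),
        Real.sq_sqrt hb, mul_comm Real.pi, ENNReal.ofReal_mul hb]
      congr 1
      rw [ENNReal.ofReal, ← NNReal.coe_real_pi, Real.toNNReal_coe]
    · have : Complex.normSq ⁻¹' Set.Iic b = ∅ := by
        ext z
        simpa using hb.trans_le (Complex.normSq_nonneg z)
      rw [this, measure_empty, ENNReal.ofReal_of_nonpos]
      exact mul_nonpos_of_nonneg_of_nonpos Real.pi_pos.le hb.le
  have hIic' : ∀ b : ℝ, (ENNReal.ofReal Real.pi • (volume : Measure ℝ).restrict (Set.Ioi 0))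
      (Set.Iic b) = ENNReal.ofReal (Real.pi * b) := by
    intro b
    rw [Measure.smul_apply, Measure.restrict_apply measurableSet_Iic, Set.inter_comm,
      Set.Ioi_inter_Iic, Real.volume_Ioc, sub_zero, smul_eq_mul, ENNReal.ofReal_mul Real.pi_pos.le]
  have hfin : IsLocallyFiniteMeasure ((volume : Measure ℂ).map Complex.normSq) :=
    ⟨fun b => ⟨Set.Iic (b + 1), Iic_mem_nhds (lt_add_one b), by
      rw [hIic]; exact ENNReal.ofReal_lt_top⟩⟩
  refine Measure.ext_of_Ioc _ _ fun a b hab => ?_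
  have hd : Set.Ioc a b = Set.Iic b \ Set.Iic a := by ext z; simp [and_comm]
  rw [hd, measure_sdiff (Set.Iic_subset_Iic.2 hab.le)
    measurableSet_Iic.nullMeasurableSet (by rw [hIic]; exact ENNReal.ofReal_ne_top),
    measure_sdiff (Set.Iic_subset_Iic.2 hab.le)
    measurableSet_Iic.nullMeasurableSet (by rw [hIic']; exact ENNReal.ofReal_ne_top)]
  simp only [hIic, hIic']

theorem lintegral_normSq {k : ℕ} {G : (Fin k → ℝ) → ℝ≥0∞} (hG : Measurable G) :
    ∫⁻ v : Fin k → ℂ, G (fun i => Complex.normSq (v i)) =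
      ENNReal.ofReal (Real.pi ^ k) * ∫⁻ w in {w | ∀ i, 0 < w i}, G w := by
  have hm : Measurable Complex.normSq := Complex.continuous_normSq.measurable
  have hσ : SigmaFinite ((volume : Measure ℂ).map Complex.normSq) := by
    rw [map_normSq_volume]
    change SigmaFinite (Real.toNNReal Real.pi • (volume : Measure ℝ).restrict (Set.Ioi 0))
    infer_instance
  have h1 : (volume : Measure (Fin k → ℂ)).map (fun v i => Complex.normSq (v i)) =
      ENNReal.ofReal (Real.pi ^ k) • (volume : Measure (Fin k → ℝ)).restrict {w | ∀ i, 0 < w i} := by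
    rw [volume_pi, Measure.pi_map_pi (fun _ => hm.aemeasurable)]
    refine Measure.pi_eq fun s hs => ?_
    have h2 : {w : Fin k → ℝ | ∀ i, 0 < w i} = Set.univ.pi fun _ => Set.Ioi 0 := by
      ext w; simp
    rw [map_normSq_volume, h2, volume_pi, Measure.restrict_pi_pi, Measure.smul_apply,
      Measure.pi_pi]
    simp only [Measure.smul_apply, smul_eq_mul, Finset.prod_mul_distrib]
    rw [ENNReal.ofReal_pow Real.pi_pos.le]
    simp
  have h3 : Measurable fun (v : Fin k → ℂ) i => Complex.normSq (v i) :=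
    measurable_pi_lambda _ fun i => hm.comp (measurable_pi_apply i)
  rw [← lintegral_map hG h3, h1, lintegral_smul_measure, smul_eq_mul]

/-! ### The Weyl integration formula -/

/-- The constant of the Weyl integration formula. -/
def weylConst (k : ℕ) : ℝ :=
  gaussConst k * ∏ j ∈ Finset.range k, ((2 : ℝ) ^ j / (j.factorial * Real.sqrt Real.pi))

theorem weylConst_pos (k : ℕ) : 0 < weylConst k :=
  mul_pos (gaussConst_pos k) (Finset.prod_pos fun j _ => by positivity)

/-- The factors of the inductive step: the density of bordered coordinates, π^k from passing to the
|v i|², and 1/k! from the interlacing box. -/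
theorem weylConst_succ (k : ℕ) :
    weylConst (k + 1) = borderConst k * weylConst k * Real.pi ^ k / k.factorial := by
  have := (gaussConst_pos k).ne'
  have h2 : (2 : ℝ) ^ k ≠ 0 := by positivity
  have h3 : Real.pi ^ k ≠ 0 := by positivity
  rw [weylConst, weylConst, borderConst, Finset.prod_range_succ, div_pow]
  generalize ∏ j ∈ Finset.range k, ((2 : ℝ) ^ j / (j.factorial * Real.sqrt Real.pi)) = P
  field_simp

theorem continuous_border_left {k : ℕ} (b : SaMat k) :
    Continuous fun p : (Fin k → ℂ) × ℝ => border b p.1 p.2 :=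
  continuous_border.comp (Continuous.prodMk_right b)

/-- By the secular equation the spectrum of the bordered matrix, hence the value of F, depends on v
only through the |v i|². Integration over v becomes integration over positive weights, and the
secular map then passes from (t, w) to the spectrum x. -/
theorem lintegral_border_diag {k : ℕ} {F : SaMat (k + 1) → ℝ≥0∞} (hF : Measurable F)
    (hinv : ∀ U b, F (SaMat.conj U b) = F b) {y : Fin k → ℝ} (hy : StrictMono y) :
    ∫⁻ v : Fin k → ℂ, ∫⁻ t : ℝ, F (border (SaMat.diag y) v t) = ENNReal.ofReal (Real.pi ^ k) *
      ∫⁻ x in {x | Interlace y x}, ENNReal.ofReal (vdm x / vdm y) * F (SaMat.diag x) := by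
  let r : (Fin k → ℝ) → Fin k → ℂ := fun w i => ((Real.sqrt (w i) : ℝ) : ℂ)
  have hr : Continuous r := by fun_prop
  let H : ℝ × (Fin k → ℝ) → ℝ≥0∞ := fun p => F (border (SaMat.diag y) (r p.2) p.1)
  have hH : Measurable H := hF.comp ((continuous_border_left _).comp
    ((hr.comp continuous_snd).prodMk continuous_fst)).measurable
  have hrw : ∀ w : Fin k → ℝ, (∀ i, 0 < w i) → ∀ i, Complex.normSq (r w i) = w i := fun w hw i => by
    simp only [r, Complex.normSq_ofReal]
    exact Real.mul_self_sqrt (hw i).le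
  -- Strict interlacing needs positive weights, and the vectors with a zero entry form a null set.
  have h1 : ∀ᵐ v : Fin k → ℂ, ∀ i, v i ≠ 0 := by
    rw [ae_all_iff]
    intro i
    exact Measure.tendsto_eval_ae_ae (μ := fun _ : Fin k => (volume : Measure ℂ)) (i := i)
      (compl_mem_ae_iff.2 (measure_singleton (0 : ℂ)))
  have h2 : ∫⁻ v : Fin k → ℂ, ∫⁻ t : ℝ, F (border (SaMat.diag y) v t) =
      ∫⁻ v : Fin k → ℂ, ∫⁻ t : ℝ, H (t, fun i => Complex.normSq (v i)) := by
    refine lintegral_congr_ae ?_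
    filter_upwards [h1] with v hv
    refine lintegral_congr fun t => ?_
    have hpos : ∀ i, 0 < Complex.normSq (v i) := fun i => Complex.normSq_pos.2 (hv i)
    obtain ⟨x, hx, hxt⟩ := exists_secularMap_eq hy t hpos
    have hw : ∀ i, secularWeight y x i = Complex.normSq (v i) := fun i => by
      have := congrFun hxt i.succ
      simpa [secularMap] using this
    have ht : secularMap y x 0 = t := by rw [hxt, Fin.cons_zero]
    obtain ⟨U, hU⟩ := exists_border_diag_eq_conj hx (v := v) fun i => (hw i).symm
    obtain ⟨V, hV⟩ := exists_border_diag_eq_conj hx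
      (v := r fun i => Complex.normSq (v i)) fun i => by rw [hw, hrw _ hpos]
    rw [ht] at hU hV
    simp only [H, hU, hV, hinv]
  have h3 : Measurable fun w : Fin k → ℝ => ∫⁻ t, H (t, w) :=
    hH.lintegral_prod_left'
  rw [h2, lintegral_normSq h3]
  congr 1
  have hms : MeasurableSet {w : Fin k → ℝ | ∀ i, 0 < w i} := by
    have : {w : Fin k → ℝ | ∀ i, 0 < w i} = Set.univ.pi fun _ => Set.Ioi 0 := by
      ext w; simp
    rw [this]
    exact MeasurableSet.univ_pi fun _ => measurableSet_Ioi
  have e := volume_preserving_piFinSuccAbove (fun _ : Fin (k + 1) => ℝ) 0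
  have hG : Measurable fun p : ℝ × (Fin k → ℝ) =>
      {w : Fin k → ℝ | ∀ i, 0 < w i}.indicator (fun w => H (p.1, w)) p.2 := by
    have : (fun p : ℝ × (Fin k → ℝ) =>
        {w : Fin k → ℝ | ∀ i, 0 < w i}.indicator (fun w => H (p.1, w)) p.2) =
        (Prod.snd ⁻¹' {w : Fin k → ℝ | ∀ i, 0 < w i}).indicator H := by
      ext p; simp [Set.indicator]
    rw [this]
    exact hH.indicator (measurable_snd hms)
  have h4 : ∫⁻ w in {w : Fin k → ℝ | ∀ i, 0 < w i}, ∫⁻ t, H (t, w) =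
      ∫⁻ u in {u : Fin (k + 1) → ℝ | ∀ i : Fin k, 0 < u i.succ}, H (u 0, Fin.tail u) := by
    have hms' : MeasurableSet {u : Fin (k + 1) → ℝ | ∀ i : Fin k, 0 < u i.succ} :=
      hms.preimage (measurable_pi_lambda (fun (u : Fin (k + 1) → ℝ) (i : Fin k) => u i.succ)
        fun i => measurable_pi_apply i.succ)
    rw [← lintegral_indicator hms, ← lintegral_indicator hms']
    have h5 := e.lintegral_comp hG
    rw [Measure.volume_eq_prod, lintegral_prod_symm' _ hG] at h5
    refine Eq.trans (lintegral_congr fun w => ?_) (h5.symm.trans (lintegral_congr fun u => ?_))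
    · by_cases hw : ∀ i, 0 < w i
      · simp [Set.indicator, hw]
      · simp [Set.indicator, hw]
    · simp only [Set.indicator, Set.mem_ofPred_eq]
      rfl
  rw [h4, lintegral_secularMap hy]
  refine setLIntegral_congr_fun (measurableSet_interlace y) fun x hx => ?_
  simp only [H]
  congr 1
  have hx' : Interlace y x := hx
  obtain ⟨V, hV⟩ := exists_border_diag_eq_conj hx' (v := r (secularWeight y x))
    fun i => hrw _ hx'.secularWeight_pos i
  rw [← hinv V (SaMat.diag x), ← hV]
  rfl

theorem measurableSet_strictMono (k : ℕ) : MeasurableSet {x : Fin k → ℝ | StrictMono x} := by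
  have : {x : Fin k → ℝ | StrictMono x} =
      ⋂ i : Fin k, ⋂ j : Fin k, ⋂ _ : i < j, {x | x i < x j} := by
    ext x; simp [StrictMono]
  rw [this]
  exact MeasurableSet.iInter fun i => MeasurableSet.iInter fun j => MeasurableSet.iInter fun _ =>
    measurableSet_lt (measurable_pi_apply i) (measurable_pi_apply j)

theorem measurableSet_interlace_prod (k : ℕ) :
    MeasurableSet {p : (Fin k → ℝ) × (Fin (k + 1) → ℝ) | Interlace p.1 p.2} := by
  have : {p : (Fin k → ℝ) × (Fin (k + 1) → ℝ) | Interlace p.1 p.2} =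
      ⋂ i : Fin k, {p | p.2 i.castSucc < p.1 i ∧ p.1 i < p.2 i.succ} := by
    ext x; simp [Interlace]
  rw [this]
  have h1 : ∀ i : Fin k, Measurable fun p : (Fin k → ℝ) × (Fin (k + 1) → ℝ) => p.1 i :=
    fun i => (measurable_pi_apply i).comp measurable_fst
  have h2 : ∀ i : Fin (k + 1), Measurable fun p : (Fin k → ℝ) × (Fin (k + 1) → ℝ) => p.2 i :=
    fun i => (measurable_pi_apply i).comp measurable_snd
  exact MeasurableSet.iInter fun i =>
    (measurableSet_lt (h2 _) (h1 i)).inter (measurableSet_lt (h1 i) (h2 _))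

/-- Integrating over interlacing pairs, first over the `k + 1` variables and then over the `k`
variables. -/
theorem lintegral_interlace_swap {k : ℕ} {g : (Fin (k + 1) → ℝ) → ℝ≥0∞} (hg : Measurable g) :
    ∫⁻ y in {y : Fin k → ℝ | StrictMono y}, ENNReal.ofReal (vdm y ^ 2) *
      ∫⁻ x in {x | Interlace y x}, ENNReal.ofReal (vdm x / vdm y) * g x =
    ∫⁻ x in {x : Fin (k + 1) → ℝ | StrictMono x},
      ENNReal.ofReal (vdm x ^ 2 / k.factorial) * g x := by
  -- One factor of the squared Vandermonde product cancels the Jacobian denominator, so the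
  -- integrand is linear in vdm y and `lintegral_vdm_box` applies after the swap.
  let K : (Fin k → ℝ) → (Fin (k + 1) → ℝ) → ℝ≥0∞ := fun y x =>
    {p : (Fin k → ℝ) × (Fin (k + 1) → ℝ) | Interlace p.1 p.2}.indicator
      (fun p => ENNReal.ofReal (vdm p.1) * (ENNReal.ofReal (vdm p.2) * g p.2)) (y, x)
  have hK : Measurable (Function.uncurry K) := by
    have hv : ∀ m : ℕ, Measurable (vdm : (Fin m → ℝ) → ℝ) := fun m => continuous_vdm.measurable
    refine Measurable.indicator ?_ (measurableSet_interlace_prod k)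
    exact ((hv k).comp measurable_fst).ennreal_ofReal.mul
      (((hv _).comp measurable_snd).ennreal_ofReal.mul (hg.comp measurable_snd))
  have h1 : ∫⁻ y in {y : Fin k → ℝ | StrictMono y}, ENNReal.ofReal (vdm y ^ 2) *
      ∫⁻ x in {x | Interlace y x}, ENNReal.ofReal (vdm x / vdm y) * g x = ∫⁻ y, ∫⁻ x, K y x := by
    rw [← lintegral_indicator (measurableSet_strictMono k)]
    refine lintegral_congr fun y => ?_
    by_cases hy : StrictMono y
    · rw [Set.indicator_of_mem (show y ∈ {y : Fin k → ℝ | StrictMono y} from hy),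
        ← lintegral_const_mul' _ _ ENNReal.ofReal_ne_top,
        ← lintegral_indicator (measurableSet_interlace y)]
      refine lintegral_congr fun x => ?_
      by_cases hx : Interlace y x
      · simp only [Set.indicator, Set.mem_ofPred_eq, hx, K, if_true]
        rw [← mul_assoc, ← mul_assoc, ← ENNReal.ofReal_mul (sq_nonneg _),
          ← ENNReal.ofReal_mul (vdm_pos hy).le]
        congr 2
        have := (vdm_pos hy).ne'
        field_simp
      · simp [Set.indicator, hx, K]
    · rw [Set.indicator_of_notMem (show y ∉ {y : Fin k → ℝ | StrictMono y} from hy)]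
      rw [← lintegral_zero (μ := (volume : Measure (Fin (k + 1) → ℝ)))]
      refine lintegral_congr fun x => ?_
      have hx : ¬ Interlace y x := fun hx => hy hx.strictMono_left
      simp [Set.indicator, hx, K]
  rw [h1, lintegral_lintegral_swap hK.aemeasurable,
    ← lintegral_indicator (measurableSet_strictMono (k + 1))]
  refine lintegral_congr fun x => ?_
  by_cases hx : StrictMono x
  · rw [Set.indicator_of_mem (show x ∈ {x : Fin (k + 1) → ℝ | StrictMono x} from hx)]
    have hms : MeasurableSet {y : Fin k → ℝ | Interlace y x} :=
      measurable_prodMk_right (measurableSet_interlace_prod k)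
    have h2 : ∀ y, K y x = {y : Fin k → ℝ | Interlace y x}.indicator
        (fun y => ENNReal.ofReal (vdm y)) y * (ENNReal.ofReal (vdm x) * g x) := by
      intro y
      by_cases hyx : Interlace y x
      · simp [Set.indicator, hyx, K]
      · simp [Set.indicator, hyx, K]
    simp only [h2]
    have hm : Measurable ({y : Fin k → ℝ | Interlace y x}.indicator
        fun y => ENNReal.ofReal (vdm y)) :=
      (continuous_vdm.measurable.ennreal_ofReal).indicator hms
    rw [lintegral_mul_const _ hm, lintegral_indicator hms, lintegral_vdm_box hx, ← mul_assoc,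
      ← ENNReal.ofReal_mul (div_nonneg (vdm_pos hx).le (Nat.cast_nonneg _))]
    congr 2
    ring
  · rw [Set.indicator_of_notMem (show x ∉ {x : Fin (k + 1) → ℝ | StrictMono x} from hx)]
    rw [← lintegral_zero (μ := (volume : Measure (Fin k → ℝ)))]
    refine lintegral_congr fun y => ?_
    have hx' : ¬ Interlace y x := fun h => hx h.strictMono
    simp [Set.indicator, hx', K]

/-- **Weyl integration formula** for unitarily invariant functions on selfadjoint matrices. -/
theorem lintegral_eq_weyl (k : ℕ) : ∀ {f : SaMat k → ℝ≥0∞}, Measurable f →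
    (∀ U b, f (SaMat.conj U b) = f b) →
    ∫⁻ b, f b = ENNReal.ofReal (weylConst k) *
      ∫⁻ x in {x : Fin k → ℝ | StrictMono x}, ENNReal.ofReal (vdm x ^ 2) * f (SaMat.diag x) := by
  induction k with
  | zero =>
    intro f hf _
    have : Subsingleton (SaMat 0) := SaMat.toMatrix_injective.subsingleton
    have h1 : {x : Fin 0 → ℝ | StrictMono x} = Set.univ :=
      Set.eq_univ_of_forall fun x => Subsingleton.strictMono x
    have hc : ∀ b : SaMat 0, f b = f 0 := fun b => by rw [Subsingleton.elim b 0]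
    have hv : ∀ x : Fin 0 → ℝ, vdm x = 1 := fun x => by simp [vdm]
    have hvol := lintegral_gaussian_saMat 0
    simp only [Nat.cast_zero, neg_zero, zero_mul, Real.exp_zero, ENNReal.ofReal_one,
      lintegral_const, one_mul] at hvol
    simp only [hc, hv, h1, Measure.restrict_univ, lintegral_const, weylConst,
      Finset.range_zero, Finset.prod_empty, mul_one, hvol, one_pow, ENNReal.ofReal_one, one_mul]
    rw [volume_pi, Measure.pi_univ]
    simp [mul_comm]
  | succ k ih =>
    intro f hf hinv
    have hfb : Measurable fun p : SaMat k × (Fin k → ℂ) × ℝ => f (border p.1 p.2.1 p.2.2) :=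
      hf.comp continuous_border.measurable
    have hg1 : Measurable fun p : SaMat k × (Fin k → ℂ) => ∫⁻ t : ℝ, f (border p.1 p.2 t) := by
      have : Measurable fun q : (SaMat k × (Fin k → ℂ)) × ℝ => f (border q.1.1 q.1.2 q.2) :=
        hfb.comp (by fun_prop : Measurable fun q : (SaMat k × (Fin k → ℂ)) × ℝ =>
          (q.1.1, q.1.2, q.2))
      exact this.lintegral_prod_right'
    have hg : Measurable fun b : SaMat k => ∫⁻ v : Fin k → ℂ, ∫⁻ t : ℝ, f (border b v t) :=
      hg1.lintegral_prod_right'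
    -- The partial integral is again unitarily invariant: substitute U v for v and use invariance of
    -- f under 1 ⊕ U.
    have hginv : ∀ U b, (∫⁻ v : Fin k → ℂ, ∫⁻ t : ℝ, f (border (SaMat.conj U b) v t)) =
        ∫⁻ v : Fin k → ℂ, ∫⁻ t : ℝ, f (border b v t) := by
      intro U b
      rw [← (measurePreserving_unitary_mulVec U).lintegral_comp
        (f := fun v => ∫⁻ t : ℝ, f (border (SaMat.conj U b) v t)) (hg1.comp measurable_prodMk_left)]
      simp only [border_conj, hinv]
    have hfd : Measurable fun x => f (SaMat.diag x) := hf.comp SaMat.continuous_diag.measurable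
    rw [lintegral_saMat_succ hf, ih hg hginv, setLIntegral_congr_fun
      (g := fun y : Fin k → ℝ => ENNReal.ofReal (Real.pi ^ k) * (ENNReal.ofReal (vdm y ^ 2) *
        ∫⁻ x in {x | Interlace y x}, ENNReal.ofReal (vdm x / vdm y) * f (SaMat.diag x)))
      (measurableSet_strictMono k) fun y hy => by
        rw [lintegral_border_diag hf hinv hy, mul_left_comm], lintegral_const_mul' _ _
        ENNReal.ofReal_ne_top, lintegral_interlace_swap hfd]
    have h1 : ∀ x : Fin (k + 1) → ℝ, ENNReal.ofReal (vdm x ^ 2 / k.factorial) * f (SaMat.diag x) =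
        ENNReal.ofReal (1 / k.factorial) * (ENNReal.ofReal (vdm x ^ 2) * f (SaMat.diag x)) :=
      fun x => by
        rw [← mul_assoc, ← ENNReal.ofReal_mul (by positivity)]
        congr 2
        ring
    simp only [h1]
    rw [lintegral_const_mul' _ _ ENNReal.ofReal_ne_top, weylConst_succ, ← mul_assoc, ← mul_assoc,
      ← mul_assoc]
    congr 1
    have hb : 0 ≤ borderConst k := div_nonneg (gaussConst_pos _).le
      (mul_nonneg (mul_nonneg (gaussConst_pos k).le (by positivity)) (Real.sqrt_nonneg _))
    have hw := (weylConst_pos k).le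
    rw [← ENNReal.ofReal_mul hb, ← ENNReal.ofReal_mul (mul_nonneg hb hw),
      ← ENNReal.ofReal_mul (mul_nonneg (mul_nonneg hb hw) (by positivity))]
    congr 1
    ring

/-! ### Asymptotics of the constant in the Weyl formula -/

theorem le_log_factorial {k : ℕ} (hk : 1 ≤ k) :
    (k : ℝ) * Real.log k - k ≤ Real.log k.factorial := by
  induction k, hk using Nat.le_induction with
  | base => simp
  | succ k hk ih =>
    have hk0 : (0 : ℝ) < k := by exact_mod_cast hk
    rw [Nat.factorial_succ, Nat.cast_mul,
      Real.log_mul (by positivity) (by positivity)]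
    push_cast
    have h1 : Real.log (((k : ℝ) + 1) / k) ≤ ((k : ℝ) + 1) / k - 1 :=
      Real.log_le_sub_one_of_pos (by positivity)
    rw [Real.log_div (by positivity) hk0.ne'] at h1
    have h2 := mul_le_mul_of_nonneg_left h1 hk0.le
    have h3 : (k : ℝ) * (((k : ℝ) + 1) / k - 1) = 1 := by field_simp; ring
    rw [h3] at h2
    linarith

theorem log_factorial_le (k : ℕ) :
    Real.log k.factorial ≤ ((k : ℝ) + 1) * Real.log (k + 1) - k := by
  induction k with
  | zero => simp
  | succ k ih =>
    rw [Nat.factorial_succ, Nat.cast_mul,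
      Real.log_mul (by positivity) (by positivity)]
    push_cast
    have h1 : Real.log (((k : ℝ) + 1) / (k + 1 + 1)) ≤ ((k : ℝ) + 1) / (k + 1 + 1) - 1 :=
      Real.log_le_sub_one_of_pos (by positivity)
    rw [Real.log_div (by positivity) (by positivity)] at h1
    have h2 := mul_le_mul_of_nonneg_left h1 (by positivity : (0 : ℝ) ≤ k + 1 + 1)
    have h3 : ((k : ℝ) + 1 + 1) * (((k : ℝ) + 1) / (k + 1 + 1) - 1) = -1 := by field_simp; ring
    rw [h3] at h2
    linarith

/-- The mean value theorem for a primitive of z log z - z. -/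
theorem log_superfactorial_step {k : ℕ} (hk : 1 ≤ k) :
    ∃ c : ℝ, k ≤ c ∧ c ≤ k + 1 ∧
    ((k : ℝ) + 1) ^ 2 * (Real.log (k + 1) / 2 - 3 / 4) - (k : ℝ) ^ 2 * (Real.log k / 2 - 3 / 4) =
      c * Real.log c - c := by
  have hk0 : (0 : ℝ) < k := by exact_mod_cast hk
  have hd : ∀ z : ℝ, 0 < z → HasDerivAt (fun z : ℝ => z ^ 2 * (Real.log z / 2 - 3 / 4))
      (z * Real.log z - z) z := by
    intro z hz
    refine ((hasDerivAt_pow 2 z).mul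
      (((Real.hasDerivAt_log hz.ne').div_const 2).sub_const (3 / 4))).congr_deriv ?_
    simp only [Nat.cast_ofNat]
    field_simp
    ring
  obtain ⟨c, hc, hc'⟩ := exists_hasDerivAt_eq_slope
    (fun z : ℝ => z ^ 2 * (Real.log z / 2 - 3 / 4)) (fun z => z * Real.log z - z)
    (lt_add_one (k : ℝ)) (fun z hz => (hd z (hk0.trans_le hz.1)).continuousAt.continuousWithinAt)
    fun z hz => hd z (hk0.trans hz.1)
  exact ⟨c, hc.1.le, hc.2.le, by rw [hc']; ring⟩

theorem mul_log_sub_mono {a b : ℝ} (ha : 1 ≤ a) (hab : a ≤ b) :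
    a * Real.log a - a ≤ b * Real.log b - b := by
  have ha0 : 0 < a := one_pos.trans_le ha
  have hb0 : 0 < b := ha0.trans_le hab
  have h1 : Real.log (a / b) ≤ a / b - 1 := Real.log_le_sub_one_of_pos (by positivity)
  rw [Real.log_div ha0.ne' hb0.ne'] at h1
  have h2 := mul_le_mul_of_nonneg_left h1 hb0.le
  have h3 : b * (a / b - 1) = a - b := by field_simp
  have h4 : 0 ≤ (b - a) * Real.log a := mul_nonneg (sub_nonneg.2 hab) (Real.log_nonneg ha)
  rw [h3] at h2
  linarith

/-- The increments of the two sequences at k lie in nearly the same interval around k log k - k, and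
the errors telescope to order k log k, which is negligible against k². -/
theorem abs_log_superfactorial_sub_le {k : ℕ} (hk : 1 ≤ k) :
    |(k : ℝ) ^ 2 * (Real.log k / 2 - 3 / 4) -
      ∑ j ∈ Finset.range k, Real.log j.factorial| ≤ k * Real.log k + k := by
  induction k, hk using Nat.le_induction with
  | base => norm_num [abs_of_neg]
  | succ k hk ih =>
    obtain ⟨c, h1, h2, h3⟩ := log_superfactorial_step hk
    have hk1 : (1 : ℝ) ≤ k := by exact_mod_cast hk
    have h4 := mul_log_sub_mono hk1 h1
    have h5 := mul_log_sub_mono (hk1.trans h1) h2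
    have h6 := le_log_factorial hk
    have h7 := log_factorial_le k
    rw [Finset.sum_range_succ]
    push_cast
    rw [abs_le] at ih ⊢
    constructor <;> linarith [ih.1, ih.2]

/-- The normalized logarithm of the constant in the Weyl formula. -/
def weylRate (k : ℕ) : ℝ := Real.log (weylConst k) / (k : ℝ) ^ 2 + Real.log k

theorem tendsto_log_nat_div : Tendsto (fun k : ℕ => Real.log k / (k : ℝ)) atTop (𝓝 0) :=
  (Real.isLittleO_log_id_atTop.tendsto_div_nhds_zero).comp tendsto_natCast_atTop_atTop

theorem weylRate_eq {k : ℕ} (hk : 1 ≤ k) : weylRate k = Real.log Real.pi / 2 +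
    ((k : ℝ) - 1) / (2 * k) * Real.log 2 - Real.log Real.pi / (2 * k) +
    ((k : ℝ) ^ 2 * (Real.log k / 2 - 3 / 4) -
      ∑ j ∈ Finset.range k, Real.log j.factorial) / (k : ℝ) ^ 2 + 3 / 4 := by
  have hk0 : (0 : ℝ) < k := by exact_mod_cast hk
  have h1 : Real.log (gaussConst k) = (k : ℝ) ^ 2 / 2 * (Real.log Real.pi - Real.log k) := by
    rw [gaussConst, Real.log_rpow (by positivity), Real.log_div Real.pi_pos.ne' hk0.ne']
  have h2 : Real.log (∏ j ∈ Finset.range k, ((2 : ℝ) ^ j / (j.factorial * Real.sqrt Real.pi))) =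
      (k : ℝ) * (k - 1) / 2 * Real.log 2 - ∑ j ∈ Finset.range k, Real.log j.factorial -
        k * (Real.log Real.pi / 2) := by
    rw [Real.log_prod fun j _ => by positivity]
    have h3 : ∀ j ∈ Finset.range k, Real.log ((2 : ℝ) ^ j / (j.factorial * Real.sqrt Real.pi)) =
        j * Real.log 2 - Real.log j.factorial - Real.log Real.pi / 2 := fun j _ => by
      rw [Real.log_div (by positivity) (by positivity), Real.log_mul (by positivity)
        (by positivity), Real.log_pow, Real.log_sqrt Real.pi_pos.le]
      ring
    rw [Finset.sum_congr rfl h3, Finset.sum_sub_distrib, Finset.sum_sub_distrib,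
      ← Finset.sum_mul, Finset.sum_const, Finset.card_range, nsmul_eq_mul]
    have h4 : ∑ j ∈ Finset.range k, (j : ℝ) = (k : ℝ) * (k - 1) / 2 := by
      clear h1 h3 hk hk0
      induction k with
      | zero => simp
      | succ k ih =>
        rw [Finset.sum_range_succ, ih]
        push_cast
        ring
    rw [h4]
  rw [weylRate, weylConst, Real.log_mul (gaussConst_pos k).ne'
    (Finset.prod_pos fun j _ => by positivity).ne', h1, h2]
  field_simp
  ring

/-- The terms of order log k cancel. Only convergence matters: the limit drops out when two matrix
sizes are compared. -/
theorem exists_tendsto_weylRate : ∃ L : ℝ, Tendsto weylRate atTop (𝓝 L) := by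
  refine ⟨Real.log Real.pi / 2 + 1 / 2 * Real.log 2 - 0 + 0 + 3 / 4, ?_⟩
  have hinv : Tendsto (fun k : ℕ => (k : ℝ)⁻¹) atTop (𝓝 0) := tendsto_inv_atTop_nhds_zero_nat
  have h0 : Tendsto (fun k : ℕ => Real.log Real.pi / 2 +
      ((1 - (k : ℝ)⁻¹) / 2) * Real.log 2 - Real.log Real.pi / 2 * (k : ℝ)⁻¹ +
      ((k : ℝ) ^ 2 * (Real.log k / 2 - 3 / 4) -
      ∑ j ∈ Finset.range k, Real.log j.factorial) / (k : ℝ) ^ 2 + 3 / 4) atTop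
      (𝓝 (Real.log Real.pi / 2 + 1 / 2 * Real.log 2 - 0 + 0 + 3 / 4)) := by
    refine Tendsto.add_const _ (Tendsto.add (Tendsto.sub (Tendsto.const_add _
      (Tendsto.mul_const _ ?_)) ?_) ?_)
    · simpa using (hinv.const_sub 1).div_const 2
    · simpa using hinv.const_mul (Real.log Real.pi / 2)
    · have h1 : Tendsto (fun k : ℕ => Real.log k / (k : ℝ) + (k : ℝ)⁻¹) atTop (𝓝 0) := by
        simpa using tendsto_log_nat_div.add hinv
      refine squeeze_zero_norm' ?_ h1
      filter_upwards [eventually_ge_atTop 1] with k hk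
      have hk0 : (0 : ℝ) < k := by exact_mod_cast hk
      rw [Real.norm_eq_abs, abs_div, abs_of_pos (pow_pos hk0 2), div_le_iff₀ (pow_pos hk0 2)]
      refine (abs_log_superfactorial_sub_le hk).trans_eq ?_
      field_simp
  refine h0.congr' ?_
  filter_upwards [eventually_ge_atTop 1] with k hk
  have hk0 : (0 : ℝ) < k := by exact_mod_cast hk
  have e1 : (1 - (k : ℝ)⁻¹) / 2 = ((k : ℝ) - 1) / (2 * k) := by field_simp
  have e2 : Real.log Real.pi / 2 * (k : ℝ)⁻¹ = Real.log Real.pi / (2 * k) := by field_simp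
  rw [weylRate_eq hk, e1, e2]

/-! ### Normalized logarithmic volumes -/

/-- The quantity `k⁻² log vol(S) + n log k`. -/
def normLogVol {n k : ℕ} (S : Set (Fin n → SaMat k)) : EReal :=
  ((((k : ℝ) ^ 2)⁻¹ : ℝ) : EReal) * ENNReal.log (vol n k S) + ((n * Real.log k : ℝ) : EReal)

theorem mul_log_le_mul_log {c : ℝ} (hc : 0 ≤ c) {u v : ℝ≥0∞} (h : u ≤ v) :
    (c : EReal) * ENNReal.log u ≤ (c : EReal) * ENNReal.log v :=
  mul_le_mul_of_nonneg_left (ENNReal.log_le_log h) (EReal.coe_nonneg.2 hc)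

theorem normLogVol_mono {n k : ℕ} {S T : Set (Fin n → SaMat k)} (h : vol n k S ≤ vol n k T) :
    normLogVol S ≤ normLogVol T :=
  add_le_add_left (mul_log_le_mul_log (by positivity) h) _

theorem normLogVol_ofReal {n k : ℕ} {V : ℝ} (hV : 0 < V) :
    ((((k : ℝ) ^ 2)⁻¹ : ℝ) : EReal) * ENNReal.log (ENNReal.ofReal V) +
      ((n * Real.log k : ℝ) : EReal) =
    ((Real.log V / (k : ℝ) ^ 2 + n * Real.log k : ℝ) : EReal) := by
  rw [ENNReal.log_ofReal_of_pos hV, ← EReal.coe_mul, ← EReal.coe_add]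
  congr 1
  ring

theorem normLogVol_le_of_le {n k : ℕ} {S : Set (Fin n → SaMat k)} {V : ℝ} (hV : 0 < V)
    (h : vol n k S ≤ ENNReal.ofReal V) :
    normLogVol S ≤ ((Real.log V / (k : ℝ) ^ 2 + n * Real.log k : ℝ) : EReal) := by
  rw [← normLogVol_ofReal hV]
  exact add_le_add_left (mul_log_le_mul_log (by positivity) h) _

theorem le_normLogVol_of_le {n k : ℕ} {S : Set (Fin n → SaMat k)} {V : ℝ} (hV : 0 < V)
    (h : ENNReal.ofReal V ≤ vol n k S) :
    ((Real.log V / (k : ℝ) ^ 2 + n * Real.log k : ℝ) : EReal) ≤ normLogVol S := by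
  rw [← normLogVol_ofReal hV]
  exact add_le_add_left (mul_log_le_mul_log (by positivity) h) _

/-! ### Microstates of one element in terms of eigenvalues -/

/-- Real sequences of length `k` whose moments of order `1 ≤ p ≤ m` are within `γ` of `α p`. -/
def momentSet (α : ℕ → ℝ) (m k : ℕ) (γ : ℝ) : Set (Fin k → ℝ) :=
  {x | ∀ p : ℕ, 1 ≤ p → p ≤ m → |(∑ i, x i ^ p) / k - α p| < γ}

/-- The logarithmic energy `∑ log |x i - x j|`, with `log 0 = 0` on the diagonal. -/
def logEnergy {k : ℕ} (x : Fin k → ℝ) : ℝ := ∑ i, ∑ j, Real.log |x i - x j|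

theorem log_vdm_sq {k : ℕ} {x : Fin k → ℝ} (hx : StrictMono x) :
    Real.log (vdm x ^ 2) = logEnergy x := by
  have h1 : logEnergy x = ∑ i, ∑ j ∈ {i}ᶜ, Real.log |x j - x i| := by
    refine Finset.sum_congr rfl fun i _ => ?_
    rw [← Finset.add_sum_erase Finset.univ _ (Finset.mem_univ i), sub_self, abs_zero,
      Real.log_zero, zero_add, ← Finset.compl_singleton]
    exact Finset.sum_congr rfl fun j _ => by rw [abs_sub_comm]
  rw [h1, ← Finset.sum_sum_Ioi_add_eq_sum_sum_off_diag fun j i => Real.log |x j - x i|,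
    Real.log_pow, vdm_eq_prod, Real.log_prod fun i _ => Finset.prod_ne_zero_iff.2 fun j hj =>
      (sub_pos.2 (hx (Finset.mem_Ioi.1 hj))).ne', Finset.mul_sum]
  refine Finset.sum_congr rfl fun i _ => ?_
  rw [Real.log_prod fun j hj => (sub_pos.2 (hx (Finset.mem_Ioi.1 hj))).ne', Finset.mul_sum]
  refine Finset.sum_congr rfl fun j _ => ?_
  rw [abs_sub_comm (x i), Real.log_abs]
  push_cast
  ring

section

variable {M : Type*} [CStarAlgebra M] {φ : M →ₗ[ℂ] ℂ} {a : M} {α : ℕ → ℝ}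

theorem single_diag_mem_microstates_iff (hα : ∀ p, φ (a ^ p) = α p) {m k : ℕ} {γ : ℝ}
    (x : Fin k → ℝ) : ![SaMat.diag x] ∈ microstates φ ![a] m k γ ↔ x ∈ momentSet α m k γ := by
  rw [mem_microstates_single_iff]
  refine forall_congr' fun p => forall_congr' fun _ => forall_congr' fun _ => ?_
  rw [SaMat.diag_pow, hα, ← Complex.ofReal_sub, Complex.norm_real, Real.norm_eq_abs]

theorem single_conj_mem_microstates_iff {m k : ℕ} {γ : ℝ} (U : unitaryGroup (Fin k) ℂ)
    (b : SaMat k) : ![SaMat.conj U b] ∈ microstates φ ![a] m k γ ↔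
      ![b] ∈ microstates φ ![a] m k γ := by
  rw [← conj_mem_microstates_iff U (A := ![b])]
  have : ![SaMat.conj U b] = fun i => SaMat.conj U (![b] i) := by
    funext i
    rw [Subsingleton.elim i 0]
    rfl
  rw [this]

theorem measurableSet_momentSet (α : ℕ → ℝ) (m k : ℕ) (γ : ℝ) :
    MeasurableSet (momentSet α m k γ) := by
  have : momentSet α m k γ = ⋂ p : ℕ, ⋂ _ : 1 ≤ p, ⋂ _ : p ≤ m,
      {x | |(∑ i, x i ^ p) / k - α p| < γ} := by
    ext x; simp [momentSet]
  rw [this]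
  refine MeasurableSet.iInter fun p => MeasurableSet.iInter fun _ => MeasurableSet.iInter fun _ =>
    (isOpen_lt ?_ continuous_const).measurableSet
  fun_prop

theorem vol_one_eq {k : ℕ} (S : Set (Fin 1 → SaMat k)) :
    vol 1 k S = volume {b : SaMat k | ![b] ∈ S} := by
  have e := volume_preserving_funUnique (Fin 1) (SaMat k)
  rw [← e.measure_preimage_equiv]
  congr 1
  ext A
  have : ![A 0] = A := by
    funext i
    rw [Subsingleton.elim i 0]
    rfl
  change _ ↔ ![A 0] ∈ S
  rw [this]

theorem vol_one_microstates (hα : ∀ p, φ (a ^ p) = α p) (m k : ℕ) (γ : ℝ) :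
    vol 1 k (microstates φ ![a] m k γ) = ENNReal.ofReal (weylConst k) *
      ∫⁻ x in {x | StrictMono x} ∩ momentSet α m k γ, ENNReal.ofReal (vdm x ^ 2) := by
  set T : Set (SaMat k) := {b | ![b] ∈ microstates φ ![a] m k γ} with hT
  have hTm : MeasurableSet T := by
    have hc : Continuous fun b : SaMat k => ![b] :=
      continuous_pi fun i => by rw [Subsingleton.elim i 0]; exact continuous_id
    exact (isOpen_microstates.preimage hc).measurableSet
  have hf : Measurable (T.indicator (1 : SaMat k → ℝ≥0∞)) := measurable_one.indicator hTm
  rw [vol_one_eq, ← lintegral_indicator_one hTm, lintegral_eq_weyl k hf fun U b => ?_]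
  · congr 1
    rw [Set.inter_comm, ← setLIntegral_indicator (measurableSet_momentSet α m k γ)]
    refine lintegral_congr fun x => ?_
    by_cases hx : x ∈ momentSet α m k γ
    · have : SaMat.diag x ∈ T := (single_diag_mem_microstates_iff hα x).2 hx
      simp [Set.indicator, hx, this]
    · have : SaMat.diag x ∉ T := fun h => hx ((single_diag_mem_microstates_iff hα x).1 h)
      simp [Set.indicator, hx, this]
  · have : SaMat.conj U b ∈ T ↔ b ∈ T := single_conj_mem_microstates_iff U b
    by_cases hb : b ∈ T
    · simp [Set.indicator, hb, this.2 hb]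
    · simp [Set.indicator, hb, mt this.1 hb]

/-- If every admissible list had smaller energy, the Weyl integrand would be small on its whole
domain. The second moment confines that domain to a cube of side 2ρ, and the volume would be too
small. -/
theorem exists_logEnergy_ge (hα : ∀ p, φ (a ^ p) = α p) {m k : ℕ} {γ : ℝ} (hk : 1 ≤ k)
    (hm : 2 ≤ m) (hγ : 0 < γ) {r : ℝ} (hr : (r : EReal) < normLogVol (microstates φ ![a] m k γ)) :
    ∃ x ∈ momentSet α m k γ, StrictMono x ∧ r ≤ logEnergy x / (k : ℝ) ^ 2 + weylRate k +
      Real.log (2 * Real.sqrt (k * (|α 2| + γ))) / k := by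
  by_contra! hcon
  have hk0 : (0 : ℝ) < k := by exact_mod_cast hk
  have hA : 0 < |α 2| + γ := by positivity
  set ρ := Real.sqrt (k * (|α 2| + γ)) with hρ
  have hρ0 : 0 < ρ := Real.sqrt_pos.2 (by positivity)
  set c := (k : ℝ) ^ 2 * (r - weylRate k) - k * Real.log (2 * ρ) with hc
  have h1 : ∀ x ∈ {x : Fin k → ℝ | StrictMono x} ∩ momentSet α m k γ,
      ENNReal.ofReal (vdm x ^ 2) ≤ ENNReal.ofReal (Real.exp c) := by
    rintro x ⟨hx, hx'⟩
    refine ENNReal.ofReal_le_ofReal ?_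
    rw [← Real.log_le_iff_le_exp (pow_pos (vdm_pos hx) 2), log_vdm_sq hx]
    have h2 := hcon x hx' hx
    rw [← sub_pos] at h2
    have h3 := mul_pos (pow_pos hk0 2) h2
    have h4 : (k : ℝ) ^ 2 * (r - (logEnergy x / (k : ℝ) ^ 2 + weylRate k +
        Real.log (2 * ρ) / k)) = c - logEnergy x := by
      rw [hc]; field_simp; ring
    rw [h4] at h3
    linarith
  have h2 : {x : Fin k → ℝ | StrictMono x} ∩ momentSet α m k γ ⊆
      Set.univ.pi fun _ => Set.Icc (-ρ) ρ := by
    rintro x ⟨_, hx'⟩ i _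
    have h3 := (abs_lt.1 (hx' 2 one_le_two hm)).2
    have h4 : (∑ i, x i ^ 2) / k ≤ |α 2| + γ := by linarith [le_abs_self (α 2)]
    rw [div_le_iff₀ hk0] at h4
    have h5 : x i ^ 2 ≤ ∑ i, x i ^ 2 :=
      Finset.single_le_sum (f := fun i => x i ^ 2) (fun i _ => sq_nonneg _) (Finset.mem_univ i)
    exact abs_le.1 (Real.abs_le_sqrt (by linarith [mul_comm (k : ℝ) (|α 2| + γ)]))
  have h3 : ∫⁻ x in {x | StrictMono x} ∩ momentSet α m k γ, ENNReal.ofReal (vdm x ^ 2) ≤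
      ENNReal.ofReal (Real.exp c) * ENNReal.ofReal ((2 * ρ) ^ k) := by
    refine (setLIntegral_mono' ((measurableSet_strictMono k).inter
      (measurableSet_momentSet α m k γ)) h1).trans ?_
    rw [setLIntegral_const]
    refine mul_le_mul_right ((measure_mono h2).trans ?_) _
    rw [volume_pi, Measure.pi_pi]
    simp only [Real.volume_Icc, Finset.prod_const, Finset.card_univ, Fintype.card_fin]
    rw [← ENNReal.ofReal_pow (by linarith)]
    exact le_of_eq (by congr 2; ring)
  have h4 : vol 1 k (microstates φ ![a] m k γ) ≤
      ENNReal.ofReal (weylConst k * (Real.exp c * (2 * ρ) ^ k)) := by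
    rw [vol_one_microstates hα, ENNReal.ofReal_mul (weylConst_pos k).le,
      ENNReal.ofReal_mul (Real.exp_pos _).le]
    exact mul_le_mul_right h3 _
  have h5 := hr.trans_le (normLogVol_le_of_le (by have := weylConst_pos k; positivity) h4)
  rw [EReal.coe_lt_coe_iff, Real.log_mul (weylConst_pos k).ne' (by positivity),
    Real.log_mul (Real.exp_pos _).ne' (by positivity), Real.log_exp, Real.log_pow, hc,
    weylRate] at h5
  have h6 : (Real.log (weylConst k) + ((k : ℝ) ^ 2 * (r - (Real.log (weylConst k) / (k : ℝ) ^ 2 +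
      Real.log k)) - k * Real.log (2 * ρ) + k * Real.log (2 * ρ))) / (k : ℝ) ^ 2 +
      (1 : ℕ) * Real.log k = r := by
    push_cast
    field_simp
    ring
  rw [h6] at h5
  exact lt_irrefl _ h5

/-- The Weyl integral is restricted to a box of side δ, on which the squared Vandermonde product is
at least exp e. -/
theorem le_normLogVol_single (hα : ∀ p, φ (a ^ p) = α p) {m k : ℕ} {γ : ℝ} (hk : 1 ≤ k)
    {u : Fin k → ℝ} {δ e : ℝ} (hδ : 0 < δ)
    (hbox : ∀ x : Fin k → ℝ, (∀ i, u i ≤ x i ∧ x i ≤ u i + δ) →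
      StrictMono x ∧ x ∈ momentSet α m k γ ∧ e ≤ logEnergy x) :
    ((e / (k : ℝ) ^ 2 + weylRate k + Real.log δ / k : ℝ) : EReal) ≤
      normLogVol (microstates φ ![a] m k γ) := by
  have hk0 : (0 : ℝ) < k := by exact_mod_cast hk
  have h1 : ENNReal.ofReal (weylConst k * (Real.exp e * δ ^ k)) ≤
      vol 1 k (microstates φ ![a] m k γ) := by
    rw [vol_one_microstates hα, ENNReal.ofReal_mul (weylConst_pos k).le]
    refine mul_le_mul_right ?_ _
    have h2 : (Set.univ.pi fun i => Set.Icc (u i) (u i + δ)) ⊆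
        {x : Fin k → ℝ | StrictMono x} ∩ momentSet α m k γ := fun x hx =>
      ⟨(hbox x fun i => hx i trivial).1, (hbox x fun i => hx i trivial).2.1⟩
    refine le_trans ?_ (lintegral_mono_set h2)
    have h3 : ∀ x ∈ Set.univ.pi fun i => Set.Icc (u i) (u i + δ),
        ENNReal.ofReal (Real.exp e) ≤ ENNReal.ofReal (vdm x ^ 2) := fun x hx => by
      obtain ⟨hx1, _, hx2⟩ := hbox x fun i => hx i trivial
      refine ENNReal.ofReal_le_ofReal ?_
      rwa [← Real.le_log_iff_exp_le (pow_pos (vdm_pos hx1) 2), log_vdm_sq hx1]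
    refine le_trans ?_ (setLIntegral_mono' (MeasurableSet.univ_pi fun i => measurableSet_Icc) h3)
    rw [setLIntegral_const, volume_pi, Measure.pi_pi, ENNReal.ofReal_mul (Real.exp_pos _).le]
    simp [ENNReal.ofReal_pow hδ.le]
  refine le_trans (le_of_eq ?_)
    (le_normLogVol_of_le (by have := weylConst_pos k; positivity) h1)
  rw [Real.log_mul (weylConst_pos k).ne' (by positivity),
    Real.log_mul (Real.exp_pos _).ne' (by positivity), Real.log_exp, Real.log_pow, weylRate]
  congr 1
  push_cast
  field_simp
  ring

end

/-! ### Refining a finite sequence -/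

/-- The block length used to spread `k` indices over `n` blocks. -/
def blockLen (n k : ℕ) : ℕ := (k + n - 1) / n

theorem le_mul_blockLen {n : ℕ} (hn : 0 < n) (k : ℕ) : k ≤ n * blockLen n k := by
  have h := Nat.div_add_mod (k + n - 1) n
  have h2 := Nat.mod_lt (k + n - 1) hn
  unfold blockLen
  omega

theorem mul_blockLen_le {n : ℕ} (hn : 0 < n) (k : ℕ) : n * blockLen n k ≤ k + n := by
  have h := Nat.mul_div_le (k + n - 1) n
  unfold blockLen
  omega

theorem blockLen_pos {n k : ℕ} (hn : 0 < n) (hk : 0 < k) : 0 < blockLen n k :=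
  Nat.pos_of_ne_zero fun h => by have := le_mul_blockLen hn k; rw [h] at this; omega

/-- The block containing a given index. -/
def blockMap {n k : ℕ} (hn : 0 < n) (i : Fin k) : Fin n :=
  ⟨i / blockLen n k, by
    rw [Nat.div_lt_iff_lt_mul (blockLen_pos hn i.pos)]
    exact i.2.trans_le (le_mul_blockLen hn k)⟩

section

variable {n k : ℕ} (hn : 0 < n)

theorem monotone_blockMap : Monotone (blockMap hn : Fin k → Fin n) := fun _ _ h =>
  Nat.div_le_div_right h

theorem lt_add_blockLen {i j : Fin k} (h : blockMap hn i = blockMap hn j) :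
    (j : ℕ) < i + blockLen n k := by
  have h1 : (i : ℕ) / blockLen n k = j / blockLen n k := congrArg Fin.val h
  have h2 := Nat.div_add_mod (i : ℕ) (blockLen n k)
  have h3 := Nat.div_add_mod (j : ℕ) (blockLen n k)
  have h4 := Nat.mod_lt (j : ℕ) (blockLen_pos hn i.pos)
  rw [h1] at h2
  omega

/-- The number of indices in a block. -/
def blockCard (k : ℕ) (A : Fin n) : ℕ := (Finset.univ.filter fun i : Fin k => blockMap hn i = A).card

theorem blockCard_le (A : Fin n) : blockCard hn k A ≤ blockLen n k := by
  rw [blockCard, ← Finset.card_range (blockLen n k)]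
  refine Finset.card_le_card_of_injOn (fun i => (i : ℕ) % blockLen n k) (fun i _ => ?_) ?_
  · simpa using Nat.mod_lt _ (blockLen_pos hn i.pos)
  · intro i hi j hj hij
    have h1 : (i : ℕ) / blockLen n k = j / blockLen n k := congrArg Fin.val
      ((Finset.mem_filter.1 hi).2.trans (Finset.mem_filter.1 hj).2.symm)
    have h2 := Nat.div_add_mod (i : ℕ) (blockLen n k)
    have h3 := Nat.div_add_mod (j : ℕ) (blockLen n k)
    have h4 : (i : ℕ) % blockLen n k = j % blockLen n k := hij
    rw [h1, h4] at h2
    exact Fin.ext (h2.symm.trans h3)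

theorem sum_blockMap (f : Fin n → ℝ) :
    ∑ i : Fin k, f (blockMap hn i) = ∑ A, blockCard hn k A * f A := by
  rw [← Finset.sum_fiberwise Finset.univ (blockMap hn : Fin k → Fin n)]
  refine Finset.sum_congr rfl fun A _ => ?_
  rw [Finset.sum_congr rfl (g := fun _ => f A) fun i hi => by rw [(Finset.mem_filter.1 hi).2],
    Finset.sum_const, nsmul_eq_mul, blockCard]

theorem sum_blockCard : ∑ A, (blockCard hn k A : ℝ) = k := by
  have := sum_blockMap (k := k) hn fun _ => 1
  simpa using this.symm

theorem tendsto_blockLen_div {n : ℕ} (hn : 0 < n) : Tendsto (fun k : ℕ => (blockLen n k : ℝ) / k) atTop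
    (𝓝 (1 / n)) := by
  have hn0 : (0 : ℝ) < n := by exact_mod_cast hn
  have h1 : Tendsto (fun k : ℕ => 1 / (n : ℝ) + (k : ℝ)⁻¹) atTop (𝓝 (1 / n)) := by
    simpa using tendsto_inv_atTop_nhds_zero_nat.const_add (1 / (n : ℝ))
  refine tendsto_of_tendsto_of_tendsto_of_le_of_le' tendsto_const_nhds h1 ?_ ?_
  · filter_upwards [eventually_ge_atTop 1] with k hk
    have hk0 : (0 : ℝ) < k := by exact_mod_cast hk
    rw [div_le_div_iff₀ hn0 hk0]
    have := le_mul_blockLen hn k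
    have h2 : (k : ℝ) ≤ n * blockLen n k := by exact_mod_cast this
    linarith
  · filter_upwards [eventually_ge_atTop 1] with k hk
    have hk0 : (0 : ℝ) < k := by exact_mod_cast hk
    have := mul_blockLen_le hn k
    have h2 : (n : ℝ) * blockLen n k ≤ k + n := by exact_mod_cast this
    rw [div_le_iff₀ hk0, add_mul, inv_mul_cancel₀ hk0.ne', one_div, ← sub_nonneg]
    have h3 := div_nonneg (sub_nonneg.2 h2) hn0.le
    have h4 : ((k : ℝ) + n - n * blockLen n k) / n = (n : ℝ)⁻¹ * k + 1 - blockLen n k := by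
      field_simp
    rwa [h4] at h3

/-- No block exceeds the block length, so a given block retains at least what the other n - 1 cannot
hold; both bounds are asymptotic to k / n. -/
theorem tendsto_blockCard_div (A : Fin n) :
    Tendsto (fun k : ℕ => (blockCard hn k A : ℝ) / k) atTop (𝓝 (1 / n)) := by
  have hn0 : (0 : ℝ) < n := by exact_mod_cast hn
  have hq := tendsto_blockLen_div hn
  have h1 : Tendsto (fun k : ℕ => 1 - ((n : ℝ) - 1) * ((blockLen n k : ℝ) / k)) atTop
      (𝓝 (1 / n)) := by
    have := (hq.const_mul ((n : ℝ) - 1)).const_sub 1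
    have h2 : 1 - ((n : ℝ) - 1) * (1 / n) = 1 / n := by field_simp; ring
    rwa [h2] at this
  refine tendsto_of_tendsto_of_tendsto_of_le_of_le' h1 hq ?_ ?_
  · filter_upwards [eventually_ge_atTop 1] with k hk
    have hk0 : (0 : ℝ) < k := by exact_mod_cast hk
    have h3 := sum_blockCard (k := k) hn
    rw [← Finset.add_sum_erase Finset.univ _ (Finset.mem_univ A)] at h3
    have h4 : ∑ B ∈ Finset.univ.erase A, (blockCard hn k B : ℝ) ≤
        ∑ B ∈ Finset.univ.erase A, (blockLen n k : ℝ) :=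
      Finset.sum_le_sum fun B _ => Nat.cast_le.2 (blockCard_le hn B)
    rw [Finset.sum_const, Finset.card_erase_of_mem (Finset.mem_univ A), Finset.card_univ,
      Fintype.card_fin, nsmul_eq_mul, Nat.cast_sub hn, Nat.cast_one] at h4
    rw [le_div_iff₀ hk0, sub_mul, mul_assoc, div_mul_cancel₀ _ hk0.ne']
    linarith
  · filter_upwards with k
    exact div_le_div_of_nonneg_right (Nat.cast_le.2 (blockCard_le hn A)) (Nat.cast_nonneg _)

/-! ### Inverse square roots summed over a block -/

theorem sum_one_div_sqrt_le (N : ℕ) :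
    ∑ d ∈ Finset.range N, 1 / Real.sqrt (d + 1) ≤ 2 * Real.sqrt N := by
  induction N with
  | zero => simp
  | succ N ih =>
    rw [Finset.sum_range_succ]
    push_cast
    have h1 : Real.sqrt N ≤ Real.sqrt (N + 1) := Real.sqrt_le_sqrt (by linarith)
    have h2 : 0 < Real.sqrt ((N : ℝ) + 1) := Real.sqrt_pos.2 (by positivity)
    have h3 : Real.sqrt ((N : ℝ) + 1) ^ 2 = N + 1 := Real.sq_sqrt (by positivity)
    have h4 : Real.sqrt (N : ℝ) ^ 2 = N := Real.sq_sqrt (by positivity)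
    have h5 : 1 / Real.sqrt ((N : ℝ) + 1) ≤ 2 * Real.sqrt (N + 1) - 2 * Real.sqrt N := by
      rw [div_le_iff₀ h2]
      nlinarith [sq_nonneg (Real.sqrt ((N : ℝ) + 1) - Real.sqrt N)]
    linarith

theorem sum_le_sum_range_of_injOn {ι : Type*} {s : Finset ι} {N : ℕ} {f : ℕ → ℝ}
    (hf : ∀ d, 0 ≤ f d) (g : ι → ℕ) (hg : Set.InjOn g s) (hN : ∀ i ∈ s, g i < N) :
    ∑ i ∈ s, f (g i) ≤ ∑ d ∈ Finset.range N, f d := by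
  rw [← Finset.sum_image hg (f := f)]
  refine Finset.sum_le_sum_of_subset_of_nonneg (fun d hd => ?_) fun d _ _ => hf d
  obtain ⟨i, hi, rfl⟩ := Finset.mem_image.1 hd
  exact Finset.mem_range.2 (hN i hi)

/-- On either side of i the distances within the block are distinct positive integers not exceeding
the block length, so each side contributes at most 2√N. -/
theorem sum_block_one_div_sqrt_le (i : Fin k) :
    ∑ j ∈ Finset.univ.filter (fun j : Fin k => blockMap hn j = blockMap hn i),
      1 / Real.sqrt |(i : ℝ) - j| ≤ 4 * Real.sqrt (blockLen n k) := by
  set s := Finset.univ.filter fun j : Fin k => blockMap hn j = blockMap hn i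
  have hf : ∀ d : ℕ, 0 ≤ 1 / Real.sqrt ((d : ℝ) + 1) := fun d => by positivity
  have h1 : ∑ j ∈ s.filter (fun j => i < j), 1 / Real.sqrt |(i : ℝ) - j| ≤
      2 * Real.sqrt (blockLen n k) := by
    refine le_trans (le_of_eq (Finset.sum_congr rfl fun j hj => ?_))
      ((sum_le_sum_range_of_injOn hf (fun j : Fin k => (j : ℕ) - i - 1) (fun j hj l hl h => ?_)
      fun j hj => ?_).trans (sum_one_div_sqrt_le _))
    · have hij : (i : ℕ) < j := (Finset.mem_filter.1 hj).2
      congr 2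
      rw [abs_sub_comm, abs_of_pos (sub_pos.2 (by exact_mod_cast hij)), Nat.sub_sub,
        Nat.cast_sub hij]
      push_cast
      ring
    · have hij : (i : ℕ) < j := (Finset.mem_filter.1 hj).2
      have hil : (i : ℕ) < l := (Finset.mem_filter.1 hl).2
      have h' : (j : ℕ) - i - 1 = l - i - 1 := h
      exact Fin.ext (by omega)
    · have hij : (i : ℕ) < j := (Finset.mem_filter.1 hj).2
      have := lt_add_blockLen hn
        (Finset.mem_filter.1 (Finset.mem_filter.1 hj).1).2.symm
      omega
  have h2 : ∑ j ∈ s.filter (fun j => ¬ i < j), 1 / Real.sqrt |(i : ℝ) - j| ≤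
      2 * Real.sqrt (blockLen n k) := by
    have h3 : ∑ j ∈ s.filter (fun j => ¬ i < j), 1 / Real.sqrt |(i : ℝ) - j| =
        ∑ j ∈ s.filter (fun j => j < i), 1 / Real.sqrt |(i : ℝ) - j| := by
      symm
      refine Finset.sum_subset (fun j hj => ?_) fun j hj hj' => ?_
      · rw [Finset.mem_filter] at hj ⊢
        exact ⟨hj.1, hj.2.not_gt⟩
      · rw [Finset.mem_filter] at hj hj'
        -- The diagonal term is 1 / √0 = 0.
        have : j = i := le_antisymm (not_lt.1 hj.2) (not_lt.1 fun h => hj' ⟨hj.1, h⟩)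
        simp [this]
    rw [h3]
    refine le_trans (le_of_eq (Finset.sum_congr rfl fun j hj => ?_))
      ((sum_le_sum_range_of_injOn hf (fun j : Fin k => (i : ℕ) - j - 1) (fun j hj l hl h => ?_)
      fun j hj => ?_).trans (sum_one_div_sqrt_le _))
    · have hij : (j : ℕ) < i := (Finset.mem_filter.1 hj).2
      congr 2
      rw [abs_of_pos (sub_pos.2 (by exact_mod_cast hij)), Nat.sub_sub, Nat.cast_sub hij]
      push_cast
      ring
    · have hij : (j : ℕ) < i := (Finset.mem_filter.1 hj).2
      have hil : (l : ℕ) < i := (Finset.mem_filter.1 hl).2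
      have h' : (i : ℕ) - j - 1 = i - l - 1 := h
      exact Fin.ext (by omega)
    · have hij : (j : ℕ) < i := (Finset.mem_filter.1 hj).2
      have := lt_add_blockLen hn (Finset.mem_filter.1 (Finset.mem_filter.1 hj).1).2
      omega
  rw [← Finset.sum_filter_add_sum_filter_not s fun j => i < j]
  linarith

/-! #### The energy of a refined sequence -/

section

variable {y : Fin n → ℝ} {δ : ℝ} {x : Fin k → ℝ}

/-- The drift δ(j - i)/k beats the slack δ/(2k) of the box by at least half, because j - i ≥ 1. -/
theorem refine_sub_ge (hδ : 0 < δ)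
    (hx : ∀ i, y (blockMap hn i) + δ * (i / k) ≤ x i ∧
      x i ≤ y (blockMap hn i) + δ * (i / k) + δ / (2 * k)) {i j : Fin k} (hij : i < j) :
    y (blockMap hn j) - y (blockMap hn i) + δ * (((j : ℝ) - i) / (2 * k)) ≤ x j - x i := by
  have hk : (0 : ℝ) < k := by exact_mod_cast i.pos
  have h1 : (1 : ℝ) ≤ (j : ℝ) - i := by
    have : (i : ℕ) + 1 ≤ j := hij
    have : ((i : ℝ) + 1) ≤ j := by exact_mod_cast this
    linarith
  have h2 : δ * (((j : ℝ) - i) / (2 * k)) ≤ δ * (j / k) - δ * (i / k) - δ / (2 * k) := by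
    have h3 : δ * (j / k) - δ * (i / k) - δ / (2 * k) - δ * (((j : ℝ) - i) / (2 * k)) =
        δ * (((j : ℝ) - i - 1) / (2 * k)) := by field_simp; ring
    have h4 : 0 ≤ δ * (((j : ℝ) - i - 1) / (2 * k)) :=
      mul_nonneg hδ.le (div_nonneg (by linarith) (by positivity))
    linarith
  have := (hx i).2
  have := (hx j).1
  linarith

theorem refine_strictMono (hy : StrictMono y) (hδ : 0 < δ)
    (hx : ∀ i, y (blockMap hn i) + δ * (i / k) ≤ x i ∧
      x i ≤ y (blockMap hn i) + δ * (i / k) + δ / (2 * k)) : StrictMono x := by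
  intro i j hij
  have hk : (0 : ℝ) < k := by exact_mod_cast i.pos
  have h1 := refine_sub_ge hn hδ hx hij
  have h2 : (0 : ℝ) < (j : ℝ) - i := sub_pos.2 (by exact_mod_cast hij)
  have h3 : 0 < δ * (((j : ℝ) - i) / (2 * k)) := by positivity
  have h4 := sub_nonneg.2 (hy.monotone (monotone_blockMap hn hij.le))
  linarith

/-- An inverse square root replaces the logarithmic singularity, since its sums over a block are
easy to bound. -/
theorem log_ge_neg_two_div_sqrt {z : ℝ} (hz : 0 < z) : -(2 / Real.sqrt z) ≤ Real.log z := by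
  have h1 := Real.log_le_sub_one_of_pos (inv_pos.2 (Real.sqrt_pos.2 hz))
  rw [Real.log_inv, Real.log_sqrt hz.le] at h1
  have : 2 / Real.sqrt z = 2 * (Real.sqrt z)⁻¹ := div_eq_mul_inv _ _
  rw [this]
  linarith

/-- Points from different blocks only move further apart. Within one block the term for y is log 0 =
0, and the drift alone bounds the distance from below. -/
theorem refine_log_ge (hy : StrictMono y) (hδ : 0 < δ)
    (hx : ∀ i, y (blockMap hn i) + δ * (i / k) ≤ x i ∧
      x i ≤ y (blockMap hn i) + δ * (i / k) + δ / (2 * k)) {i j : Fin k} (hij : i < j) :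
    Real.log |y (blockMap hn i) - y (blockMap hn j)| +
      (if blockMap hn j = blockMap hn i then
        Real.log (δ / 2) - 2 * Real.sqrt k * (1 / Real.sqrt |(i : ℝ) - j|) else 0) ≤
      Real.log |x i - x j| := by
  have hk : (0 : ℝ) < k := by exact_mod_cast i.pos
  have h1 := refine_sub_ge hn hδ hx hij
  have h2 : (0 : ℝ) < (j : ℝ) - i := sub_pos.2 (by exact_mod_cast hij)
  have h3 : 0 < δ * (((j : ℝ) - i) / (2 * k)) := by positivity
  have h4 := sub_nonneg.2 (hy.monotone (monotone_blockMap hn hij.le))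
  rw [abs_sub_comm (x i), abs_of_pos (sub_pos.2 (refine_strictMono hn hy hδ hx hij))]
  split_ifs with h
  · rw [h, sub_self, abs_zero, Real.log_zero, zero_add]
    rw [h, sub_self, zero_add] at h1
    refine le_trans ?_ (Real.log_le_log h3 h1)
    have h5 : δ * (((j : ℝ) - i) / (2 * k)) = δ / 2 * (((j : ℝ) - i) / k) := by field_simp
    rw [h5, Real.log_mul (by positivity) (by positivity)]
    have h6 := log_ge_neg_two_div_sqrt (z := ((j : ℝ) - i) / k) (by positivity)
    rw [Real.sqrt_div h2.le] at h6
    rw [abs_sub_comm, abs_of_pos h2]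
    have h7 : 2 / (Real.sqrt ((j : ℝ) - i) / Real.sqrt k) =
        2 * Real.sqrt k * (1 / Real.sqrt ((j : ℝ) - i)) := by
      have : Real.sqrt k ≠ 0 := (Real.sqrt_pos.2 hk).ne'
      field_simp
    rw [h7] at h6
    linarith
  · rw [add_zero, abs_sub_comm, abs_of_nonneg h4]
    refine Real.log_le_log (lt_of_le_of_ne h4 fun h5 => h ?_) (by linarith)
    exact hy.injective (by linarith)

theorem refine_logEnergy_ge (hy : StrictMono y) (hδ : 0 < δ) (hδ' : δ ≤ 2)
    (hx : ∀ i, y (blockMap hn i) + δ * (i / k) ≤ x i ∧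
      x i ≤ y (blockMap hn i) + δ * (i / k) + δ / (2 * k)) :
    ∑ A, ∑ B, (blockCard hn k A : ℝ) * blockCard hn k B * Real.log |y A - y B| +
      k * (blockLen n k * Real.log (δ / 2) - 8 * Real.sqrt k * Real.sqrt (blockLen n k)) ≤
      logEnergy x := by
  have hlog : Real.log (δ / 2) ≤ 0 := Real.log_nonpos (by positivity) (by linarith)
  have h1 : ∀ i j : Fin k, Real.log |y (blockMap hn i) - y (blockMap hn j)| +
      (if blockMap hn j = blockMap hn i then
        Real.log (δ / 2) - 2 * Real.sqrt k * (1 / Real.sqrt |(i : ℝ) - j|) else 0) ≤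
      Real.log |x i - x j| := by
    intro i j
    rcases lt_trichotomy i j with h | rfl | h
    · exact refine_log_ge hn hy hδ hx h
    -- On the diagonal the logarithms and 1 / √0 are 0, and what remains is log (δ / 2) ≤ 0.
    · simpa using hlog
    · have := refine_log_ge hn hy hδ hx h
      simpa only [abs_sub_comm, eq_comm] using this
  have h2 : ∀ i : Fin k, ∑ j : Fin k, Real.log |y (blockMap hn i) - y (blockMap hn j)| +
      (blockLen n k * Real.log (δ / 2) - 8 * Real.sqrt k * Real.sqrt (blockLen n k)) ≤
      ∑ j, Real.log |x i - x j| := by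
    intro i
    refine le_trans ?_ (Finset.sum_le_sum fun j _ => h1 i j)
    rw [Finset.sum_add_distrib, ← Finset.sum_filter, Finset.sum_sub_distrib, Finset.sum_const,
      nsmul_eq_mul, ← Finset.mul_sum]
    have h3 := sum_block_one_div_sqrt_le hn i
    have h4 : (blockCard hn k (blockMap hn i) : ℝ) ≤ blockLen n k :=
      Nat.cast_le.2 (blockCard_le hn _)
    have h5 := mul_le_mul_of_nonneg_left h3 (by positivity : 0 ≤ 2 * Real.sqrt k)
    have h6 := mul_le_mul_of_nonpos_right h4 hlog
    change _ ≤ _ + ((blockCard hn k (blockMap hn i) : ℝ) * _ - _)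
    linarith
  have h3 := Finset.sum_le_sum fun i (_ : i ∈ Finset.univ) => h2 i
  rw [Finset.sum_add_distrib, Finset.sum_const, Finset.card_univ, Fintype.card_fin,
    nsmul_eq_mul] at h3
  refine le_trans (le_of_eq ?_) h3
  congr 1
  rw [sum_blockMap (k := k) hn fun A => ∑ j : Fin k, Real.log |y A - y (blockMap hn j)|]
  refine Finset.sum_congr rfl fun A _ => ?_
  rw [sum_blockMap (k := k) hn fun B => Real.log |y A - y B|, Finset.mul_sum]
  exact Finset.sum_congr rfl fun B _ => mul_assoc _ _ _

/-- The even power on the right bounds all lower powers at once, and its average over a list is a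
controlled moment. -/
theorem abs_pow_sub_pow_le_of_close {u v δ : ℝ} (hδ : δ ≤ 1) (h : |u - v| ≤ δ) {m p : ℕ}
    (hp : p ≤ m) : |u ^ p - v ^ p| ≤ δ * (m * 2 ^ m * (1 + v ^ (2 * m))) := by
  have h0 : 0 ≤ δ := (abs_nonneg _).trans h
  set w := max 1 |v| with hw
  have hw1 : 1 ≤ w := le_max_left _ _
  have h1 : max |u| |v| ≤ 2 * w := by
    refine max_le ?_ ?_
    · have := abs_sub_abs_le_abs_sub u v
      have := le_max_right 1 |v|
      linarith
    · have := le_max_right 1 |v|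
      linarith
  have h2 : w ^ (2 * m) ≤ 1 + v ^ (2 * m) := by
    have h3 : 0 ≤ v ^ (2 * m) := (even_two_mul m).pow_nonneg v
    rcases le_total |v| 1 with h4 | h4
    · rw [hw, max_eq_left h4, one_pow]; linarith
    · rw [hw, max_eq_right h4, (even_two_mul m).pow_abs]; linarith
  have h3 : max |u| |v| ^ (p - 1) ≤ 2 ^ m * (1 + v ^ (2 * m)) := by
    calc max |u| |v| ^ (p - 1) ≤ (2 * w) ^ (p - 1) := pow_le_pow_left₀
          (le_max_of_le_left (abs_nonneg _)) h1 _
      _ = 2 ^ (p - 1) * w ^ (p - 1) := mul_pow _ _ _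
      _ ≤ 2 ^ m * w ^ (2 * m) := mul_le_mul (pow_le_pow_right₀ one_le_two (by omega))
          (pow_le_pow_right₀ hw1 (by omega)) (by positivity) (by positivity)
      _ ≤ _ := mul_le_mul_of_nonneg_left h2 (by positivity)
  calc |u ^ p - v ^ p| ≤ |u - v| * p * max |u| |v| ^ (p - 1) := abs_pow_sub_pow_le _ _ _
    _ ≤ δ * m * (2 ^ m * (1 + v ^ (2 * m))) := by
        refine mul_le_mul (mul_le_mul h (Nat.cast_le.2 hp) (Nat.cast_nonneg _) h0) h3 ?_
          (by positivity)
        exact pow_nonneg (le_max_of_le_left (abs_nonneg _)) _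
    _ = _ := by ring

end

end

/-! ### Free entropy of one element is a limit -/

section

variable {n : ℕ} (hn : 0 < n)

theorem tendsto_sum_blockMap_div (f : Fin n → ℝ) :
    Tendsto (fun k : ℕ => (∑ i : Fin k, f (blockMap hn i)) / k) atTop (𝓝 ((∑ A, f A) / n)) := by
  have h : Tendsto (fun k : ℕ => ∑ A, (blockCard hn k A : ℝ) / k * f A) atTop
      (𝓝 (∑ A, 1 / n * f A)) :=
    tendsto_finsetSum _ fun A _ => (tendsto_blockCard_div hn A).mul_const _
  rw [← Finset.mul_sum, one_div, inv_mul_eq_div] at h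
  refine h.congr fun k => ?_
  rw [sum_blockMap hn f, Finset.sum_div]
  exact Finset.sum_congr rfl fun A _ => (mul_div_right_comm _ _ _).symm

/-- Three errors of at most γ/4 add up: spreading by δ, unequal block sizes, and the error of y
itself. Moments of y up to order 2m are required because spreading is controlled by the average of
the 2m-th powers. -/
theorem eventually_refine_mem_momentSet {α : ℕ → ℝ} {m : ℕ} {γ δ : ℝ} (hγ : 0 < γ)
    (hδ : 0 < δ) (hδ1 : δ ≤ 1) (hm : 1 ≤ m)
    (hδm : δ * (m * 2 ^ m * (3 + |α (2 * m)|)) ≤ γ / 4) {y : Fin n → ℝ}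
    (hy : y ∈ momentSet α (2 * m) n (min (γ / 4) 1)) :
    ∀ᶠ k : ℕ in atTop, ∀ x : Fin k → ℝ, (∀ i : Fin k, y (blockMap hn i) + δ * (i / k) ≤ x i ∧
      x i ≤ y (blockMap hn i) + δ * (i / k) + δ / (2 * k)) → x ∈ momentSet α m k γ := by
  have h1 : ∀ᶠ k : ℕ in atTop, ∀ p ∈ Finset.range (2 * m + 1),
      |(∑ i : Fin k, y (blockMap hn i) ^ p) / k - (∑ A, y A ^ p) / n| < min (γ / 4) 1 := by
    rw [eventually_all_finset]
    intro p _
    exact (Metric.tendsto_nhds.1 (tendsto_sum_blockMap_div hn fun A => y A ^ p)) _ (by positivity)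
  filter_upwards [h1, eventually_ge_atTop 1] with k hk hk1 x hx p hp1 hpm
  have hk0 : (0 : ℝ) < k := by exact_mod_cast hk1
  have h2 : ∀ i : Fin k, |x i - y (blockMap hn i)| ≤ δ := by
    intro i
    have hi : (i : ℝ) + 1 ≤ k := by exact_mod_cast i.2
    have h3 : δ * (i / k) + δ / (2 * k) ≤ δ := by
      have : δ * (i / k) + δ / (2 * k) = δ * ((i + 1 / 2) / k) := by field_simp
      rw [this]
      refine mul_le_of_le_one_right hδ.le ?_
      rw [div_le_one hk0]
      linarith
    have h4 : 0 ≤ δ * ((i : ℝ) / k) := by positivity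
    rw [abs_le]
    constructor <;> linarith [(hx i).1, (hx i).2]
  have h3 : |(∑ i, x i ^ p) / k - (∑ i : Fin k, y (blockMap hn i) ^ p) / k| ≤ γ / 4 := by
    rw [← sub_div, ← Finset.sum_sub_distrib, abs_div, abs_of_pos hk0, div_le_iff₀ hk0]
    refine (Finset.abs_sum_le_sum_abs _ _).trans ((Finset.sum_le_sum fun i _ =>
      abs_pow_sub_pow_le_of_close hδ1 (h2 i) hpm).trans ?_)
    rw [← Finset.mul_sum, ← Finset.mul_sum, Finset.sum_add_distrib, Finset.sum_const,
      Finset.card_univ, Fintype.card_fin, nsmul_eq_mul, mul_one]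
    have h4 := (abs_lt.1 (hk (2 * m) (by simp))).2
    have h5 := (abs_lt.1 (hy (2 * m) (by omega) le_rfl)).2
    have h6 := min_le_right (γ / 4) (1 : ℝ)
    have h7 := le_abs_self (α (2 * m))
    -- One unit for the moment error of y and one for the block sizes; the summand 1 in the power
    -- estimate makes the 3 of `hδm`.
    have h8 : (∑ i : Fin k, y (blockMap hn i) ^ (2 * m)) / k ≤ 2 + |α (2 * m)| := by linarith
    rw [div_le_iff₀ hk0] at h8
    calc δ * (m * 2 ^ m * (k + ∑ i : Fin k, y (blockMap hn i) ^ (2 * m)))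
        ≤ δ * (m * 2 ^ m * (k + (2 + |α (2 * m)|) * k)) := by gcongr
      _ = δ * (m * 2 ^ m * (3 + |α (2 * m)|)) * k := by ring
      _ ≤ γ / 4 * k := by gcongr
  have h4 := hk p (Finset.mem_range.2 (by omega))
  have h5 := hy p hp1 (by omega)
  have h6 := min_le_left (γ / 4) (1 : ℝ)
  rw [abs_lt] at h4 h5 ⊢
  rw [abs_le] at h3
  constructor <;> linarith [h3.1, h3.2, h4.1, h4.2, h5.1, h5.2]

variable {M : Type*} [CStarAlgebra M] {φ : M →ₗ[ℂ] ℂ} {a : M} {α : ℕ → ℝ}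

/-- The loss relative to the energy of y consists of the terms within blocks. For fixed δ it tends
to 0 as n grows. The last summand on the left comes from the volume of the box. -/
theorem tendsto_refine_energy (y : Fin n → ℝ) {δ : ℝ} (hδ : 0 < δ) :
    Tendsto (fun k : ℕ =>
      (∑ A, ∑ B, (blockCard hn k A : ℝ) * blockCard hn k B * Real.log |y A - y B| +
        k * (blockLen n k * Real.log (δ / 2) - 8 * Real.sqrt k * Real.sqrt (blockLen n k))) /
        (k : ℝ) ^ 2 + Real.log (δ / (2 * k)) / k) atTop
      (𝓝 (logEnergy y / (n : ℝ) ^ 2 + (Real.log (δ / 2) / n - 8 * Real.sqrt (1 / n)))) := by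
  have h1 : Tendsto (fun k : ℕ => ∑ A, ∑ B, ((blockCard hn k A : ℝ) / k) *
      ((blockCard hn k B : ℝ) / k) * Real.log |y A - y B|) atTop
      (𝓝 (∑ A, ∑ B, (1 / n) * (1 / n) * Real.log |y A - y B|)) :=
    tendsto_finsetSum _ fun A _ => tendsto_finsetSum _ fun B _ =>
      ((tendsto_blockCard_div hn A).mul (tendsto_blockCard_div hn B)).mul_const _
  have h2 : Tendsto (fun k : ℕ => (blockLen n k : ℝ) / k * Real.log (δ / 2) -
      8 * Real.sqrt ((blockLen n k : ℝ) / k)) atTop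
      (𝓝 (1 / n * Real.log (δ / 2) - 8 * Real.sqrt (1 / n))) :=
    ((tendsto_blockLen_div hn).mul_const _).sub ((tendsto_blockLen_div hn).sqrt.const_mul 8)
  have h3 : Tendsto (fun k : ℕ => Real.log (δ / 2) / k - Real.log k / k) atTop (𝓝 (0 - 0)) :=
    (tendsto_const_div_atTop_nhds_zero_nat _).sub tendsto_log_nat_div
  have h4 := (h1.add h2).add h3
  have h5 : ∑ A, ∑ B, (1 / n) * (1 / n) * Real.log |y A - y B| +
      (1 / n * Real.log (δ / 2) - 8 * Real.sqrt (1 / n)) + (0 - 0) =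
      logEnergy y / (n : ℝ) ^ 2 + (Real.log (δ / 2) / n - 8 * Real.sqrt (1 / n)) := by
    simp_rw [← Finset.mul_sum]
    rw [logEnergy]
    ring
  rw [h5] at h4
  refine h4.congr' ?_
  filter_upwards [eventually_ge_atTop 1] with k hk
  have hk0 : (0 : ℝ) < k := by exact_mod_cast hk
  have h6 : ∑ A, ∑ B, ((blockCard hn k A : ℝ) / k) * ((blockCard hn k B : ℝ) / k) *
      Real.log |y A - y B| = (∑ A, ∑ B, (blockCard hn k A : ℝ) * blockCard hn k B *
      Real.log |y A - y B|) / (k : ℝ) ^ 2 := by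
    rw [Finset.sum_div]
    refine Finset.sum_congr rfl fun A _ => ?_
    rw [Finset.sum_div]
    refine Finset.sum_congr rfl fun B _ => ?_
    field_simp
  have h7 : Real.log (δ / (2 * k)) = Real.log (δ / 2) - Real.log k := by
    rw [← div_div, Real.log_div (by positivity) hk0.ne']
  have h8 : Real.sqrt ((blockLen n k : ℝ) / k) =
      Real.sqrt k * Real.sqrt (blockLen n k) / k := by
    rw [Real.sqrt_div (Nat.cast_nonneg _), div_eq_div_iff (Real.sqrt_pos.2 hk0).ne' hk0.ne']
    nth_rw 1 [← Real.mul_self_sqrt hk0.le]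
    ring
  rw [h6, h7, h8]
  field_simp

theorem eventually_le_single_of_mem_momentSet {n : ℕ} (hn : 0 < n) (hα : ∀ p, φ (a ^ p) = α p) {m : ℕ} {γ δ L : ℝ}
    (hL : Tendsto weylRate atTop (𝓝 L)) (hγ : 0 < γ) (hδ : 0 < δ) (hδ1 : δ ≤ 1) (hm : 1 ≤ m)
    (hδm : δ * (m * 2 ^ m * (3 + |α (2 * m)|)) ≤ γ / 4) {y : Fin n → ℝ} (hy' : StrictMono y)
    (hy : y ∈ momentSet α (2 * m) n (min (γ / 4) 1)) {r : ℝ}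
    (hr : r < logEnergy y / (n : ℝ) ^ 2 + (Real.log (δ / 2) / n - 8 * Real.sqrt (1 / n)) + L) :
    ∀ᶠ k : ℕ in atTop, (r : EReal) ≤ normLogVol (microstates φ ![a] m k γ) := by
  filter_upwards [eventually_refine_mem_momentSet hn hγ hδ hδ1 hm hδm hy,
    eventually_ge_atTop 1, ((tendsto_refine_energy hn y hδ).add hL).eventually_const_le hr]
    with k hk hk1 hrk
  have hk0 : (0 : ℝ) < k := by exact_mod_cast hk1
  refine le_trans (EReal.coe_le_coe_iff.2 (hrk.trans (le_of_eq ?_)))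
    (le_normLogVol_single hα hk1 (u := fun i => y (blockMap hn i) + δ * (i / k))
      (δ := δ / (2 * k)) (by positivity) fun x hx =>
      ⟨refine_strictMono hn hy' hδ hx, hk x hx,
        refine_logEnergy_ge hn hy' hδ (by linarith) hx⟩)
  ring

end

variable {M : Type*} [CStarAlgebra M] {φ : M →ₗ[ℂ] ℂ} {a : M} {α : ℕ → ℝ}

/-- Below the free entropy of one element, the volume bound holds for all large `k`, not only for
infinitely many. -/
theorem eventually_le_single (hα : ∀ p, φ (a ^ p) = α p) (m : ℕ) {γ : ℝ} (hγ : 0 < γ) {r : ℝ}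
    (hr : (r : EReal) < freeEntropy φ ![a]) :
    ∀ᶠ k : ℕ in atTop, (r : EReal) ≤ normLogVol (microstates φ ![a] m k γ) := by
  obtain ⟨L, hL⟩ := exists_tendsto_weylRate
  obtain ⟨r', hr1, hr2⟩ := EReal.lt_iff_exists_real_btwn.1 hr
  rw [EReal.coe_lt_coe_iff] at hr1
  -- Replacing m by m + 1 makes the order 2m' at least 2, so the second moment is available.
  set m' := m + 1
  set C := (m' * 2 ^ m' * (3 + |α (2 * m')|) : ℝ) with hC
  have hC0 : 0 < C := by positivity
  set δ := min 1 (γ / 4 / C) with hδ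
  have hδ0 : 0 < δ := by positivity
  have hδC : δ * C ≤ γ / 4 := by
    rw [← le_div_iff₀ hC0]
    exact min_le_right _ _
  set γ' := min (γ / 4) (1 : ℝ) with hγ'
  have hγ'0 : 0 < γ' := by positivity
  have h1 : (r' : EReal) < limsup (fun k => normLogVol (microstates φ ![a] (2 * m') k γ')) atTop :=
    hr2.trans_le (iInf_le_of_le (2 * m') (iInf_le_of_le γ' (iInf_le _ hγ'0)))
  have h2 := frequently_lt_of_lt_limsup (by isBoundedDefault) h1
  set A := |α 2| + γ' with hA
  have hA0 : 0 < A := by positivity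
  -- The level that survives extraction of a list at size k and its refinement to larger sizes.
  -- Since δ is fixed beforehand, the total loss vanishes, and one large k₀ with volume above r'
  -- suffices.
  have h3 : Tendsto (fun k : ℕ => r' - Real.log (2 * Real.sqrt (k * A)) / k - weylRate k + L +
      (Real.log (δ / 2) / k - 8 * Real.sqrt (1 / k))) atTop (𝓝 r') := by
    have h4 : Tendsto (fun k : ℕ => Real.log (2 * Real.sqrt (k * A)) / k) atTop (𝓝 0) := by
      have h5 : Tendsto (fun k : ℕ => Real.log (2 * Real.sqrt A) / k + 1 / 2 * (Real.log k / k))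
          atTop (𝓝 (0 + 1 / 2 * 0)) :=
        (tendsto_const_div_atTop_nhds_zero_nat _).add (tendsto_log_nat_div.const_mul _)
      rw [mul_zero, add_zero] at h5
      refine h5.congr' ?_
      filter_upwards [eventually_ge_atTop 1] with k hk
      have hk0 : (0 : ℝ) < k := by exact_mod_cast hk
      rw [Real.sqrt_mul hk0.le, mul_left_comm, Real.log_mul (Real.sqrt_pos.2 hk0).ne'
        (by positivity), Real.log_sqrt hk0.le]
      ring
    have h6 : Tendsto (fun k : ℕ => Real.log (δ / 2) / k - 8 * Real.sqrt (1 / k)) atTop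
        (𝓝 (0 - 8 * Real.sqrt 0)) :=
      (tendsto_const_div_atTop_nhds_zero_nat _).sub
        ((tendsto_const_div_atTop_nhds_zero_nat 1).sqrt.const_mul 8)
    have h7 := (((h4.const_sub r').sub hL).add_const L).add h6
    simpa using h7
  obtain ⟨k₀, hk₀, hrk, hk1⟩ := (h2.and_eventually
    ((h3.eventually_const_lt hr1).and (eventually_ge_atTop 1))).exists
  obtain ⟨y, hy, hy', hry⟩ := exists_logEnergy_ge hα hk1 (by omega) hγ'0 hk₀
  have h8 := eventually_le_single_of_mem_momentSet hk1 hα hL hγ hδ0 (min_le_left _ _)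
    (by omega : 1 ≤ m') hδC hy' hy (r := r) (by linarith)
  filter_upwards [h8] with k hk
  exact hk.trans (normLogVol_mono (measure_mono (microstates_mono (by omega) le_rfl)))

/-! ### Chessboard estimates for traces of words -/

theorem ntr_mul_conjTranspose {k : ℕ} (A : Matrix (Fin k) (Fin k) ℂ) :
    ntr (A * Aᴴ) = (((∑ i, ∑ j, ‖A i j‖ ^ 2) / k : ℝ) : ℂ) := by
  rw [ntr, Matrix.trace]
  push_cast
  congr 1
  refine Finset.sum_congr rfl fun i _ => ?_
  rw [Matrix.diag_apply, Matrix.mul_apply]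
  refine Finset.sum_congr rfl fun j _ => ?_
  rw [conjTranspose_apply]
  exact Complex.mul_conj' _

theorem norm_ntr_mul_sq_le {k : ℕ} (A B : Matrix (Fin k) (Fin k) ℂ) :
    ‖ntr (A * B)‖ ^ 2 ≤ ‖ntr (A * Aᴴ)‖ * ‖ntr (B * Bᴴ)‖ := by
  have h1 : ‖(A * B).trace‖ ≤ ∑ q : Fin k × Fin k, ‖A q.1 q.2‖ * ‖B q.2 q.1‖ := by
    rw [Fintype.sum_prod_type]
    refine (norm_sum_le _ _).trans (Finset.sum_le_sum fun i _ => ?_)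
    rw [Matrix.diag_apply, Matrix.mul_apply]
    refine (norm_sum_le _ _).trans (Finset.sum_le_sum fun j _ => ?_)
    rw [norm_mul]
  have h2 := (pow_le_pow_left₀ (norm_nonneg _) h1 2).trans
    (Finset.sum_mul_sq_le_sq_mul_sq Finset.univ (fun q : Fin k × Fin k => ‖A q.1 q.2‖)
      fun q => ‖B q.2 q.1‖)
  have h3 : ∑ q : Fin k × Fin k, ‖B q.2 q.1‖ ^ 2 = ∑ i, ∑ j, ‖B i j‖ ^ 2 := by
    rw [Fintype.sum_prod_type, Finset.sum_comm]
  rw [Fintype.sum_prod_type, h3] at h2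
  rw [ntr_mul_conjTranspose, ntr_mul_conjTranspose, Complex.norm_real, Complex.norm_real,
    Real.norm_of_nonneg (by positivity), Real.norm_of_nonneg (by positivity), ntr, norm_div,
    Complex.norm_natCast, div_pow, div_mul_div_comm, ← sq]
  exact div_le_div_of_nonneg_right h2 (by positivity)

section

variable {ι : Type*} {k : ℕ}

/-- The product of matrices along a word. -/
def wordProd (B : ι → SaMat k) (w : List ι) : Matrix (Fin k) (Fin k) ℂ :=
  (w.map fun i => (B i).toMatrix).prod

theorem wordProd_append (B : ι → SaMat k) (u v : List ι) :
    wordProd B (u ++ v) = wordProd B u * wordProd B v := by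
  simp [wordProd]

theorem wordProd_cons (B : ι → SaMat k) (i : ι) (v : List ι) :
    wordProd B (i :: v) = (B i).toMatrix * wordProd B v := by
  simp [wordProd]

theorem wordProd_reverse (B : ι → SaMat k) (u : List ι) :
    wordProd B u.reverse = (wordProd B u)ᴴ := by
  rw [wordProd, wordProd, Matrix.conjTranspose_list_prod, List.map_map, List.map_reverse]
  congr 2
  refine List.map_congr_left fun i _ => ?_
  exact (B i).conjTranspose_toMatrix.symm

theorem wordProd_map {κ : Type*} (B : ι → SaMat k) (g : κ → ι) (w : List κ) :
    wordProd B (w.map g) = wordProd (fun i => B (g i)) w := by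
  simp [wordProd, List.map_map, Function.comp_def]

/-- Cauchy–Schwarz for the trace; the adjoint of a word in selfadjoint letters is the reversed word.
-/
theorem norm_ntr_wordProd_append_sq_le (B : ι → SaMat k) (u v : List ι) :
    ‖ntr (wordProd B (u ++ v))‖ ^ 2 ≤
      ‖ntr (wordProd B (u ++ u.reverse))‖ * ‖ntr (wordProd B (v ++ v.reverse))‖ := by
  simp only [wordProd_append, wordProd_reverse]
  exact norm_ntr_mul_sq_le _ _

theorem ntr_wordProd_append_comm (B : ι → SaMat k) (u v : List ι) :
    ntr (wordProd B (u ++ v)) = ntr (wordProd B (v ++ u)) := by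
  rw [wordProd_append, wordProd_append, ntr_mul_comm]

/-- The trace of a word of length `2 ^ r` in selfadjoint matrices is dominated by the trace of the
`2 ^ r`-th power of one of them. -/
theorem exists_norm_ntr_wordProd_le [Finite ι] (B : ι → SaMat k) (r : ℕ) {w : List ι}
    (hw : w.length = 2 ^ r) :
    ∃ i, ‖ntr (wordProd B w)‖ ≤ ‖ntr ((B i).toMatrix ^ 2 ^ r)‖ := by
  obtain ⟨w₀, hw₀, hmax⟩ := Set.exists_max_image {w : List ι | w.length = 2 ^ r}
    (fun w => ‖ntr (wordProd B w)‖) (List.finite_length_eq ι _) ⟨w, hw⟩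
  -- Starting from a word of maximal trace, reflecting the half that begins with a run of one letter
  -- doubles that run without decreasing the bound.
  have key : ∀ j ≤ r, ∃ (i : ι) (v : List ι), (List.replicate (2 ^ j) i ++ v).length = 2 ^ r ∧
      ‖ntr (wordProd B w₀)‖ ≤ ‖ntr (wordProd B (List.replicate (2 ^ j) i ++ v))‖ := by
    intro j
    induction j with
    | zero =>
      intro _
      obtain ⟨i, v, rfl⟩ : ∃ i v, w₀ = i :: v := by
        cases w₀ with
        | nil =>
          have : (0 : ℕ) = 2 ^ r := hw₀
          exact absurd this (by positivity)
        | cons i v => exact ⟨i, v, rfl⟩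
      exact ⟨i, v, hw₀, le_rfl⟩
    | succ j ih =>
      intro hj
      obtain ⟨i, v, hlen, hle⟩ := ih (by omega)
      have hr : 2 ^ r = 2 ^ (r - 1) * 2 := by
        rw [← pow_succ]
        congr 1
        omega
      have hjr : 2 ^ j ≤ 2 ^ (r - 1) := Nat.pow_le_pow_right two_pos (by omega)
      rw [List.length_append, List.length_replicate] at hlen
      set u := v.take (2 ^ (r - 1) - 2 ^ j) with hu
      set t := v.drop (2 ^ (r - 1) - 2 ^ j) with ht
      have hul : u.length = 2 ^ (r - 1) - 2 ^ j := by
        rw [hu, List.length_take]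
        omega
      have htl : t.length = 2 ^ (r - 1) := by
        rw [ht, List.length_drop]
        omega
      refine ⟨i, u ++ u.reverse, ?_, ?_⟩
      · simp only [List.length_append, List.length_replicate, List.length_reverse, hul, pow_succ]
        omega
      · have h1 : List.replicate (2 ^ j) i ++ v = (List.replicate (2 ^ j) i ++ u) ++ t := by
          rw [List.append_assoc, hu, ht, List.take_append_drop]
        have h2 := norm_ntr_wordProd_append_sq_le B (List.replicate (2 ^ j) i ++ u) t
        rw [← h1] at h2
        -- Maximality bounds the palindrome of the other half, so one factor cancels in the
        -- Cauchy–Schwarz inequality.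
        have h3 := hmax (t ++ t.reverse) (by
          simp only [Set.mem_ofPred_eq, List.length_append, List.length_reverse, htl]
          omega)
        -- The palindrome starts and ends with the run; cyclicity of the trace joins the two copies.
        have h4 : ntr (wordProd B (List.replicate (2 ^ j) i ++ u ++
            (List.replicate (2 ^ j) i ++ u).reverse)) =
            ntr (wordProd B (List.replicate (2 ^ (j + 1)) i ++ (u ++ u.reverse))) := by
          rw [List.reverse_append, List.reverse_replicate, ← List.append_assoc,
            ntr_wordProd_append_comm, pow_succ, mul_two, List.replicate_add]
          simp only [List.append_assoc]
        rw [h4] at h2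
        set X := ‖ntr (wordProd B w₀)‖
        set Y := ‖ntr (wordProd B (List.replicate (2 ^ (j + 1)) i ++ (u ++ u.reverse)))‖
        have hX : 0 ≤ X := norm_nonneg _
        have hY : 0 ≤ Y := norm_nonneg _
        have h5 : X ^ 2 ≤ Y * X := (pow_le_pow_left₀ hX hle 2).trans
          (h2.trans (mul_le_mul_of_nonneg_left h3 hY))
        rcases hX.eq_or_lt with h6 | h6
        · rw [← h6]; exact hY
        · exact le_of_mul_le_mul_right (by rwa [sq] at h5) h6
  obtain ⟨i, v, hlen, hle⟩ := key r le_rfl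
  have hv : v = [] := by
    rw [List.length_append, List.length_replicate] at hlen
    exact List.length_eq_zero_iff.1 (by omega)
  have h : wordProd B (List.replicate (2 ^ r) i) = (B i).toMatrix ^ 2 ^ r := by
    rw [wordProd, List.map_replicate, List.prod_replicate]
  rw [hv, List.append_nil, h] at hle
  exact ⟨i, (hmax w hw).trans hle⟩

theorem norm_ntr_one_le : ‖ntr (1 : Matrix (Fin k) (Fin k) ℂ)‖ ≤ 1 := by
  rw [ntr, Matrix.trace_one, Fintype.card_fin]
  rcases eq_or_ne (k : ℂ) 0 with h | h
  · simp [h]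
  · simp [div_self h]

/-- Shorter words are padded to length 2^r by an extra letter for the identity, whose trace is at
most 1. -/
theorem norm_ntr_wordProd_le [Finite ι] (B : ι → SaMat k) {r : ℕ} {C : ℝ} (hC : 1 ≤ C)
    (hB : ∀ i, ‖ntr ((B i).toMatrix ^ 2 ^ r)‖ ≤ C) {w : List ι} (hw : w.length ≤ 2 ^ r) :
    ‖ntr (wordProd B w)‖ ≤ C := by
  set B' : Option ι → SaMat k := fun o => o.elim (SaMat.mk 1 conjTranspose_one) B with hB'
  have h1 : wordProd B' (w.map some ++ List.replicate (2 ^ r - w.length) none) = wordProd B w := by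
    rw [wordProd_append, wordProd_map]
    have : wordProd B' (List.replicate (2 ^ r - w.length) none) = 1 := by
      rw [wordProd, List.map_replicate, List.prod_replicate]
      exact one_pow _
    rw [this, mul_one]
    rfl
  obtain ⟨i, hi⟩ := exists_norm_ntr_wordProd_le B' r
    (w := w.map some ++ List.replicate (2 ^ r - w.length) none) (by simp; omega)
  rw [h1] at hi
  refine hi.trans ?_
  cases i with
  | none =>
    have : (B' none).toMatrix ^ 2 ^ r = 1 := one_pow _
    rw [this]
    exact norm_ntr_one_le.trans hC
  | some i => exact hB i

theorem norm_ntr_toMatrix_mul_le (D : SaMat k) (A : Matrix (Fin k) (Fin k) ℂ) {C : ℝ}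
    (hA : ‖ntr (A * Aᴴ)‖ ≤ C) : ‖ntr (D.toMatrix * A)‖ ≤ ‖D‖ * Real.sqrt C := by
  have h := norm_ntr_mul_sq_le D.toMatrix A
  have h1 : ‖ntr (D.toMatrix * D.toMatrixᴴ)‖ = ‖D‖ ^ 2 := by
    rw [ntr_mul_conjTranspose, Complex.norm_real, Real.norm_of_nonneg (by positivity),
      SaMat.norm_sq_eq_re_ntr, re_ntr_sq]
  rw [h1] at h
  have hC : 0 ≤ C := (norm_nonneg _).trans hA
  refine le_of_sq_le_sq ?_ (by positivity)
  rw [mul_pow, Real.sq_sqrt hC]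
  exact h.trans (mul_le_mul_of_nonneg_left hA (by positivity))

/-- Letters are exchanged one at a time. Each exchange costs the trace of (A i - A' i) W, which
Cauchy–Schwarz bounds by |A i - A' i|₂ and the trace of W W*. The latter is a word of length at most
2N in both alphabets, so the chessboard estimate replaces operator norm bounds. -/
theorem norm_ntr_wordProd_sub_le [Finite ι] (A A' : ι → SaMat k) {r N : ℕ} {C ε : ℝ} (hC : 1 ≤ C)
    (hA : ∀ i, ‖ntr ((A i).toMatrix ^ 2 ^ r)‖ ≤ C) (hA' : ∀ i, ‖ntr ((A' i).toMatrix ^ 2 ^ r)‖ ≤ C)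
    (hN : 2 * N ≤ 2 ^ r) (hε : ∀ i, ‖A i - A' i‖ ≤ ε) {w : List ι} (hw : w.length ≤ N) :
    ‖ntr (wordProd A w) - ntr (wordProd A' w)‖ ≤ w.length * (ε * Real.sqrt C) := by
  set B : ι ⊕ ι → SaMat k := Sum.elim A A'
  have hB : ∀ i, ‖ntr ((B i).toMatrix ^ 2 ^ r)‖ ≤ C := by
    rintro (i | i)
    exacts [hA i, hA' i]
  have hsub : ∀ X Y : Matrix (Fin k) (Fin k) ℂ, ntr (X - Y) = ntr X - ntr Y := fun X Y => by
    rw [ntr, ntr, ntr, trace_sub, sub_div]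
  -- The prefix u collects the letters already exchanged.
  have key : ∀ (w : List ι) (u : List (ι ⊕ ι)), u.length + w.length ≤ N →
      ‖ntr (wordProd B u * wordProd A w) - ntr (wordProd B u * wordProd A' w)‖ ≤
        w.length * (ε * Real.sqrt C) := by
    intro w
    induction w with
    | nil => intro u _; simp [wordProd]
    | cons i w ih =>
      intro u hu
      rw [List.length_cons] at hu
      have h1 := ih (u ++ [Sum.inr i]) (by rw [List.length_append, List.length_singleton]; omega)
      rw [wordProd_append] at h1
      have h2 : wordProd B [Sum.inr i] = (A' i).toMatrix := by simp [wordProd, B]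
      rw [h2] at h1
      set W := wordProd A w * wordProd B u with hW
      have h3 : ‖ntr (W * Wᴴ)‖ ≤ C := by
        have h4 : W = wordProd B (w.map Sum.inl ++ u) := by
          rw [wordProd_append, wordProd_map]
          rfl
        rw [h4, ← wordProd_reverse, ← wordProd_append]
        refine norm_ntr_wordProd_le B hC hB ?_
        simp only [List.length_append, List.length_reverse, List.length_map]
        omega
      have h5 := (norm_ntr_toMatrix_mul_le (A i - A' i) W h3).trans
        (mul_le_mul_of_nonneg_right (hε i) (Real.sqrt_nonneg _))
      have h6 : ntr (wordProd B u * wordProd A (i :: w)) -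
          ntr (wordProd B u * wordProd A' (i :: w)) =
          ntr ((A i - A' i).toMatrix * W) +
          (ntr (wordProd B u * (A' i).toMatrix * wordProd A w) -
            ntr (wordProd B u * (A' i).toMatrix * wordProd A' w)) := by
        rw [hW, ← mul_assoc, ntr_mul_comm _ (wordProd B u), map_sub, sub_mul, mul_sub, hsub,
          wordProd_cons, wordProd_cons]
        simp only [mul_assoc]
        ring
      rw [h6, List.length_cons, Nat.cast_add, Nat.cast_one, add_mul, one_mul, add_comm (_ * _)]
      exact (norm_add_le _ _).trans (add_le_add h5 h1)
  have := key w [] (by simpa using hw)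
  simpa [wordProd] using this

end

/-! ### The distribution of a selfadjoint element -/

section

variable {M : Type*} [CStarAlgebra M] {φ : M →ₗ[ℂ] ℂ}

/-- By polarization 4c is a difference of two elements of the form x*x, on which φ is real. -/
theorem IsTracialState.im_eq_zero (hφ : IsTracialState φ) {c : M} (hc : IsSelfAdjoint c) :
    (φ c).im = 0 := by
  have h1 : (4 : ℂ) • c = star (c + 1) * (c + 1) - star (c - 1) * (c - 1) := by
    rw [star_add, star_sub, star_one, hc.star_eq, show (4 : ℂ) = (4 : ℕ) by norm_num,
      Nat.cast_smul_eq_nsmul]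
    noncomm_ring
  have h2 := congrArg (fun z => (φ z).im) h1
  simp only [map_smul, map_sub, smul_eq_mul, Complex.sub_im, (hφ.nonneg _).2] at h2
  simpa using h2

open scoped CompactlySupported in
/-- A state restricted to the algebra of a selfadjoint element, as a positive functional on
continuous functions on the spectrum. -/
def IsTracialState.spectralFunctional (hφ : IsTracialState φ) {a : M} (ha : IsSelfAdjoint a) :
    C_c(spectrum ℝ a, ℝ) →ₚ[ℝ] ℝ :=
  PositiveLinearMap.mk₀
    { toFun := fun f => (φ (cfcHom (R := ℝ) ha f.toContinuousMap)).re
      map_add' := fun f g => by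
        have : (f + g).toContinuousMap = f.toContinuousMap + g.toContinuousMap := rfl
        rw [this, map_add, map_add, Complex.add_re]
      map_smul' := fun r f => by
        have : (r • f).toContinuousMap = r • f.toContinuousMap := rfl
        rw [this, map_smul, ← Complex.coe_smul, map_smul]
        simp }
    fun f hf => by
      have hf' : ∀ x, 0 ≤ f x := hf
      set g : C(spectrum ℝ a, ℝ) := ⟨fun x => Real.sqrt (f x), by fun_prop⟩ with hg
      have h1 : f.toContinuousMap = star g * g := by
        ext x
        exact (Real.mul_self_sqrt (hf' x)).symm
      change 0 ≤ (φ (cfcHom (R := ℝ) ha f.toContinuousMap)).re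
      rw [h1, map_mul, map_star]
      exact (hφ.nonneg _).1

/-- Riesz–Markov on the compact spectrum, with the resulting measure pushed forward to the line; the
moment of order 0 shows that it is a probability. -/
theorem IsTracialState.exists_distribution (hφ : IsTracialState φ) {a : M}
    (ha : IsSelfAdjoint a) : ∃ (μ : Measure ℝ) (R : ℝ), IsProbabilityMeasure μ ∧ 0 ≤ R ∧
      (∀ᵐ t ∂μ, |t| ≤ R) ∧ ∀ p : ℕ, φ (a ^ p) = ((∫ t, t ^ p ∂μ : ℝ) : ℂ) := by
  have hcomp : CompactSpace (spectrum ℝ a) :=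
    isCompact_iff_compactSpace.1 (spectrum.isCompact a)
  set ν := RealRMK.rieszMeasure (hφ.spectralFunctional ha) with hν
  have hid : cfcHom (R := ℝ) ha (.restrict (spectrum ℝ a) (.id ℝ)) = a := cfcHom_id ha
  have hmom : ∀ p : ℕ, φ (a ^ p) = ((∫ t : spectrum ℝ a, (t : ℝ) ^ p ∂ν : ℝ) : ℂ) := by
    intro p
    set f := CompactlySupportedContinuousMap.continuousMapEquiv
      ((ContinuousMap.restrict (spectrum ℝ a) (.id ℝ)) ^ p) with hf
    have h1 := RealRMK.integral_rieszMeasure (hφ.spectralFunctional ha) f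
    have h2 : hφ.spectralFunctional ha f = (φ (a ^ p)).re := by
      change (φ (cfcHom (R := ℝ) ha ((ContinuousMap.restrict (spectrum ℝ a) (.id ℝ)) ^ p))).re = _
      rw [map_pow, hid]
    rw [h2] at h1
    apply Complex.ext
    · rw [Complex.ofReal_re, ← h1]
      rfl
    · rw [Complex.ofReal_im, hφ.im_eq_zero (ha.pow p)]
  have hprob : IsProbabilityMeasure ν := by
    have h1 := hmom 0
    simp only [pow_zero, hφ.map_one, integral_const, smul_eq_mul, mul_one] at h1
    have h2 : ν.real Set.univ = 1 := by exact_mod_cast h1.symm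
    constructor
    rw [Measure.real, ENNReal.toReal_eq_one_iff] at h2
    exact h2
  obtain ⟨R, hR⟩ := (spectrum.isCompact (𝕜 := ℝ) a).isBounded.exists_norm_le
  have hval : Measurable (Subtype.val : spectrum ℝ a → ℝ) := measurable_subtype_coe
  refine ⟨ν.map Subtype.val, |R|, Measure.isProbabilityMeasure_map hval.aemeasurable, abs_nonneg _,
    ?_, fun p => ?_⟩
  · rw [ae_map_iff hval.aemeasurable (measurableSet_le (by fun_prop) (by fun_prop))]
    exact Eventually.of_forall fun t => (hR t t.2).trans (le_abs_self R)
  · rw [hmom, integral_map hval.aemeasurable (by fun_prop)]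

end

/-! ### Existence of bounded microstate sequences -/

theorem opNorm_diag_le {k : ℕ} {x : Fin k → ℝ} {R : ℝ} (hR : 0 ≤ R) (hx : ∀ i, |x i| ≤ R) :
    opNorm (SaMat.diag x).toMatrix ≤ R := by
  refine ContinuousLinearMap.opNorm_le_bound _ hR fun v => ?_
  refine le_of_sq_le_sq ?_ (by positivity)
  rw [mul_pow, EuclideanSpace.norm_sq_eq, EuclideanSpace.norm_sq_eq, Finset.mul_sum]
  refine Finset.sum_le_sum fun i _ => ?_
  have h1 : (Matrix.toEuclideanCLM (𝕜 := ℂ) (SaMat.diag x).toMatrix v) i = (x i : ℂ) * v i := by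
    rw [Matrix.ofLp_toEuclideanCLM]
    exact Matrix.mulVec_diagonal _ _ _
  rw [h1, norm_mul, mul_pow, Complex.norm_real, Real.norm_eq_abs]
  gcongr
  exact hx i

/-- The strong law for independent samples of μ, applied to each power; countably many almost sure
events occur together. -/
theorem exists_sample {μ : Measure ℝ} [IsProbabilityMeasure μ] {R : ℝ}
    (hR : ∀ᵐ t ∂μ, |t| ≤ R) : ∃ x : ℕ → ℝ, (∀ i, |x i| ≤ R) ∧ ∀ p : ℕ,
      Tendsto (fun k : ℕ => (∑ i ∈ Finset.range k, x i ^ p) / (k : ℝ)) atTop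
        (𝓝 (∫ t : ℝ, t ^ p ∂μ)) := by
  set P := Measure.infinitePi fun _ : ℕ => μ with hP
  have hmap : ∀ i, P.map (fun ω => ω i) = μ := fun i => Measure.infinitePi_map_eval _ i
  have hev : ∀ i, Measurable fun ω : ℕ → ℝ => ω i := fun i => measurable_pi_apply i
  have h1 : ∀ᵐ ω ∂P, ∀ i, |ω i| ≤ R := by
    rw [ae_all_iff]
    intro i
    have := hR
    rw [← hmap i] at this
    exact ae_of_ae_map (hev i).aemeasurable this
  have h2 : ∀ p : ℕ, ∀ᵐ ω ∂P, Tendsto (fun k : ℕ => (∑ i ∈ Finset.range k, ω i ^ p) / (k : ℝ)) atTop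
      (𝓝 (∫ t : ℝ, t ^ p ∂μ)) := by
    intro p
    have hpm : Measurable fun t : ℝ => t ^ p := by fun_prop
    have hint : Integrable (fun t : ℝ => t ^ p) μ := by
      refine Integrable.of_bound hpm.aestronglyMeasurable (R ^ p) ?_
      filter_upwards [hR] with t ht
      rw [norm_pow, Real.norm_eq_abs]
      exact pow_le_pow_left₀ (abs_nonneg _) ht _
    have h3 := ProbabilityTheory.strong_law_ae_real (μ := P) (fun i ω => ω i ^ p) ?_ ?_ ?_
    · have h4 : ∫ ω, ω 0 ^ p ∂P = ∫ t, t ^ p ∂μ := by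
        conv_rhs => rw [← hmap 0, integral_map (hev 0).aemeasurable (by fun_prop)]
      rwa [h4] at h3
    · have : Integrable (fun t : ℝ => t ^ p) (P.map fun ω => ω 0) := by rwa [hmap]
      exact this.comp_measurable (hev 0)
    · intro i j hij
      exact (ProbabilityTheory.iIndepFun_infinitePi (P := fun _ : ℕ => μ)
        (X := fun _ t => t ^ p) fun _ => hpm).indepFun hij
    · intro i
      refine ProbabilityTheory.IdentDistrib.comp (u := fun t => t ^ p)
        (f := fun ω : ℕ → ℝ => ω i) (g := fun ω : ℕ → ℝ => ω 0) ?_ hpm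
      exact ⟨(hev i).aemeasurable, (hev 0).aemeasurable, by rw [hmap, hmap]⟩
  obtain ⟨ω, hω1, hω2⟩ := (h1.and (ae_all_iff.2 h2)).exists
  exact ⟨ω, hω1, hω2⟩

theorem IsTracialState.exists_isMicrostateSeq {M : Type*} [CStarAlgebra M] {φ : M →ₗ[ℂ] ℂ}
    (hφ : IsTracialState φ) {a : M} (ha : IsSelfAdjoint a) : ∃ s, IsMicrostateSeq φ a s := by
  obtain ⟨μ, R, hμ, hR0, hR, hα⟩ := hφ.exists_distribution ha
  obtain ⟨x, hx, hlim⟩ := exists_sample hR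
  refine ⟨fun k => SaMat.diag fun i : Fin k => x i, fun m γ hγ => ?_, R, fun k =>
    opNorm_diag_le hR0 fun i => hx i⟩
  have h1 : ∀ᶠ k : ℕ in atTop, ∀ p ∈ Finset.range (m + 1),
      |(∑ i ∈ Finset.range k, x i ^ p) / k - ∫ t, t ^ p ∂μ| < γ := by
    rw [eventually_all_finset]
    intro p _
    exact Metric.tendsto_nhds.1 (hlim p) γ hγ
  filter_upwards [h1] with k hk
  rw [single_diag_mem_microstates_iff hα]
  intro p _ hpm
  rw [Fin.sum_univ_eq_sum_range (fun i => x i ^ p) k]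
  exact hk p (Finset.mem_range.2 (by omega))

/-! ### Convergence in moments -/

theorem eventually_one_div_le {γ : ℝ} (hγ : 0 < γ) :
    ∀ᶠ n : ℕ in atTop, 1 / ((n : ℝ) + 1) ≤ γ :=
  tendsto_one_div_add_atTop_nhds_zero_nat.eventually_le_const hγ

section

open Polynomial

theorem abs_eval_le_of_one_le_abs (P : ℝ[X]) {t : ℝ} (ht : 1 ≤ |t|) :
    |P.eval t| ≤ (∑ d ∈ Finset.range (P.natDegree + 1), |P.coeff d|) * |t| ^ P.natDegree := by
  rw [eval_eq_sum_range, Finset.sum_mul]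
  refine (Finset.abs_sum_le_sum_abs _ _).trans (Finset.sum_le_sum fun d hd => ?_)
  rw [abs_mul, abs_pow]
  exact mul_le_mul_of_nonneg_left
    (pow_le_pow_right₀ ht (Nat.lt_succ_iff.1 (Finset.mem_range.1 hd))) (abs_nonneg _)

/-- Outside [-R, R] the growth of P is absorbed by a high even power, gaining the factor R^(-2s).
This allows for the few eigenvalues that moment bounds leave far out. -/
theorem abs_sub_eval_le {f : ℝ → ℝ} (hf1 : ∀ t, |f t| ≤ 1) {P : ℝ[X]} {R ε : ℝ} (hR : 1 ≤ R)
    (hε : 0 ≤ ε) (hP : ∀ t ∈ Set.Icc (-R) R, |P.eval t - f t| ≤ ε) (s : ℕ) (t : ℝ) :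
    |f t - P.eval t| ≤ ε + (1 + ∑ d ∈ Finset.range (P.natDegree + 1), |P.coeff d|) *
      (t ^ (2 * (P.natDegree + s)) / R ^ (2 * s)) := by
  set K := ∑ d ∈ Finset.range (P.natDegree + 1), |P.coeff d|
  have hK : 0 ≤ K := Finset.sum_nonneg fun d _ => abs_nonneg _
  have ht0 : 0 ≤ t ^ (2 * (P.natDegree + s)) := (even_two_mul _).pow_nonneg t
  have hR0 : 0 < R := by linarith
  rcases le_or_gt |t| R with h | h
  · rw [abs_sub_comm]
    have : 0 ≤ (1 + K) * (t ^ (2 * (P.natDegree + s)) / R ^ (2 * s)) := by positivity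
    linarith [hP t (abs_le.1 h)]
  · have h1 : 1 ≤ |t| := hR.trans h.le
    have h2 : |t| ^ P.natDegree ≤ t ^ (2 * (P.natDegree + s)) / R ^ (2 * s) := by
      rw [le_div_iff₀ (by positivity), ← (even_two_mul _).pow_abs t, mul_add, pow_add]
      exact mul_le_mul (pow_le_pow_right₀ h1 (by omega)) (pow_le_pow_left₀ hR0.le h.le _)
        (by positivity) (by positivity)
    have h3 : (1 : ℝ) ≤ |t| ^ P.natDegree := one_le_pow₀ h1
    have h4 := abs_eval_le_of_one_le_abs P h1
    have h5 : |f t - P.eval t| ≤ |f t| + |P.eval t| := abs_sub _ _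
    have h6 : (1 + K) * |t| ^ P.natDegree ≤
        (1 + K) * (t ^ (2 * (P.natDegree + s)) / R ^ (2 * s)) :=
      mul_le_mul_of_nonneg_left h2 (by positivity)
    linarith [hf1 t]

theorem abs_sum_eval_div_sub_le {α : ℕ → ℝ} (hα0 : α 0 = 1) (P : ℝ[X]) {m k : ℕ} {γ : ℝ}
    (hk : 1 ≤ k) (hγ : 0 < γ) (hm : P.natDegree ≤ m) {x : Fin k → ℝ} (hx : x ∈ momentSet α m k γ) :
    |(∑ i, P.eval (x i)) / k - ∑ d ∈ Finset.range (P.natDegree + 1), P.coeff d * α d| ≤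
      (∑ d ∈ Finset.range (P.natDegree + 1), |P.coeff d|) * γ := by
  have hk0 : (k : ℝ) ≠ 0 := by positivity
  have h1 : (∑ i, P.eval (x i)) / k =
      ∑ d ∈ Finset.range (P.natDegree + 1), P.coeff d * ((∑ i, x i ^ d) / k) := by
    simp only [eval_eq_sum_range]
    rw [Finset.sum_comm, Finset.sum_div]
    exact Finset.sum_congr rfl fun d _ => by rw [← Finset.mul_sum, mul_div_assoc]
  rw [h1, ← Finset.sum_sub_distrib, Finset.sum_mul]
  refine (Finset.abs_sum_le_sum_abs _ _).trans (Finset.sum_le_sum fun d hd => ?_)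
  rw [← mul_sub, abs_mul]
  refine mul_le_mul_of_nonneg_left ?_ (abs_nonneg _)
  rcases Nat.eq_zero_or_pos d with rfl | hd0
  · simp [hα0, hk0, hγ.le]
  · have := Finset.mem_range.1 hd
    exact (hx d hd0 (by omega)).le

/-- Averages of a bounded continuous function are determined by finitely many moments, up to a
prescribed error. -/
theorem exists_eventually_average_close {α : ℕ → ℝ} {R₀ : ℝ} (hR₀ : 0 ≤ R₀) (hα0 : α 0 = 1)
    (hα : ∀ q, |α (2 * q)| ≤ R₀ ^ (2 * q)) {f : ℝ → ℝ} (hf : Continuous f)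
    (hf1 : ∀ t, |f t| ≤ 1) {ε : ℝ} (hε : 0 < ε) :
    ∃ c : ℝ, ∀ᶠ n : ℕ in atTop, ∀ k : ℕ, 1 ≤ k → ∀ x ∈ momentSet α n k (1 / (n + 1)),
      |(∑ i, f (x i)) / k - c| ≤ ε := by
  -- Being larger than both R₀ and 1, this makes the tail terms decay geometrically in s.
  set R := R₀ + 2 with hR
  have hR0 : 0 < R := by linarith
  obtain ⟨P, hP⟩ := exists_polynomial_near_of_continuousOn (-R) R f hf.continuousOn (ε / 3)
    (by positivity)
  set D := P.natDegree
  set K := ∑ d ∈ Finset.range (D + 1), |P.coeff d| with hK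
  have hK0 : 0 ≤ K := Finset.sum_nonneg fun d _ => abs_nonneg _
  have h1 : Tendsto (fun s : ℕ => (1 + K) * (R₀ ^ (2 * D) * ((R₀ / R) ^ 2) ^ s +
      ((1 / R) ^ 2) ^ s)) atTop (𝓝 ((1 + K) * (R₀ ^ (2 * D) * 0 + 0))) := by
    refine (((tendsto_pow_atTop_nhds_zero_of_lt_one (by positivity) ?_).const_mul _).add
      (tendsto_pow_atTop_nhds_zero_of_lt_one (by positivity) ?_)).const_mul _
    · refine pow_lt_one₀ (by positivity) ?_ two_ne_zero
      rw [div_lt_one hR0]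
      linarith
    · refine pow_lt_one₀ (by positivity) ?_ two_ne_zero
      rw [div_lt_one hR0]
      linarith
  rw [mul_zero, add_zero, mul_zero] at h1
  obtain ⟨s, hs⟩ := (h1.eventually_le_const (show 0 < ε / 3 by positivity)).exists
  refine ⟨∑ d ∈ Finset.range (D + 1), P.coeff d * α d, ?_⟩
  filter_upwards [eventually_ge_atTop (2 * (D + s) + 1),
    eventually_one_div_le (show 0 < ε / 3 / (K + 1) by positivity), eventually_one_div_le one_pos]
    with n hn hn1 hn2 k hk x hx
  have hk0 : (0 : ℝ) < k := by exact_mod_cast hk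
  have h2 := abs_sum_eval_div_sub_le hα0 P hk (by positivity) (by omega) hx
  have h3 : K * (1 / ((n : ℝ) + 1)) ≤ ε / 3 := by
    rw [le_div_iff₀ (by positivity)] at hn1
    have : (0 : ℝ) < 1 / ((n : ℝ) + 1) := by positivity
    linarith
  have h4 : |(∑ i, f (x i)) / k - (∑ i, P.eval (x i)) / k| ≤ ε / 3 + ε / 3 := by
    rw [← sub_div, ← Finset.sum_sub_distrib, abs_div, abs_of_pos hk0, div_le_iff₀ hk0]
    refine (Finset.abs_sum_le_sum_abs _ _).trans ((Finset.sum_le_sum fun i _ =>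
      abs_sub_eval_le hf1 (R := R) (by linarith) (by positivity) (fun t ht => (hP t ht).le) s
        (x i)).trans ?_)
    rw [Finset.sum_add_distrib, Finset.sum_const, Finset.card_univ, Fintype.card_fin,
      nsmul_eq_mul, ← Finset.mul_sum, ← Finset.sum_div]
    have h5 : (∑ i, x i ^ (2 * (D + s))) / k ≤ R₀ ^ (2 * (D + s)) + 1 := by
      rcases Nat.eq_zero_or_pos (D + s) with h0 | h0
      · rw [h0, mul_zero]
        simp [hk0.ne']
      · have h6 := (abs_lt.1 (hx (2 * (D + s)) (by omega) (by omega))).2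
        have h7 := (le_abs_self _).trans (hα (D + s))
        linarith
    rw [div_le_iff₀ hk0] at h5
    have h6 : (1 + K) * ((∑ i, x i ^ (2 * (D + s))) / R ^ (2 * s)) ≤ ε / 3 * k := by
      calc (1 + K) * ((∑ i, x i ^ (2 * (D + s))) / R ^ (2 * s))
          ≤ (1 + K) * (((R₀ ^ (2 * (D + s)) + 1) * k) / R ^ (2 * s)) := by gcongr
        _ = (1 + K) * (R₀ ^ (2 * D) * ((R₀ / R) ^ 2) ^ s + ((1 / R) ^ 2) ^ s) * k := by
            rw [mul_add 2, pow_add, ← pow_mul, ← pow_mul, div_pow, div_pow, one_pow]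
            ring
        _ ≤ ε / 3 * k := by gcongr
    linarith
  have h5 := abs_sub_le ((∑ i, f (x i)) / k) ((∑ i, P.eval (x i)) / k)
    (∑ d ∈ Finset.range (D + 1), P.coeff d * α d)
  linarith

end

/-! ### Monotone rearrangements with close moments are close -/

/-- The ramp function that is `0` on `(-∞, s]`, `1` on `[t, ∞)` and linear in between. -/
def ramp (s t u : ℝ) : ℝ := max 0 (min 1 ((u - s) / (t - s)))

theorem continuous_ramp (s t : ℝ) : Continuous (ramp s t) := by
  unfold ramp
  fun_prop

theorem ramp_nonneg (s t u : ℝ) : 0 ≤ ramp s t u := le_max_left _ _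

theorem ramp_le_one (s t u : ℝ) : ramp s t u ≤ 1 := max_le zero_le_one (min_le_left _ _)

theorem ramp_of_le {s t u : ℝ} (hst : s < t) (h : u ≤ s) : ramp s t u = 0 :=
  max_eq_left ((min_le_right _ _).trans (div_nonpos_of_nonpos_of_nonneg (by linarith)
    (by linarith)))

theorem ramp_of_ge {s t u : ℝ} (hst : s < t) (h : t ≤ u) : ramp s t u = 1 := by
  have : 1 ≤ (u - s) / (t - s) := by rw [one_le_div (by linarith)]; linarith
  rw [ramp, min_eq_left this, max_eq_right zero_le_one]

/-- By monotonicity a single index where y jumps over [s, t] past x forces the ramp of y to dominate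
that of x at every index, so nothing cancels in the difference of sums. -/
theorem sum_crossing_le {k : ℕ} {x y : Fin k → ℝ} (hx : Monotone x) (hy : Monotone y) {s t : ℝ}
    (hst : s < t) : (∑ i, if x i ≤ s ∧ t ≤ y i then (1 : ℝ) else 0) ≤
      |∑ i, ramp s t (y i) - ∑ i, ramp s t (x i)| := by
  by_cases h : ∃ i, x i ≤ s ∧ t ≤ y i
  · obtain ⟨i₀, h1, h2⟩ := h
    refine le_trans ?_ (le_abs_self _)
    rw [← Finset.sum_sub_distrib]
    refine Finset.sum_le_sum fun i _ => ?_
    split_ifs with h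
    · rw [ramp_of_ge hst h.2, ramp_of_le hst h.1, sub_zero]
    · rcases le_total i i₀ with h3 | h3
      · rw [ramp_of_le hst ((hx h3).trans h1), sub_zero]
        exact ramp_nonneg _ _ _
      · rw [ramp_of_ge hst (h2.trans (hy h3)), sub_nonneg]
        exact ramp_le_one _ _ _
  · push Not at h
    rw [Finset.sum_eq_zero fun i _ => if_neg fun hi => (h i hi.1).not_ge hi.2]
    exact abs_nonneg _

/-- Truncation to the interval `[-R, R]`. -/
def truncate (R u : ℝ) : ℝ := max (-R) (min R u)

theorem truncate_mem {R : ℝ} (hR : 0 < R) (u : ℝ) : -R ≤ truncate R u ∧ truncate R u ≤ R :=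
  ⟨le_max_left _ _, max_le (by linarith) (min_le_left _ _)⟩

theorem le_truncate {R u : ℝ} (h : truncate R u < R) : u ≤ truncate R u := by
  unfold truncate at *
  rcases le_total R u with h1 | h1
  · rw [min_eq_left h1] at h
    exact absurd (le_max_right (-R) R) h.not_ge
  · rw [min_eq_right h1]
    exact le_max_right _ _

theorem truncate_le {R u : ℝ} (h : -R < truncate R u) : truncate R u ≤ u := by
  unfold truncate at *
  rcases lt_max_iff.1 h with h1 | h1
  · exact absurd h1 (lt_irrefl _)
  · rw [max_eq_right h1.le]
    exact min_le_right _ _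

theorem sub_truncate_sq_le {R : ℝ} (hR : 0 < R) (u : ℝ) :
    (u - truncate R u) ^ 2 ≤ u ^ 4 / R ^ 2 := by
  rw [le_div_iff₀ (by positivity)]
  unfold truncate
  rcases le_total R u with h1 | h1
  · rw [min_eq_left h1, max_eq_right (by linarith)]
    have h2 : (u - R) ^ 2 ≤ u ^ 2 := pow_le_pow_left₀ (by linarith) (by linarith) 2
    have h3 : R ^ 2 ≤ u ^ 2 := pow_le_pow_left₀ hR.le h1 2
    calc (u - R) ^ 2 * R ^ 2 ≤ u ^ 2 * u ^ 2 := mul_le_mul h2 h3 (by positivity) (by positivity)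
      _ = u ^ 4 := by ring
  · rw [min_eq_right h1]
    rcases le_total (-R) u with h2 | h2
    · rw [max_eq_right h2, sub_self, zero_pow two_ne_zero, zero_mul]
      positivity
    · rw [max_eq_left h2]
      have h3 : (u - -R) ^ 2 ≤ u ^ 2 := by
        rw [← neg_sq u]
        exact sq_le_sq' (by linarith) (by linarith)
      have h4 : R ^ 2 ≤ u ^ 2 := by
        rw [← neg_sq u]
        exact pow_le_pow_left₀ hR.le (by linarith) 2
      calc (u - -R) ^ 2 * R ^ 2 ≤ u ^ 2 * u ^ 2 :=
            mul_le_mul h3 h4 (by positivity) (by positivity)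
        _ = u ^ 4 := by ring

/-- The mesh points dividing `[-R, R]` into `N` intervals. -/
def meshPt (R : ℝ) (N j : ℕ) : ℝ := -R + j * (2 * R / N)

/-- A gap wider than two mesh lengths contains a whole mesh interval; j rounds its lower end up. -/
theorem exists_mesh_crossing {R : ℝ} {N : ℕ} (hR : 0 < R) (hN : 0 < N) {u v : ℝ}
    (h : truncate R u + 2 * (2 * R / N) < truncate R v) :
    ∃ j ∈ Finset.range N, u ≤ meshPt R N j ∧ meshPt R N (j + 1) ≤ v := by
  have hN0 : (0 : ℝ) < N := by exact_mod_cast hN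
  set d := 2 * R / N with hd
  have hd0 : 0 < d := by positivity
  have hu := truncate_mem hR u
  have hv := truncate_mem hR v
  set j := ⌈(truncate R u + R) / d⌉₊ with hj
  have h1 : truncate R u + R ≤ j * d := by
    rw [← div_le_iff₀ hd0]
    exact Nat.le_ceil _
  have h2 : (j : ℝ) * d < truncate R u + R + d := by
    have := Nat.ceil_lt_add_one (div_nonneg (by linarith : 0 ≤ truncate R u + R) hd0.le)
    rw [← hj, ← sub_lt_iff_lt_add, lt_div_iff₀ hd0] at this
    linarith
  have h3 : (j : ℝ) * d < N * d := by
    have : (N : ℝ) * d = 2 * R := by rw [hd]; field_simp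
    linarith
  refine ⟨j, Finset.mem_range.2 (by exact_mod_cast lt_of_mul_lt_mul_right h3 hd0.le), ?_, ?_⟩
  · have := le_truncate (R := R) (u := u) (by linarith)
    rw [meshPt]
    linarith
  · have := truncate_le (R := R) (u := v) (by linarith)
    rw [meshPt]
    push_cast
    linarith

theorem truncate_sub_sq_le {R : ℝ} {N : ℕ} (hR : 0 < R) (hN : 0 < N) (u v : ℝ) :
    (truncate R u - truncate R v) ^ 2 ≤ (2 * (2 * R / N)) ^ 2 + (2 * R) ^ 2 *
      ∑ j ∈ Finset.range N, ((if u ≤ meshPt R N j ∧ meshPt R N (j + 1) ≤ v then (1 : ℝ) else 0) +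
        (if v ≤ meshPt R N j ∧ meshPt R N (j + 1) ≤ u then (1 : ℝ) else 0)) := by
  have hN0 : (0 : ℝ) < N := by exact_mod_cast hN
  have hu := truncate_mem hR u
  have hv := truncate_mem hR v
  set T := ∑ j ∈ Finset.range N,
    ((if u ≤ meshPt R N j ∧ meshPt R N (j + 1) ≤ v then (1 : ℝ) else 0) +
      (if v ≤ meshPt R N j ∧ meshPt R N (j + 1) ≤ u then (1 : ℝ) else 0)) with hT
  have hterm : ∀ j ∈ Finset.range N,
      0 ≤ (if u ≤ meshPt R N j ∧ meshPt R N (j + 1) ≤ v then (1 : ℝ) else 0) +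
      (if v ≤ meshPt R N j ∧ meshPt R N (j + 1) ≤ u then (1 : ℝ) else 0) := fun j _ => by
    split_ifs <;> norm_num
  have hT0 : 0 ≤ T := Finset.sum_nonneg hterm
  rcases le_or_gt |truncate R u - truncate R v| (2 * (2 * R / N)) with h | h
  · have h1 : (truncate R u - truncate R v) ^ 2 ≤ (2 * (2 * R / N)) ^ 2 := by
      rw [← sq_abs]
      exact pow_le_pow_left₀ (abs_nonneg _) h 2
    have : 0 ≤ (2 * R) ^ 2 * T := by positivity
    linarith
  · have h1 : (truncate R u - truncate R v) ^ 2 ≤ (2 * R) ^ 2 :=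
      sq_le_sq' (by linarith [hu.1, hv.2]) (by linarith [hu.2, hv.1])
    have h2 : 1 ≤ T := by
      rcases lt_abs.1 h with h3 | h3
      · obtain ⟨j, hj, hj'⟩ := exists_mesh_crossing hR hN
          (show truncate R v + 2 * (2 * R / N) < truncate R u by linarith)
        refine le_trans ?_ (Finset.single_le_sum hterm hj)
        rw [if_pos hj']
        split_ifs <;> norm_num
      · obtain ⟨j, hj, hj'⟩ := exists_mesh_crossing hR hN
          (show truncate R u + 2 * (2 * R / N) < truncate R v by linarith)
        refine le_trans ?_ (Finset.single_le_sum hterm hj)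
        rw [if_pos hj']
        split_ifs <;> norm_num
    have h3 : (2 * R) ^ 2 ≤ (2 * R) ^ 2 * T := le_mul_of_one_le_right (by positivity) h2
    have : 0 ≤ (2 * (2 * R / N)) ^ 2 := by positivity
    linarith

/-- After truncation to [-R, R], entries either differ by at most two mesh lengths or cross a mesh
interval. Crossings are counted by ramp averages, which the moments nearly determine. The truncated
parts are small by the fourth moment. -/
theorem eventually_monotone_close {α : ℕ → ℝ} {R₀ : ℝ} (hR₀ : 0 ≤ R₀) (hα0 : α 0 = 1)
    (hα : ∀ q, |α (2 * q)| ≤ R₀ ^ (2 * q)) {ε : ℝ} (hε : 0 < ε) :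
    ∀ᶠ n : ℕ in atTop, ∀ k : ℕ, 1 ≤ k → ∀ x ∈ momentSet α n k (1 / (n + 1)),
      ∀ y ∈ momentSet α n k (1 / (n + 1)), Monotone x → Monotone y →
      (∑ i, (x i - y i) ^ 2) / k ≤ ε := by
  set A := |α 4| + 1 with hA
  have hA0 : 0 < A := by positivity
  -- Each tail then costs ε/18 and the middle 2ε/9; the factor 3 from squaring a sum of three terms
  -- makes the total ε.
  set R := Real.sqrt (18 * A / ε) with hR
  have hR0 : 0 < R := Real.sqrt_pos.2 (by positivity)
  have hR2 : A / R ^ 2 = ε / 18 := by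
    rw [hR, Real.sq_sqrt (by positivity)]
    field_simp
  obtain ⟨N, hN, hNε⟩ : ∃ N : ℕ, 0 < N ∧ (2 * (2 * R / N)) ^ 2 ≤ ε / 9 := by
    have h1 : Tendsto (fun N : ℕ => (2 * (2 * R / N)) ^ 2) atTop (𝓝 ((2 * 0) ^ 2)) :=
      ((tendsto_const_div_atTop_nhds_zero_nat (2 * R)).const_mul 2).pow 2
    rw [mul_zero, zero_pow two_ne_zero] at h1
    obtain ⟨N, hN1, hN2⟩ := ((h1.eventually_le_const (show 0 < ε / 9 by positivity)).and
      (eventually_gt_atTop 0)).exists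
    exact ⟨N, hN2, hN1⟩
  have hN0 : (0 : ℝ) < N := by exact_mod_cast hN
  -- The 4 counts two crossing directions and two ramp averages, each within η of its common value.
  set η := ε / 9 / ((2 * R) ^ 2 * (N * 4)) with hη
  have hη0 : 0 < η := by positivity
  have hmesh : ∀ j, meshPt R N j < meshPt R N (j + 1) := fun j => by
    have : 0 < 2 * R / N := by positivity
    rw [meshPt, meshPt]
    push_cast
    linarith
  have h1 : ∀ j, ∃ c : ℝ, ∀ᶠ n : ℕ in atTop, ∀ k : ℕ, 1 ≤ k →
      ∀ x ∈ momentSet α n k (1 / (n + 1)),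
      |(∑ i, ramp (meshPt R N j) (meshPt R N (j + 1)) (x i)) / k - c| ≤ η := fun j =>
    exists_eventually_average_close hR₀ hα0 hα (continuous_ramp _ _) (fun t => by
      rw [abs_of_nonneg (ramp_nonneg _ _ _)]
      exact ramp_le_one _ _ _) hη0
  choose c hc using h1
  have h2 := (eventually_all_finset (Finset.range N)).2 fun j (_ : j ∈ Finset.range N) => hc j
  filter_upwards [h2, eventually_ge_atTop 4, eventually_one_div_le one_pos]
    with n hn hn4 hn1 k hk x hx y hy hxm hym
  have hk0 : (0 : ℝ) < k := by exact_mod_cast hk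
  have h4 : ∀ z ∈ momentSet α n k (1 / (n + 1)), (∑ i, z i ^ 4) / k ≤ A := by
    intro z hz
    have h5 := (abs_lt.1 (hz 4 (by omega) hn4)).2
    have h6 := le_abs_self (α 4)
    linarith
  have htail : ∀ z ∈ momentSet α n k (1 / (n + 1)),
      ∑ i, (z i - truncate R (z i)) ^ 2 ≤ ε / 18 * k := by
    intro z hz
    refine (Finset.sum_le_sum fun i _ => sub_truncate_sq_le hR0 (z i)).trans ?_
    rw [← Finset.sum_div, ← hR2, div_mul_eq_mul_div]
    exact div_le_div_of_nonneg_right ((div_le_iff₀ hk0).1 (h4 z hz)) (by positivity)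
  have hcross : ∀ z ∈ momentSet α n k (1 / (n + 1)), ∀ w ∈ momentSet α n k (1 / (n + 1)),
      Monotone z → Monotone w → ∀ j ∈ Finset.range N,
      (∑ i, if z i ≤ meshPt R N j ∧ meshPt R N (j + 1) ≤ w i then (1 : ℝ) else 0) ≤
        2 * η * k := by
    intro z hz w hw hzm hwm j hj
    refine (sum_crossing_le hzm hwm (hmesh j)).trans ?_
    have h5 := hn j hj k hk z hz
    have h6 := hn j hj k hk w hw
    rw [← div_le_iff₀ hk0]
    conv_lhs => rw [← abs_of_pos hk0]
    rw [← abs_div, sub_div]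
    rw [abs_le] at h5 h6 ⊢
    constructor <;> linarith [h5.1, h5.2, h6.1, h6.2]
  have hmid : ∑ i, (truncate R (x i) - truncate R (y i)) ^ 2 ≤ (ε / 9 + ε / 9) * k := by
    refine (Finset.sum_le_sum fun i _ => truncate_sub_sq_le hR0 hN (x i) (y i)).trans ?_
    rw [Finset.sum_add_distrib, Finset.sum_const, Finset.card_univ, Fintype.card_fin,
      nsmul_eq_mul, ← Finset.mul_sum, Finset.sum_comm]
    have h5 : ∀ j ∈ Finset.range N, ∑ i,
        ((if x i ≤ meshPt R N j ∧ meshPt R N (j + 1) ≤ y i then (1 : ℝ) else 0) +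
        (if y i ≤ meshPt R N j ∧ meshPt R N (j + 1) ≤ x i then (1 : ℝ) else 0)) ≤
        4 * η * k := by
      intro j hj
      rw [Finset.sum_add_distrib]
      have := hcross x hx y hy hxm hym j hj
      have := hcross y hy x hx hym hxm j hj
      linarith
    have h6 := Finset.sum_le_sum h5
    rw [Finset.sum_const, Finset.card_range, nsmul_eq_mul] at h6
    have h7 := mul_le_mul_of_nonneg_left h6 (by positivity : 0 ≤ (2 * R) ^ 2)
    have h8 : (2 * R) ^ 2 * (N * (4 * η * k)) = ε / 9 * k := by
      rw [hη]
      field_simp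
    rw [h8] at h7
    have h9 := mul_le_mul_of_nonneg_left hNε hk0.le
    linarith
  rw [div_le_iff₀ hk0]
  have h5 : ∀ i, (x i - y i) ^ 2 ≤ 3 * ((x i - truncate R (x i)) ^ 2 +
      (truncate R (x i) - truncate R (y i)) ^ 2 + (y i - truncate R (y i)) ^ 2) := by
    intro i
    nlinarith [sq_nonneg ((x i - truncate R (x i)) - (truncate R (x i) - truncate R (y i))),
      sq_nonneg ((x i - truncate R (x i)) + (y i - truncate R (y i))),
      sq_nonneg ((truncate R (x i) - truncate R (y i)) + (y i - truncate R (y i)))]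
  refine (Finset.sum_le_sum fun i _ => h5 i).trans ?_
  rw [← Finset.mul_sum, Finset.sum_add_distrib, Finset.sum_add_distrib]
  linarith [htail x hx, htail y hy]

/-! ### Microstates of one element are approximately unitarily equivalent -/

section

variable {M : Type*} [CStarAlgebra M] {φ : M →ₗ[ℂ] ℂ}

theorem IsTracialState.exists_real_moments (hφ : IsTracialState φ) {a : M}
    (ha : IsSelfAdjoint a) : ∃ (α : ℕ → ℝ) (R : ℝ), 0 ≤ R ∧ α 0 = 1 ∧
      (∀ q, |α (2 * q)| ≤ R ^ (2 * q)) ∧ ∀ p : ℕ, φ (a ^ p) = α p := by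
  obtain ⟨μ, R, hμ, hR0, hR, hα⟩ := hφ.exists_distribution ha
  refine ⟨fun p => ∫ t, t ^ p ∂μ, R, hR0, by simp, fun q => ?_, hα⟩
  have := norm_integral_le_of_norm_le_const (μ := μ) (f := fun t : ℝ => t ^ (2 * q))
    (C := R ^ (2 * q)) (by
      filter_upwards [hR] with t ht
      rw [norm_pow, Real.norm_eq_abs]
      exact pow_le_pow_left₀ (abs_nonneg _) ht _)
  simpa using this

theorem exists_momentSet_of_mem_microstates {a : M} {α : ℕ → ℝ} (hα : ∀ p, φ (a ^ p) = α p)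
    {m k : ℕ} {γ : ℝ} {b : SaMat k} (hb : ![b] ∈ microstates φ ![a] m k γ) :
    ∃ (U : unitaryGroup (Fin k) ℂ) (x : Fin k → ℝ), Monotone x ∧ b = SaMat.conj U (SaMat.diag x) ∧
      x ∈ momentSet α m k γ := by
  obtain ⟨U, x, hx, rfl⟩ := b.exists_eq_conj_diag_monotone
  rw [single_conj_mem_microstates_iff, single_diag_mem_microstates_iff hα] at hb
  exact ⟨U, x, hx, rfl, hb⟩

theorem IsTracialState.eventually_exists_conj_close (hφ : IsTracialState φ) {a : M}
    (ha : IsSelfAdjoint a) {ε : ℝ} (hε : 0 < ε) :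
    ∀ᶠ q : ℕ in atTop, ∀ k : ℕ, 1 ≤ k → ∀ b c : SaMat k,
      ![b] ∈ microstates φ ![a] q k (1 / (q + 1)) → ![c] ∈ microstates φ ![a] q k (1 / (q + 1)) →
      ∃ U : unitaryGroup (Fin k) ℂ, ‖SaMat.conj U b - c‖ ≤ ε := by
  obtain ⟨α, R, hR, hα0, hα1, hα⟩ := hφ.exists_real_moments ha
  filter_upwards [eventually_monotone_close hR hα0 hα1 (show 0 < ε ^ 2 by positivity)]
    with q hq k hk b c hb hc
  obtain ⟨U, x, hx, rfl, hx'⟩ := exists_momentSet_of_mem_microstates hα hb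
  obtain ⟨V, y, hy, rfl, hy'⟩ := exists_momentSet_of_mem_microstates hα hc
  refine ⟨V * U⁻¹, le_of_sq_le_sq ?_ hε.le⟩
  rw [SaMat.norm_sq_conj_diag_sub]
  exact hq k hk x hx' y hy' hx hy

/-! ### Exchanging the last entry of a microstate -/

theorem mem_microstates_iff_wordProd {n : ℕ} {X : Fin n → M} {m k : ℕ} {γ : ℝ}
    {A : Fin n → SaMat k} : A ∈ microstates φ X m k γ ↔ ∀ p : ℕ, 1 ≤ p → p ≤ m →
      ∀ i : Fin p → Fin n,
      ‖ntr (wordProd A (List.ofFn i)) - φ (List.ofFn fun j => X (i j)).prod‖ < γ := by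
  simp only [wordProd, List.map_ofFn]
  rfl

theorem norm_ntr_pow_sub_lt_of_mem_microstates {n : ℕ} {X : Fin n → M} {m k p : ℕ} {γ : ℝ}
    {A : Fin n → SaMat k} (hA : A ∈ microstates φ X m k γ) (hp : 1 ≤ p) (hpm : p ≤ m) (i : Fin n) :
    ‖ntr ((A i).toMatrix ^ p) - φ (X i ^ p)‖ < γ := by
  have := hA p hp hpm fun _ => i
  simpa [List.ofFn_const] using this

theorem adjoin_last {β : Type*} {n : ℕ} (F : Fin n → β) (a : β) :
    adjoin F a (Fin.last n) = a := by
  simp [adjoin]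

theorem adjoin_castSucc {β : Type*} {n : ℕ} (F : Fin n → β) (a : β) (i : Fin n) :
    adjoin F a i.castSucc = F i := by
  simp [adjoin]

theorem comp_adjoin {β δ : Type*} {n : ℕ} (g : β → δ) (F : Fin n → β) (a : β) :
    (fun i => g (adjoin F a i)) = adjoin (fun i => g (F i)) (g a) := by
  funext i
  refine Fin.lastCases ?_ (fun i => ?_) i
  · rw [adjoin_last, adjoin_last]
  · rw [adjoin_castSucc, adjoin_castSucc]

theorem last_mem_microstates {n : ℕ} {F : Fin n → M} {a : M} {m k : ℕ} {γ : ℝ}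
    {ξ : Fin n → SaMat k} {b : SaMat k} (h : adjoin ξ b ∈ microstates φ (adjoin F a) m k γ) :
    ![b] ∈ microstates φ ![a] m k γ := by
  rw [mem_microstates_single_iff]
  intro p hp hpm
  simpa only [adjoin_last] using norm_ntr_pow_sub_lt_of_mem_microstates h hp hpm (Fin.last n)

/-- Two microstates for `a` are, up to unitary conjugation, interchangeable as the last entry of
microstates for `F ∪ {a}`. -/
theorem IsTracialState.eventually_conj_transfer (hφ : IsTracialState φ) {n : ℕ} (F : Fin n → M)
    {a : M} (ha : IsSelfAdjoint a) (m : ℕ) {γ : ℝ} (hγ : 0 < γ) :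
    ∀ᶠ q : ℕ in atTop, ∀ k : ℕ, 1 ≤ k → ∀ b c : SaMat k,
      ![b] ∈ microstates φ ![a] q k (1 / (q + 1)) → ![c] ∈ microstates φ ![a] q k (1 / (q + 1)) →
      ∃ U : unitaryGroup (Fin k) ℂ, ∀ ξ : Fin n → SaMat k,
        adjoin ξ b ∈ microstates φ (adjoin F a) q k (1 / (q + 1)) →
        adjoin (fun i => SaMat.conj U (ξ i)) c ∈ microstates φ (adjoin F a) m k γ := by
  obtain ⟨r, hr⟩ : ∃ r : ℕ, 2 * m ≤ 2 ^ r := ⟨2 * m, (Nat.lt_two_pow_self).le⟩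
  -- A common bound for the traces of 2^r-th powers, where the 1 covers the microstate tolerance.
  set C : ℝ := 1 + ∑ i, ‖φ (adjoin F a i ^ 2 ^ r)‖ with hC
  have hC1 : 1 ≤ C := le_add_of_nonneg_right (Finset.sum_nonneg fun i _ => norm_nonneg _)
  have hCs : 0 < Real.sqrt C := Real.sqrt_pos.2 (by linarith)
  -- Exchanging the letters in a word of length at most m then costs at most γ/2; the other half is
  -- the tolerance of the given microstate.
  set ε := γ / 2 / (m + 1) / Real.sqrt C with hε
  have hε0 : 0 < ε := by positivity
  have hmε : m * (ε * Real.sqrt C) ≤ γ / 2 := by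
    have h1 : (m + 1) * (ε * Real.sqrt C) = γ / 2 := by
      rw [hε]
      field_simp
    have h2 : 0 < ε * Real.sqrt C := by positivity
    linarith
  filter_upwards [hφ.eventually_exists_conj_close ha hε0, eventually_ge_atTop (2 ^ r),
    eventually_ge_atTop m, eventually_one_div_le one_pos,
    eventually_one_div_le (half_pos hγ)] with q hq hqr hqm hq1 hqγ k hk b c hb hc
  obtain ⟨U, hU⟩ := hq k hk b c hb hc
  refine ⟨U, fun ξ hξ => ?_⟩
  rw [← conj_mem_microstates_iff U, comp_adjoin (fun x => SaMat.conj U x)] at hξ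
  set A := adjoin (fun i => SaMat.conj U (ξ i)) (SaMat.conj U b) with hA
  set A' := adjoin (fun i => SaMat.conj U (ξ i)) c with hA'
  have hsum : ∀ i, ‖φ (adjoin F a i ^ 2 ^ r)‖ ≤ C - 1 := fun i => by
    rw [hC, add_sub_cancel_left]
    exact Finset.single_le_sum (f := fun i => ‖φ (adjoin F a i ^ 2 ^ r)‖)
      (fun i _ => norm_nonneg _) (Finset.mem_univ i)
  have h1 : ∀ i, ‖ntr ((A i).toMatrix ^ 2 ^ r)‖ ≤ C := by
    intro i
    have h2 := norm_ntr_pow_sub_lt_of_mem_microstates hξ Nat.one_le_two_pow hqr i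
    have h3 := norm_le_norm_add_norm_sub (φ (adjoin F a i ^ 2 ^ r)) (ntr ((A i).toMatrix ^ 2 ^ r))
    rw [norm_sub_rev] at h3
    linarith [hsum i]
  have h2 : ∀ i, ‖ntr ((A' i).toMatrix ^ 2 ^ r)‖ ≤ C := by
    intro i
    refine Fin.lastCases ?_ (fun i => ?_) i
    · have h3 := (mem_microstates_single_iff.1 hc) (2 ^ r) Nat.one_le_two_pow hqr
      have h4 := norm_le_norm_add_norm_sub (φ (a ^ 2 ^ r)) (ntr (c.toMatrix ^ 2 ^ r))
      have h5 := hsum (Fin.last n)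
      rw [norm_sub_rev] at h4
      rw [adjoin_last] at h5
      rw [hA', adjoin_last]
      linarith
    · have := h1 i.castSucc
      rw [hA, adjoin_castSucc] at this
      rwa [hA', adjoin_castSucc]
  have h3 : ∀ i, ‖A i - A' i‖ ≤ ε := by
    intro i
    refine Fin.lastCases ?_ (fun i => ?_) i
    · rw [hA, hA', adjoin_last, adjoin_last]
      exact hU
    · rw [hA, hA', adjoin_castSucc, adjoin_castSucc, sub_self, norm_zero]
      exact hε0.le
  rw [mem_microstates_iff_wordProd] at hξ ⊢
  intro p hp hpm i
  have h4 := norm_ntr_wordProd_sub_le A A' hC1 h1 h2 hr h3 (w := List.ofFn i) (by simpa using hpm)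
  rw [List.length_ofFn] at h4
  have h5 := hξ p hp (hpm.trans hqm) i
  have h6 : (p : ℝ) * (ε * Real.sqrt C) ≤ m * (ε * Real.sqrt C) :=
    mul_le_mul_of_nonneg_right (Nat.cast_le.2 hpm) (by positivity)
  have h7 := norm_sub_le_norm_sub_add_norm_sub (ntr (wordProd A' (List.ofFn i)))
    (ntr (wordProd A (List.ofFn i))) (φ (List.ofFn fun j => adjoin F a (i j)).prod)
  rw [norm_sub_rev _ (ntr (wordProd A (List.ofFn i)))] at h7
  linarith

end

/-! ### Microstate volumes are bounded -/

/-- The indicator is dominated by exp (k²(ρ - |b|²)). With this rate the Gaussian integral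
contributes -log k after normalization, which cancels the added log k. -/
theorem volume_norm_sq_le {k : ℕ} (hk : 1 ≤ k) (ρ : ℝ) :
    (volume : Measure (SaMat k)) {b | ‖b‖ ^ 2 ≤ ρ} ≤
      ENNReal.ofReal (Real.exp ((k : ℝ) ^ 2 * ρ) *
        (Real.pi / (k : ℝ) ^ 2) ^ ((k : ℝ) ^ 2 / 2)) := by
  have hc : (0 : ℝ) < (k : ℝ) ^ 2 := by positivity
  have hm : MeasurableSet {b : SaMat k | ‖b‖ ^ 2 ≤ ρ} :=
    (isClosed_le (by fun_prop) continuous_const).measurableSet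
  rw [← lintegral_indicator_one hm]
  have h1 : ∀ b : SaMat k, Set.indicator {b : SaMat k | ‖b‖ ^ 2 ≤ ρ} (1 : SaMat k → ℝ≥0∞) b ≤
      ENNReal.ofReal (Real.exp ((k : ℝ) ^ 2 * ρ)) *
        ENNReal.ofReal (Real.exp (-(k : ℝ) ^ 2 * ‖b‖ ^ 2)) := by
    intro b
    by_cases hb : ‖b‖ ^ 2 ≤ ρ
    · rw [Set.indicator_of_mem (show b ∈ {b : SaMat k | ‖b‖ ^ 2 ≤ ρ} from hb), Pi.one_apply,
        ← ENNReal.ofReal_mul (Real.exp_pos _).le, ← Real.exp_add, ENNReal.one_le_ofReal,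
        Real.one_le_exp_iff]
      have := mul_le_mul_of_nonneg_left hb hc.le
      linarith
    · rw [Set.indicator_of_notMem (show b ∉ {b : SaMat k | ‖b‖ ^ 2 ≤ ρ} from hb)]
      exact zero_le
  refine (lintegral_mono h1).trans (le_of_eq ?_)
  rw [lintegral_const_mul' _ _ ENNReal.ofReal_ne_top, lintegral_gaussian hc, finrank_saMat,
    ← ENNReal.ofReal_mul (Real.exp_pos _).le, Nat.cast_pow]

theorem normLogVol_le_of_norm_sq_le {n k : ℕ} (hk : 1 ≤ k) {S : Set (Fin n → SaMat k)} {ρ : ℝ}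
    (hS : ∀ A ∈ S, ∀ i, ‖A i‖ ^ 2 ≤ ρ) :
    normLogVol S ≤ ((n * (ρ + Real.log Real.pi / 2) : ℝ) : EReal) := by
  have hk0 : (0 : ℝ) < k := by exact_mod_cast hk
  have hpk : 0 < Real.pi / (k : ℝ) ^ 2 := by positivity
  set V := Real.exp ((k : ℝ) ^ 2 * ρ) * (Real.pi / (k : ℝ) ^ 2) ^ ((k : ℝ) ^ 2 / 2) with hV
  have hV0 : 0 < V := by positivity
  have h1 : vol n k S ≤ ENNReal.ofReal (V ^ n) := by
    calc vol n k S ≤ vol n k (Set.univ.pi fun _ => {b : SaMat k | ‖b‖ ^ 2 ≤ ρ}) :=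
          measure_mono fun A hA i _ => hS A hA i
      _ = ∏ _ : Fin n, (volume : Measure (SaMat k)) {b | ‖b‖ ^ 2 ≤ ρ} := volume_pi_pi _
      _ ≤ ∏ _ : Fin n, ENNReal.ofReal V := Finset.prod_le_prod' fun _ _ => volume_norm_sq_le hk ρ
      _ = ENNReal.ofReal (V ^ n) := by
          rw [Finset.prod_const, Finset.card_univ, Fintype.card_fin, ENNReal.ofReal_pow hV0.le]
  refine (normLogVol_le_of_le (by positivity) h1).trans (le_of_eq ?_)
  congr 1
  rw [Real.log_pow, hV, Real.log_mul (Real.exp_pos _).ne' (Real.rpow_pos_of_pos hpk _).ne',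
    Real.log_exp, Real.log_rpow hpk, Real.log_div Real.pi_pos.ne' (by positivity), Real.log_pow]
  push_cast
  field_simp
  ring

/-! ### Frequent and eventual bounds for the asymptotic entropy -/

theorem asymptoticEntropy_le_limsup {n : ℕ} (S : ∀ (_ k : ℕ) (_ : ℝ), Set (Fin n → SaMat k))
    (m : ℕ) {γ : ℝ} (hγ : 0 < γ) :
    asymptoticEntropy S ≤ limsup (fun k => normLogVol (S m k γ)) atTop :=
  iInf_le_of_le m (iInf_le_of_le γ (iInf_le _ hγ))

theorem asymptoticEntropy_le {n : ℕ} {S : ∀ (_ k : ℕ) (_ : ℝ), Set (Fin n → SaMat k)} {m : ℕ}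
    {γ : ℝ} (hγ : 0 < γ) {r : EReal} (h : ∀ᶠ k in atTop, normLogVol (S m k γ) ≤ r) :
    asymptoticEntropy S ≤ r :=
  (asymptoticEntropy_le_limsup S m hγ).trans (limsup_le_of_le (by isBoundedDefault) h)

theorem frequently_lt_normLogVol {n : ℕ} {S : ∀ (_ k : ℕ) (_ : ℝ), Set (Fin n → SaMat k)} {m : ℕ}
    {γ : ℝ} (hγ : 0 < γ) {r : EReal} (h : r < asymptoticEntropy S) :
    ∃ᶠ k in atTop, r < normLogVol (S m k γ) :=
  frequently_lt_of_lt_limsup (by isBoundedDefault)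
    (h.trans_le (asymptoticEntropy_le_limsup S m hγ))

theorem le_asymptoticEntropy {n : ℕ} {S : ∀ (_ k : ℕ) (_ : ℝ), Set (Fin n → SaMat k)} {r : EReal}
    (h : ∀ (m : ℕ) (γ : ℝ), 0 < γ → ∃ᶠ k in atTop, r ≤ normLogVol (S m k γ)) :
    r ≤ asymptoticEntropy S :=
  le_iInf fun m => le_iInf fun γ => le_iInf fun hγ =>
    le_limsup_of_frequently_le (h m γ hγ) (by isBoundedDefault)

theorem exists_eventually_normLogVol_lt {n : ℕ}
    {S : ∀ (_ k : ℕ) (_ : ℝ), Set (Fin n → SaMat k)} {r : EReal} (h : asymptoticEntropy S < r) :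
    ∃ (m : ℕ) (γ : ℝ), 0 < γ ∧ ∀ᶠ k in atTop, normLogVol (S m k γ) < r := by
  obtain ⟨m, hm⟩ := iInf_lt_iff.1 h
  obtain ⟨γ, hγ⟩ := iInf_lt_iff.1 hm
  obtain ⟨h0, h1⟩ := iInf_lt_iff.1 hγ
  exact ⟨m, γ, h0, eventually_lt_of_limsup_lt h1 (by isBoundedDefault)⟩

section

variable {M : Type*} [CStarAlgebra M] {φ : M →ₗ[ℂ] ℂ}

theorem norm_sq_le_of_mem_microstates {n : ℕ} {X : Fin n → M} {m k : ℕ} {γ : ℝ} (hm : 2 ≤ m)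
    {A : Fin n → SaMat k} (hA : A ∈ microstates φ X m k γ) (i : Fin n) :
    ‖A i‖ ^ 2 ≤ ∑ i, ‖φ (X i ^ 2)‖ + γ := by
  have h1 := norm_ntr_pow_sub_lt_of_mem_microstates hA one_le_two hm i
  have h2 := norm_le_norm_add_norm_sub (φ (X i ^ 2)) (ntr ((A i).toMatrix ^ 2))
  rw [norm_sub_rev] at h2
  have h3 : ‖A i‖ ^ 2 ≤ ‖ntr ((A i).toMatrix ^ 2)‖ := by
    rw [SaMat.norm_sq_eq_re_ntr, ← sq]
    exact Complex.re_le_norm _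
  have h4 := Finset.single_le_sum (f := fun i => ‖φ (X i ^ 2)‖) (fun i _ => norm_nonneg _)
    (Finset.mem_univ i)
  linarith

theorem freeEntropy_ne_top {n : ℕ} (X : Fin n → M) : freeEntropy φ X ≠ ⊤ := by
  refine ne_top_of_le_ne_top (EReal.coe_ne_top
    (n * (∑ i, ‖φ (X i ^ 2)‖ + 1 + Real.log Real.pi / 2) : ℝ))
    (asymptoticEntropy_le (m := 2) one_pos ?_)
  filter_upwards [eventually_ge_atTop 1] with k hk
  exact normLogVol_le_of_norm_sq_le hk fun A hA i => norm_sq_le_of_mem_microstates le_rfl hA i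

theorem relFreeEntropy_ne_top {n : ℕ} (F : Fin n → M) (a : M) (s : ∀ k : ℕ, SaMat k) :
    relFreeEntropy φ F a s ≠ ⊤ := by
  refine ne_top_of_le_ne_top (EReal.coe_ne_top
    (n * (∑ i, ‖φ (adjoin F a i ^ 2)‖ + 1 + Real.log Real.pi / 2) : ℝ))
    (asymptoticEntropy_le (m := 2) one_pos ?_)
  filter_upwards [eventually_ge_atTop 1] with k hk
  refine normLogVol_le_of_norm_sq_le hk fun A hA i => ?_
  have := norm_sq_le_of_mem_microstates le_rfl hA i.castSucc
  rwa [adjoin_castSucc] at this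

/-! ### Slices of microstate spaces -/

/-- The tuples which, followed by `b`, form a microstate for `F ∪ {a}`. -/
def microstateSlice (φ : M →ₗ[ℂ] ℂ) {n : ℕ} (F : Fin n → M) (a : M) (m : ℕ) {k : ℕ} (γ : ℝ)
    (b : SaMat k) : Set (Fin n → SaMat k) :=
  {ξ | adjoin ξ b ∈ microstates φ (adjoin F a) m k γ}

theorem continuous_adjoin {n k : ℕ} :
    Continuous fun p : SaMat k × (Fin n → SaMat k) => adjoin p.2 p.1 := by
  refine continuous_pi fun i => ?_
  refine Fin.lastCases ?_ (fun i => ?_) i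
  · simp only [adjoin_last]
    exact continuous_fst
  · simp only [adjoin_castSucc]
    exact (continuous_apply i).comp continuous_snd

theorem isOpen_microstateSlice {n : ℕ} {F : Fin n → M} {a : M} {m k : ℕ} {γ : ℝ} (b : SaMat k) :
    IsOpen (microstateSlice φ F a m γ b) :=
  isOpen_microstates.preimage (continuous_adjoin.comp (Continuous.prodMk_right b))

theorem vol_microstates_adjoin {n : ℕ} (F : Fin n → M) (a : M) (m k : ℕ) (γ : ℝ) :
    vol (n + 1) k (microstates φ (adjoin F a) m k γ) =
      ∫⁻ b : SaMat k, vol n k (microstateSlice φ F a m γ b) := by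
  have e := volume_preserving_piFinSuccAbove (fun _ : Fin (n + 1) => SaMat k) (Fin.last n)
  set T : Set (SaMat k × (Fin n → SaMat k)) :=
    {p | adjoin p.2 p.1 ∈ microstates φ (adjoin F a) m k γ} with hT
  have hTm : MeasurableSet T := (isOpen_microstates.preimage continuous_adjoin).measurableSet
  have h1 : (MeasurableEquiv.piFinSuccAbove (fun _ : Fin (n + 1) => SaMat k) (Fin.last n)) ⁻¹' T =
      microstates φ (adjoin F a) m k γ := by
    ext A
    have : adjoin (fun i : Fin n => A ((Fin.last n).succAbove i)) (A (Fin.last n)) = A := by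
      simp only [Fin.succAbove_last]
      exact Fin.snoc_init_self A
    change adjoin (fun i : Fin n => A ((Fin.last n).succAbove i)) (A (Fin.last n)) ∈
      microstates φ (adjoin F a) m k γ ↔ _
    rw [this]
  rw [vol, ← h1, e.measure_preimage hTm.nullMeasurableSet]
  exact Measure.prod_apply hTm

theorem vol_microstateSlice_le {n : ℕ} {F : Fin n → M} {a : M} {m m' k : ℕ} {γ γ' : ℝ}
    {b c : SaMat k} (U : unitaryGroup (Fin k) ℂ)
    (hU : ∀ ξ ∈ microstateSlice φ F a m γ b,
      (fun i => SaMat.conj U (ξ i)) ∈ microstateSlice φ F a m' γ' c) :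
    vol n k (microstateSlice φ F a m γ b) ≤ vol n k (microstateSlice φ F a m' γ' c) := by
  rw [← (measurePreserving_conj (n := n) U).measure_preimage
    (isOpen_microstateSlice c).measurableSet.nullMeasurableSet]
  exact measure_mono hU

/-- The unitary matching b to c embeds one slice into the other and preserves volume. -/
theorem IsTracialState.eventually_vol_slice_le (hφ : IsTracialState φ) {n : ℕ} (F : Fin n → M)
    {a : M} (ha : IsSelfAdjoint a) (m : ℕ) {γ : ℝ} (hγ : 0 < γ) :
    ∀ᶠ q : ℕ in atTop, ∀ k : ℕ, 1 ≤ k → ∀ b c : SaMat k,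
      ![b] ∈ microstates φ ![a] q k (1 / (q + 1)) → ![c] ∈ microstates φ ![a] q k (1 / (q + 1)) →
      vol n k (microstateSlice φ F a q (1 / (q + 1)) b) ≤
        vol n k (microstateSlice φ F a m γ c) := by
  filter_upwards [hφ.eventually_conj_transfer F ha m hγ] with q hq k hk b c hb hc
  obtain ⟨U, hU⟩ := hq k hk b c hb hc
  exact vol_microstateSlice_le U hU

theorem normLogVol_of_vol_eq_mul {n k : ℕ} {T : Set (Fin n → SaMat k)} {T' : Set (Fin 1 → SaMat k)} {L : EReal}
    (hL : L = ((((k : ℝ) ^ 2)⁻¹ : ℝ) : EReal) * ENNReal.log (vol n k T * vol 1 k T') +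
      (((n + 1 : ℕ) * Real.log k : ℝ) : EReal)) :
    L = normLogVol T + normLogVol T' := by
  rw [hL, normLogVol, normLogVol, ENNReal.log_mul_add, EReal.left_distrib_of_nonneg_of_ne_top
    (EReal.coe_nonneg.2 (by positivity)) (EReal.coe_ne_top _), add_add_add_comm, ← EReal.coe_add]
  congr 2
  push_cast
  ring

theorem normLogVol_le_add {n k : ℕ} {S : Set (Fin (n + 1) → SaMat k)}
    {T : Set (Fin n → SaMat k)} {T' : Set (Fin 1 → SaMat k)}
    (h : vol (n + 1) k S ≤ vol n k T * vol 1 k T') :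
    normLogVol S ≤ normLogVol T + normLogVol T' := by
  rw [← normLogVol_of_vol_eq_mul rfl]
  exact add_le_add_left (mul_log_le_mul_log (by positivity) h) _

theorem add_le_normLogVol {n k : ℕ} {S : Set (Fin (n + 1) → SaMat k)}
    {T : Set (Fin n → SaMat k)} {T' : Set (Fin 1 → SaMat k)}
    (h : vol n k T * vol 1 k T' ≤ vol (n + 1) k S) :
    normLogVol T + normLogVol T' ≤ normLogVol S := by
  rw [← normLogVol_of_vol_eq_mul rfl]
  exact add_le_add_left (mul_log_le_mul_log (by positivity) h) _

theorem measurableSet_single_microstates {a : M} {m k : ℕ} {γ : ℝ} :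
    MeasurableSet {b : SaMat k | ![b] ∈ microstates φ ![a] m k γ} := by
  have hc : Continuous fun b : SaMat k => ![b] :=
    continuous_pi fun i => by rw [Subsingleton.elim i 0]; exact continuous_id
  exact (isOpen_microstates.preimage hc).measurableSet

/-- If every slice over a microstate for `a` has volume at most `V`, so has the microstate space of
`F ∪ {a}` relative to that of `a`. -/
theorem vol_microstates_adjoin_le {n : ℕ} {F : Fin n → M} {a : M} {m k : ℕ} {γ : ℝ} {V : ℝ≥0∞}
    (h : ∀ b : SaMat k, ![b] ∈ microstates φ ![a] m k γ →
      vol n k (microstateSlice φ F a m γ b) ≤ V) :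
    vol (n + 1) k (microstates φ (adjoin F a) m k γ) ≤
      V * vol 1 k (microstates φ ![a] m k γ) := by
  rw [vol_microstates_adjoin, vol_one_eq, ← lintegral_indicator_const
    measurableSet_single_microstates]
  refine lintegral_mono fun b => ?_
  by_cases hb : ![b] ∈ microstates φ ![a] m k γ
  · rw [Set.indicator_of_mem (s := {b | ![b] ∈ microstates φ ![a] m k γ}) hb]
    exact h b hb
  · have : microstateSlice φ F a m γ b = ∅ :=
      Set.eq_empty_iff_forall_notMem.2 fun ξ hξ => hb (last_mem_microstates hξ)
    rw [this, measure_empty]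
    exact zero_le

theorem le_vol_microstates_adjoin {n : ℕ} {F : Fin n → M} {a : M} {m m' k : ℕ} {γ γ' : ℝ}
    {V : ℝ≥0∞} (h : ∀ b : SaMat k, ![b] ∈ microstates φ ![a] m' k γ' →
      V ≤ vol n k (microstateSlice φ F a m γ b)) :
    V * vol 1 k (microstates φ ![a] m' k γ') ≤
      vol (n + 1) k (microstates φ (adjoin F a) m k γ) := by
  rw [vol_microstates_adjoin, vol_one_eq, ← lintegral_indicator_const
    measurableSet_single_microstates]
  refine lintegral_mono fun b => ?_
  by_cases hb : ![b] ∈ microstates φ ![a] m' k γ'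
  · rw [Set.indicator_of_mem (s := {b | ![b] ∈ microstates φ ![a] m' k γ'}) hb]
    exact h b hb
  · rw [Set.indicator_of_notMem (s := {b | ![b] ∈ microstates φ ![a] m' k γ'}) hb]
    exact zero_le

/-! ### The entropy formula -/

/-- Both sets Ξ are slices over microstates of a, so at a finer tolerance the first is no larger
than the second. -/
theorem IsTracialState.relFreeEntropy_le (hφ : IsTracialState φ) {n : ℕ} (F : Fin n → M) {a : M}
    (ha : IsSelfAdjoint a) {s t : ∀ k : ℕ, SaMat k} (hs : IsMicrostateSeq φ a s)
    (ht : IsMicrostateSeq φ a t) : relFreeEntropy φ F a s ≤ relFreeEntropy φ F a t := by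
  refine le_of_forall_lt_imp_le_of_dense fun r hr => le_asymptoticEntropy fun m γ hγ => ?_
  obtain ⟨q, hq⟩ := (hφ.eventually_vol_slice_le F ha m hγ).exists
  have hq0 : (0 : ℝ) < 1 / (q + 1) := by positivity
  refine ((frequently_lt_normLogVol (m := q) hq0 hr).and_eventually ((hs.approx q _ hq0).and
    ((ht.approx q _ hq0).and (eventually_ge_atTop 1)))).mono ?_
  rintro k ⟨h1, h2, h3, hk⟩
  exact h1.le.trans (normLogVol_mono (hq k hk (s k) (t k) h2 h3))

/-- Every slice at fine tolerance is at most the coarse slice over s k, which bounds the Fubini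
integral by a product. -/
theorem IsTracialState.freeEntropy_adjoin_le (hφ : IsTracialState φ) {n : ℕ} (F : Fin n → M)
    {a : M} (ha : IsSelfAdjoint a) {s : ∀ k : ℕ, SaMat k} (hs : IsMicrostateSeq φ a s) :
    freeEntropy φ (adjoin F a) ≤ relFreeEntropy φ F a s + freeEntropy φ ![a] := by
  -- Neither summand is ⊤, which rules out an indeterminate sum.
  refine EReal.le_add_of_forall_gt (.inr (freeEntropy_ne_top _))
    (.inl (relFreeEntropy_ne_top _ _ _)) fun x hx y hy => ?_
  obtain ⟨m, γ, hγ, h1⟩ := exists_eventually_normLogVol_lt hx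
  obtain ⟨m', γ', hγ', h2⟩ := exists_eventually_normLogVol_lt hy
  obtain ⟨q, hq, hqm, hqγ⟩ := ((hφ.eventually_vol_slice_le F ha m hγ).and
    ((eventually_ge_atTop m').and (eventually_one_div_le hγ'))).exists
  have hq0 : (0 : ℝ) < 1 / (q + 1) := by positivity
  refine asymptoticEntropy_le (m := q) hq0 ?_
  filter_upwards [h1, h2, hs.approx q _ hq0, eventually_ge_atTop 1] with k hk1 hk2 hk3 hk
  refine (normLogVol_le_add (vol_microstates_adjoin_le fun b hb =>
    hq k hk b (s k) hb hk3)).trans (add_le_add hk1.le ?_)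
  exact (normLogVol_mono (measure_mono (microstates_mono hqm hqγ))).trans hk2.le

/-- Every coarse slice is at least the fine slice over s k. The latter is known to be large only for
infinitely many k, so the volume for a must be large for all large k; `eventually_le_single`
supplies this. -/
theorem IsTracialState.le_freeEntropy_adjoin (hφ : IsTracialState φ) {n : ℕ} (F : Fin n → M)
    {a : M} (ha : IsSelfAdjoint a) {s : ∀ k : ℕ, SaMat k} (hs : IsMicrostateSeq φ a s) :
    relFreeEntropy φ F a s + freeEntropy φ ![a] ≤ freeEntropy φ (adjoin F a) := by
  obtain ⟨α, -, -, -, -, hα⟩ := hφ.exists_real_moments ha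
  refine EReal.add_le_of_forall_lt fun x hx y hy => ?_
  obtain ⟨y', hy1, hy2⟩ := EReal.lt_iff_exists_real_btwn.1 hy
  refine le_asymptoticEntropy fun m γ hγ => ?_
  obtain ⟨q, hq⟩ := (hφ.eventually_vol_slice_le F ha m hγ).exists
  have hq0 : (0 : ℝ) < 1 / (q + 1) := by positivity
  refine ((frequently_lt_normLogVol (m := q) hq0 hx).and_eventually ((hs.approx q _ hq0).and
    ((eventually_le_single hα q hq0 hy2).and (eventually_ge_atTop 1)))).mono ?_
  rintro k ⟨h1, h2, h3, hk⟩
  exact (add_le_add h1.le (hy1.le.trans h3)).trans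
    (add_le_normLogVol (le_vol_microstates_adjoin fun b hb => hq k hk (s k) b h2 hb))

end

end FreeEntropy

end

theorem lemma2p3 {M : Type*} [CStarAlgebra M] [WStarAlgebra M] (φ : M →ₗ[ℂ] ℂ)
    (hφ : FreeEntropy.IsTracialState φ) {n : ℕ} (F : Fin n → M) (hF : ∀ i, IsSelfAdjoint (F i))
    (a : M) (ha : IsSelfAdjoint a) :
    -- norm-bounded microstate sequences for `a` exist
    (∃ s : ∀ k : ℕ, FreeEntropy.SaMat k, FreeEntropy.IsMicrostateSeq φ a s) ∧
    -- the relative free entropy does not depend on the sequence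
    (∀ s t : ∀ k : ℕ, FreeEntropy.SaMat k,
      FreeEntropy.IsMicrostateSeq φ a s → FreeEntropy.IsMicrostateSeq φ a t →
      FreeEntropy.relFreeEntropy φ F a s = FreeEntropy.relFreeEntropy φ F a t) ∧
    -- the entropy formula, both summands lying in `[-∞, ∞)`
    (∀ s : ∀ k : ℕ, FreeEntropy.SaMat k, FreeEntropy.IsMicrostateSeq φ a s →
      FreeEntropy.relFreeEntropy φ F a s ≠ ⊤ ∧ FreeEntropy.freeEntropy φ ![a] ≠ ⊤ ∧
      FreeEntropy.freeEntropy φ (FreeEntropy.adjoin F a) =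
        FreeEntropy.relFreeEntropy φ F a s + FreeEntropy.freeEntropy φ ![a]) := by
  exact ⟨hφ.exists_isMicrostateSeq ha,
    fun _ _ hs ht => le_antisymm (hφ.relFreeEntropy_le F ha hs ht) (hφ.relFreeEntropy_le F ha ht hs),
    fun _ hs => ⟨FreeEntropy.relFreeEntropy_ne_top _ _ _, FreeEntropy.freeEntropy_ne_top _,
      le_antisymm (hφ.freeEntropy_adjoin_le F ha hs) (hφ.le_freeEntropy_adjoin F ha hs)⟩⟩
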